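/- Let $k$ be a field, $J$ a set and $\theta\colon J\to J$ an involution. Let $Q=(Q_{ij})_{i,j\in J}$ with $Q_{ij}\in k[u,v]$ satisfy (M1) $Q_{ii}=0$, (M2) $Q_{ij}(u,v)=Q_{\theta(j)\theta(i)}(-v,-u)$ and (M3) $Q_{ij}\neq 0$ for $i\ne j$; let $Q'=(Q_i)_{i\in J}$ with $Q_i\in k[u]$ satisfy (V1) $Q_i=0$ if $\theta(i)=i$ and (V2) $Q_i\ne0$ if $\theta(i)\neq i$. Call $Q$ and $Q'$ perfect if moreover (M4) $Q_{ij}(u,v)=Q_{ji}(v,u)$ for all $i,j$, respectively (V3) $Q_i(u)=Q_{\theta(i)}(-u)$ for all $i$. Let $n\ge 1$, and let $\beta\in\mathbb N[J]$ be $\theta$-invariant, with $\beta(i)$ even whenever $\theta(i)=i$, and $\sum_i\beta(i)=2n$. Let ${}^\theta J^\beta$ be the (finite) set of $\nu=\nu_1\cdots\nu_n\in J^n$ with $\sum_l(\nu_l+\theta(\nu_l))=\beta$. Let $\mathfrak W_n=\langle s_0,\dots,s_{n-1}\rangle$ be the Weyl group of type $B_n$ ($s_0s_1$ of order $4$ if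 $n\ge2$). It acts on ${}^\theta J^\beta$: $s_0$ replaces $\nu_1$ by $\theta(\nu_1)$, and $s_k$ ($k\ge1$) exchanges $\nu_k$ and $\nu_{k+1}$. It acts on $k[x_1,\dots,x_n]$: $s_0$ changes the sign of $x_1$, and $s_k$ exchanges $x_k$ and $x_{k+1}$. The orientifold KLR algebra ${}^\theta\mathcal R(\beta)$ is the unital $k$-algebra generated by $e(\nu)$ ($\nu\in{}^\theta J^\beta$), $x_1,\dots,x_n$, $\tau_0,\dots,\tau_{n-1}$ with the relations * $e(\nu)e(\nu')=\delta_{\nu\nu'}e(\nu)$, $\sum_\nu e(\nu)=1$, $x_le(\nu)=e(\nu)x_l$, $\tau_ke(\nu)=e(s_k\nu)\tau_k$, $x_lx_{l'}=x_{l'}x_l$; * $\tau_k^2e(\nu)=Q_{\nu_k,\nu_{k+1}}(x_{k+1},x_k)e(\nu)$ for $k\ge1$, and $\tau_0^2e(\nu)=Q_{\nu_1}(-x_1)e(\nu)$; * $\tau_k\tau_{k'}=\tau_{k'}\tau_k$ if $|k-k'|>1$; * $(\tau_{k+1}\tau_k\tau_{k+1}-\tau_k\tau_{k+1}\tau_k)e(\nu)=\delta_{\nu_k,\nu_{k+2}}\frac{Q_{\nu_k,\nu_{k+1}}(x_{k+1},x_k)-Q_{\nu_k,\nu_{k+1}}(x_{k+1},x_{k+2})}{x_k-x_{k+2}}e(\nu)$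 for $k\ge1$; * $((\tau_1\tau_0)^2-(\tau_0\tau_1)^2)e(\nu)$ equals $\frac{Q_{\nu_2}(x_2)-Q_{\nu_1}(x_1)}{x_1+x_2}\tau_1e(\nu)$ if $\nu_1\ne\nu_2=\theta(\nu_1)$; $\frac{Q_{\nu_1,\nu_2}(x_2,-x_1)-Q_{\nu_1,\nu_2}(-x_2,-x_1)}{x_2}\tau_0e(\nu)$ if $\nu_1\ne\theta(\nu_1)$ and $\nu_2=\theta(\nu_2)$; $\frac{Q_{\nu_1,\nu_2}(x_2,-x_1)-Q_{\nu_1,\nu_2}(x_2,x_1)}{x_1x_2}(x_1\tau_0+1)e(\nu)$ if $\theta(\nu_1)=\nu_1\ne\nu_2=\theta(\nu_2)$; and $0$ otherwise; * for $k\ge1$, $(\tau_kx_l-x_{s_k(l)}\tau_k)e(\nu)$ equals $-e(\nu)$ if $l=k$ and $\nu_k=\nu_{k+1}$, $e(\nu)$ if $l=k+1$ and $\nu_k=\nu_{k+1}$, and $0$ otherwise; $(\tau_0x_1+x_1\tau_0)e(\nu)$ equals $-2e(\nu)$ if $\theta(\nu_1)=\nu_1$ and $0$ otherwise; $\tau_0x_l=x_l\tau_0$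 for $l\neq1$. (A relation $b=\frac{p}{q}c$ whose fraction $p/q$ is not a polynomial is read as the relations $d\,b=g\,c$ for all polynomials $g,d$ with $gq=dp$.) Filter ${}^\theta\mathcal R(\beta)$ by $\deg e(\nu)=\deg x_l=0$, $\deg\tau_k=1$. Let ${}^0\mathcal H_n\ltimes P_\beta$ be the semidirect product of the nil-Hecke algebra of type $B_n$ (generators $T_0,\dots,T_{n-1}$, with $T_k^2=0$ and the braid relations) with $P_\beta=\bigoplus_\nu k[x_1,\dots,x_n]e(\nu)$, that is, $T_k\,f e(\nu)=s_k(f)e(s_k\nu)\,T_k$, graded by $\deg T_k=1$ and $\deg P_\beta=0$. For each $w\in\mathfrak W_n$ choose a reduced expression $w=s_{k_1}\cdots s_{k_l}$ and put $\tau_w=\tau_{k_1}\cdots\tau_{k_l}$. (A) For every $\beta$ as above the following are equivalent: 1. ${}^\theta\mathcal R(\beta)$ satisfies the PBW property: $\operatorname{gr}{}^\theta\mathcal R(\beta)\cong{}^0\mathcal H_n\ltimes P_\beta$ as graded algebras; 1'. there is such an isomorphism that sends the symbols of $e(\nu),x_l,\tau_k$ to $e(\nu),x_l,T_k$; 2.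 $\{\tau_wx_1^{a_1}\cdots x_n^{a_n}e(\nu)\mid w\in\mathfrak W_n,\ a\in\mathbb Z_{\ge0}^n,\ \nu\in{}^\theta J^\beta\}$ is a $k$-basis of ${}^\theta\mathcal R(\beta)$; 3. the identities in (M4) and (V3) hold for all entries of $Q$ and $Q'$ which $\beta$ involves, i.e. $Q_{ij}(u,v)=Q_{ji}(v,u)$ whenever $i,j$ are consecutive entries of some $\nu\in{}^\theta J^\beta$, and $Q_i(u)=Q_{\theta(i)}(-u)$ whenever $i$ is an entry of some $\nu\in{}^\theta J^\beta$. (B) If $n\ge2$, then the following are equivalent: (1) holds for all such $\beta$ (with $\sum_i\beta(i)=2n$); (1') holds for all such $\beta$; (2) holds for all such $\beta$; $Q$ and $Q'$ are perfect. -/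

import Mathlib

open scoped DirectSum

noncomputable section

/-! ### Filtered algebras and their associated graded algebras -/

/-- An increasing filtration `F 0 ≤ F 1 ≤ ⋯` of a `k`-algebra by subspaces,
compatible with the multiplication. -/
structure AlgFiltration (k A : Type*) [CommRing k] [Ring A] [Algebra k A] where
  F : ℕ → Submodule k A
  mono : Monotone F
  one_mem : (1 : A) ∈ F 0
  mul_mem : ∀ {i j : ℕ} {a b : A}, a ∈ F i → b ∈ F j → a * b ∈ F (i + j)

namespace AlgFiltration

variable {k A : Type*} [CommRing k] [Ring A] [Algebra k A] (𝓕 : AlgFiltration k A)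

/-- `F (d - 1)`, with the convention `F (-1) = 0`. -/
def lt : ℕ → Submodule k A
  | 0 => ⊥
  | d + 1 => 𝓕.F d

/-- The graded piece `F d / F (d - 1)`. -/
def Piece (d : ℕ) : Type _ := 𝓕.F d ⧸ (𝓕.lt d).comap (𝓕.F d).subtype

instance (d : ℕ) : AddCommGroup (𝓕.Piece d) :=
  inferInstanceAs (AddCommGroup (𝓕.F d ⧸ (𝓕.lt d).comap (𝓕.F d).subtype))

instance (d : ℕ) : Module k (𝓕.Piece d) :=
  inferInstanceAs (Module k (𝓕.F d ⧸ (𝓕.lt d).comap (𝓕.F d).subtype))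

/-- The projection `F d → F d / F (d - 1)`. -/
def proj (d : ℕ) : 𝓕.F d →ₗ[k] 𝓕.Piece d := Submodule.mkQ ((𝓕.lt d).comap (𝓕.F d).subtype)

theorem proj_surjective (d : ℕ) : Function.Surjective (𝓕.proj d) := Submodule.mkQ_surjective _

theorem ker_proj (d : ℕ) : LinearMap.ker (𝓕.proj d) = (𝓕.lt d).comap (𝓕.F d).subtype :=
  Submodule.ker_mkQ _

/-- The class in `F d / F (d - 1)` of an element of `F d`. -/
def cls {d : ℕ} (a : A) (ha : a ∈ 𝓕.F d) : 𝓕.Piece d := 𝓕.proj d ⟨a, ha⟩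

theorem mul_mem_lt_left {i j : ℕ} {a b : A} (ha : a ∈ 𝓕.lt i) (hb : b ∈ 𝓕.F j) :
    a * b ∈ 𝓕.lt (i + j) := by
  cases i with
  | zero =>
    have : a = 0 := by simpa [lt] using ha
    simp [this]
  | succ i =>
    have h := 𝓕.mul_mem (show a ∈ 𝓕.F i from ha) hb
    have e : i + 1 + j = (i + j) + 1 := by omega
    rw [e]
    exact h

theorem mul_mem_lt_right {i j : ℕ} {a b : A} (ha : a ∈ 𝓕.F i) (hb : b ∈ 𝓕.lt j) :
    a * b ∈ 𝓕.lt (i + j) := by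
  cases j with
  | zero =>
    have : b = 0 := by simpa [lt] using hb
    simp [this]
  | succ j => exact 𝓕.mul_mem ha (show b ∈ 𝓕.F j from hb)

/-- Multiplication `F i × F j → F (i + j)`. -/
def mulF (i j : ℕ) : 𝓕.F i →ₗ[k] 𝓕.F j →ₗ[k] 𝓕.F (i + j) :=
  LinearMap.mk₂ k (fun a b => ⟨a.1 * b.1, 𝓕.mul_mem a.2 b.2⟩)
    (fun _ _ _ => Subtype.ext (add_mul _ _ _))
    (fun _ _ _ => Subtype.ext (smul_mul_assoc _ _ _))
    (fun _ _ _ => Subtype.ext (mul_add _ _ _))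
    (fun _ _ _ => Subtype.ext (mul_smul_comm _ _ _))

/-- The induced multiplication of the graded pieces. -/
def mulPiece (i j : ℕ) : 𝓕.Piece i →ₗ[k] 𝓕.Piece j →ₗ[k] 𝓕.Piece (i + j) :=
  Submodule.liftQ ((𝓕.lt i).comap (𝓕.F i).subtype)
    (LinearMap.flip (Submodule.liftQ ((𝓕.lt j).comap (𝓕.F j).subtype)
      (LinearMap.flip ((𝓕.mulF i j).compr₂ (𝓕.proj (i + j))))
      (fun b hb => by
        rw [LinearMap.mem_ker]
        ext a
        change 𝓕.mulF i j a b ∈ LinearMap.ker (𝓕.proj (i + j))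
        rw [ker_proj, Submodule.mem_comap]
        exact 𝓕.mul_mem_lt_right a.2 (Submodule.mem_comap.mp hb))))
    (fun a ha => by
      rw [LinearMap.mem_ker]
      refine LinearMap.ext fun y => ?_
      obtain ⟨b, rfl⟩ := Submodule.mkQ_surjective _ y
      change 𝓕.mulF i j a b ∈ LinearMap.ker (𝓕.proj (i + j))
      rw [ker_proj, Submodule.mem_comap]
      exact 𝓕.mul_mem_lt_left (Submodule.mem_comap.mp ha) b.2)

instance : GradedMonoid.GMul 𝓕.Piece where
  mul := fun {i j} a b => 𝓕.mulPiece i j a b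

instance : GradedMonoid.GOne 𝓕.Piece where
  one := 𝓕.cls 1 𝓕.one_mem

theorem cls_mul_cls {i j : ℕ} {a b : A} (ha : a ∈ 𝓕.F i) (hb : b ∈ 𝓕.F j) :
    GradedMonoid.GMul.mul (𝓕.cls a ha) (𝓕.cls b hb) = 𝓕.cls (a * b) (𝓕.mul_mem ha hb) := rfl

theorem exists_cls {d : ℕ} (x : 𝓕.Piece d) : ∃ (a : A) (ha : a ∈ 𝓕.F d), x = 𝓕.cls a ha := by
  obtain ⟨⟨a, ha⟩, rfl⟩ := 𝓕.proj_surjective d x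
  exact ⟨a, ha, rfl⟩

theorem mk_cls_eq {i j : ℕ} (h : i = j) {a b : A} (hab : a = b) (ha : a ∈ 𝓕.F i)
    (hb : b ∈ 𝓕.F j) :
    (GradedMonoid.mk i (𝓕.cls a ha) : GradedMonoid 𝓕.Piece) = GradedMonoid.mk j (𝓕.cls b hb) := by
  subst h
  subst hab
  rfl

theorem algebraMap_mem (c : k) : algebraMap k A c ∈ 𝓕.F 0 := by
  rw [Algebra.algebraMap_eq_smul_one]
  exact (𝓕.F 0).smul_mem c 𝓕.one_mem

instance : DirectSum.GRing 𝓕.Piece where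
  mul_zero := fun {i j} a => map_zero (𝓕.mulPiece i j a)
  zero_mul := fun {i j} b => by
    change 𝓕.mulPiece i j 0 b = 0
    simp
  mul_add := fun {i j} a b c => map_add (𝓕.mulPiece i j a) b c
  add_mul := fun {i j} a b c => by
    change 𝓕.mulPiece i j (a + b) c = 𝓕.mulPiece i j a c + 𝓕.mulPiece i j b c
    simp
  one_mul := by
    rintro ⟨i, x⟩
    obtain ⟨a, ha, rfl⟩ := 𝓕.exists_cls x
    exact 𝓕.mk_cls_eq (zero_add i) (one_mul a) _ _
  mul_one := by
    rintro ⟨i, x⟩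
    obtain ⟨a, ha, rfl⟩ := 𝓕.exists_cls x
    exact 𝓕.mk_cls_eq (add_zero i) (mul_one a) _ _
  mul_assoc := by
    rintro ⟨i, x⟩ ⟨j, y⟩ ⟨l, z⟩
    obtain ⟨a, ha, rfl⟩ := 𝓕.exists_cls x
    obtain ⟨b, hb, rfl⟩ := 𝓕.exists_cls y
    obtain ⟨c, hc, rfl⟩ := 𝓕.exists_cls z
    exact 𝓕.mk_cls_eq (add_assoc i j l) (mul_assoc a b c) _ _
  natCast := fun m => m • 𝓕.cls 1 𝓕.one_mem
  natCast_zero := zero_smul _ _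
  natCast_succ := fun m => succ_nsmul _ _
  intCast := fun m => m • 𝓕.cls 1 𝓕.one_mem
  intCast_ofNat := fun m => natCast_zsmul _ _
  intCast_negSucc_ofNat := fun m => negSucc_zsmul _ _

instance : DirectSum.GAlgebra k 𝓕.Piece where
  toFun :=
    { toFun := fun c => 𝓕.cls (algebraMap k A c) (𝓕.algebraMap_mem c)
      map_zero' := by
        rw [cls, ← map_zero (𝓕.proj 0)]
        congr 1
        exact Subtype.ext (map_zero _)
      map_add' := fun c c' => by
        rw [cls, cls, cls, ← map_add]
        congr 1
        exact Subtype.ext (map_add _ _ _) }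
  map_one := by
    change 𝓕.cls _ _ = 𝓕.cls _ _
    congr 1
    exact map_one _
  map_mul := fun r s => 𝓕.mk_cls_eq (zero_add 0).symm (map_mul _ _ _) _ _
  commutes := by
    rintro r ⟨i, x⟩
    obtain ⟨a, ha, rfl⟩ := 𝓕.exists_cls x
    exact 𝓕.mk_cls_eq ((zero_add i).trans (add_zero i).symm) (Algebra.commutes r a) _ _
  smul_def := by
    rintro r ⟨i, x⟩
    obtain ⟨a, ha, rfl⟩ := 𝓕.exists_cls x
    exact 𝓕.mk_cls_eq (zero_add i).symm (Algebra.smul_def r a) ((𝓕.F i).smul_mem r ha) _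

/-- The associated graded algebra `gr A = ⨁ d, F d / F (d - 1)`. -/
abbrev Gr : Type _ := ⨁ d, 𝓕.Piece d

/-- The symbol in degree `d` of an element of `F d`. -/
def symbol (d : ℕ) (a : A) (ha : a ∈ 𝓕.F d) : 𝓕.Gr := DirectSum.of 𝓕.Piece d (𝓕.cls a ha)

/-- The homogeneous component of degree `d` of the associated graded algebra. -/
def grPiece (d : ℕ) : Submodule k 𝓕.Gr := LinearMap.range (DirectSum.lof k ℕ 𝓕.Piece d)

end AlgFiltration

/-! ### Filtrations and gradings by degrees of generators -/

/-- The span of all products of the elements `g s` of total degree at most `d`. -/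
def spanDegLE (k : Type*) {A G : Type*} [CommRing k] [Ring A] [Algebra k A]
    (g : G → A) (deg : G → ℕ) (d : ℕ) : Submodule k A :=
  Submodule.span k {a | ∃ l : List G, (l.map deg).sum ≤ d ∧ (l.map g).prod = a}

/-- The span of all products of the elements `g s` of total degree exactly `d`. -/
def spanDegEq (k : Type*) {A G : Type*} [CommRing k] [Ring A] [Algebra k A]
    (g : G → A) (deg : G → ℕ) (d : ℕ) : Submodule k A :=
  Submodule.span k {a | ∃ l : List G, (l.map deg).sum = d ∧ (l.map g).prod = a}

/-- The filtration of an algebra determined by assigning degrees to a family of elements. -/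
def degFiltration (k : Type*) {A G : Type*} [CommRing k] [Ring A] [Algebra k A]
    (g : G → A) (deg : G → ℕ) : AlgFiltration k A where
  F := spanDegLE k g deg
  mono := fun i j hij => Submodule.span_mono (by
    rintro a ⟨l, hl, rfl⟩
    exact ⟨l, hl.trans hij, rfl⟩)
  one_mem := Submodule.subset_span ⟨[], by simp, by simp⟩
  mul_mem := by
    intro i j a b ha hb
    have h := Submodule.mul_mem_mul ha hb
    rw [spanDegLE, spanDegLE, Submodule.span_mul_span] at h
    refine Submodule.span_mono ?_ h
    rintro _ ⟨_, ⟨l, hl, rfl⟩, _, ⟨l', hl', rfl⟩, rfl⟩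
    exact ⟨l ++ l', by simpa using add_le_add hl hl', by simp⟩

theorem mem_degFiltration (k : Type*) {A G : Type*} [CommRing k] [Ring A] [Algebra k A]
    (g : G → A) (deg : G → ℕ) (s : G) (d : ℕ) (h : deg s ≤ d) :
    g s ∈ (degFiltration k g deg).F d :=
  Submodule.subset_span ⟨[s], by simpa using h, by simp⟩

/-! ### Ordered monomials and polynomials in a finite family of elements -/

/-- The product `X 0 ^ a 0 * X 1 ^ a 1 * ⋯ * X (n - 1) ^ a (n - 1)`, in this order. -/
def ordMonomial {A : Type*} [Monoid A] {n : ℕ} (X : Fin n → A) (a : Fin n → ℕ) : A :=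
  (List.ofFn fun l => X l ^ a l).prod

/-- The value of a polynomial at a family of elements, monomials being written in the order of the
indices; for commuting elements this is the usual evaluation. -/
def ordEval {k A : Type*} [CommRing k] [Ring A] [Algebra k A] {n : ℕ} (X : Fin n → A)
    (p : MvPolynomial (Fin n) k) : A :=
  ∑ a ∈ p.support, p.coeff a • ordMonomial X a

/-! ### Coefficient matrices and vectors -/

/-- A set `J` with an involution `θ`, a coefficient matrix `Q` with entries in `k[u, v]`
(`u` is the variable `0`, `v` the variable `1`) and a coefficient vector `Q'` with entries
in `k[u]`. -/
structure CoeffDatum (k J : Type*) [Field k] where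
  θ : J → J
  θ_invol : Function.Involutive θ
  Q : J → J → MvPolynomial (Fin 2) k
  Q' : J → Polynomial k

namespace CoeffDatum

variable {k J : Type*} [Field k] (D : CoeffDatum k J)

/-- `f(a, b)` for `f ∈ k[u, v]`. -/
def subst₂ {σ : Type*} (f : MvPolynomial (Fin 2) k) (a b : MvPolynomial σ k) : MvPolynomial σ k :=
  MvPolynomial.aeval ![a, b] f

/-- (M1): `Q_{ii} = 0`. -/
def MatRegular : Prop := ∀ i, D.Q i i = 0

/-- (M2): `Q_{ij}(u, v) = Q_{θ(j)θ(i)}(-v, -u)`. -/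
def MatThetaSymmetric : Prop :=
  ∀ i j, D.Q i j = subst₂ (D.Q (D.θ j) (D.θ i)) (-MvPolynomial.X 1) (-MvPolynomial.X 0)

/-- (M3): `Q_{ij} ≠ 0` for `i ≠ j`. -/
def MatNonvanishing : Prop := ∀ i j, i ≠ j → D.Q i j ≠ 0

/-- `Q_{ij}(u, v) = Q_{ji}(v, u)` for the given `i`, `j`. -/
def HermitianAt (i j : J) : Prop :=
  D.Q i j = subst₂ (D.Q j i) (MvPolynomial.X 1) (MvPolynomial.X 0)

/-- (M4): `Q_{ij}(u, v) = Q_{ji}(v, u)` for all `i`, `j`. -/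
def MatHermitian : Prop := ∀ i j, D.HermitianAt i j

/-- (V1): `Q_i = 0` for `θ(i) = i`. -/
def VecRegular : Prop := ∀ i, D.θ i = i → D.Q' i = 0

/-- (V2): `Q_i ≠ 0` for `θ(i) ≠ i`. -/
def VecNonvanishing : Prop := ∀ i, D.θ i ≠ i → D.Q' i ≠ 0

/-- `Q_i(u) = Q_{θ(i)}(-u)` for the given `i`. -/
def SelfConjugateAt (i : J) : Prop := D.Q' i = (D.Q' (D.θ i)).comp (-Polynomial.X)

/-- (V3): `Q_i(u) = Q_{θ(i)}(-u)` for all `i`. -/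
def VecSelfConjugate : Prop := ∀ i, D.SelfConjugateAt i

/-- The coefficient matrix is perfect: (M1)-(M4). -/
def MatPerfect : Prop :=
  D.MatRegular ∧ D.MatThetaSymmetric ∧ D.MatNonvanishing ∧ D.MatHermitian

/-- The coefficient vector is perfect: (V1)-(V3). -/
def VecPerfect : Prop := D.VecRegular ∧ D.VecNonvanishing ∧ D.VecSelfConjugate

/-! ### Isotropic compositions -/

/-- `β` is a self-dual dimension vector, even at the fixed points of `θ`, with `‖β‖_θ = n`. -/
def IsSelfDual (β : J →₀ ℕ) (n : ℕ) : Prop :=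
  (∀ i, β (D.θ i) = β i) ∧ (∀ i, D.θ i = i → Even (β i)) ∧ β.degree = 2 * n

/-- The isotropic compositions `ν = ν_1 ⋯ ν_n` of `β`, i.e. `∑ₖ (ν_k + θ(ν_k)) = β`. The entry
`ν_k` is `ν.1` at the index `k - 1`. -/
def IsoComp (β : J →₀ ℕ) (n : ℕ) : Type _ :=
  {ν : Fin n → J // ∑ l, (Finsupp.single (ν l) 1 + Finsupp.single (D.θ (ν l)) 1) = β}

instance (β : J →₀ ℕ) (n : ℕ) : Finite (D.IsoComp β n) := by
  have key : ∀ (ν : D.IsoComp β n) (l : Fin n), ν.1 l ∈ β.support := by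
    rintro ⟨ν, rfl⟩ l
    classical
    rw [Finsupp.mem_support_iff, Finsupp.finsetSum_apply]
    intro h
    have h' := (Finset.sum_eq_zero_iff.mp h) l (Finset.mem_univ l)
    simp at h'
  refine Finite.of_injective
    (fun ν : D.IsoComp β n => fun l : Fin n => (⟨ν.1 l, key ν l⟩ : β.support)) ?_
  intro ν μ h
  apply Subtype.ext
  funext l
  have := congrFun h l
  simpa using this

instance (β : J →₀ ℕ) (n : ℕ) : Fintype (D.IsoComp β n) := Fintype.ofFinite _

end CoeffDatum

/-- The index before `k`. The simple reflection `s_k` with `k ≥ 1` exchanges the positions `k` and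
`k + 1` of `1, …, n`, which are the elements `prevIdx k` and `k` of `Fin n`. -/
def prevIdx {n : ℕ} (k : Fin n) : Fin n := ⟨(k : ℕ) - 1, lt_of_le_of_lt (Nat.sub_le _ _) k.2⟩

namespace CoeffDatum

variable {k J : Type*} [Field k] (D : CoeffDatum k J) {β : J →₀ ℕ} {n : ℕ}

/-- The action of `s_r`, `0 ≤ r ≤ n - 1`, on words: `s_0` replaces `ν_1` by `θ(ν_1)`, and `s_r`
with `r ≥ 1` exchanges `ν_r` and `ν_{r+1}`. -/
def reflWord (r : Fin n) (ν : Fin n → J) : Fin n → J :=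
  if (r : ℕ) = 0 then Function.update ν r (D.θ (ν r)) else ν ∘ Equiv.swap (prevIdx r) r

/-- The action of `s_r` on isotropic compositions of `β`. -/
def refl (r : Fin n) (ν : D.IsoComp β n) : D.IsoComp β n :=
  ⟨D.reflWord r ν.1, by
    obtain ⟨ν, rfl⟩ := ν
    dsimp only
    unfold reflWord
    split_ifs with h
    · refine Finset.sum_congr rfl fun l _ => ?_
      by_cases hl : l = r
      · subst hl
        simp [D.θ_invol (ν l), add_comm]
      · simp [Function.update_of_ne hl]
    · exact Equiv.sum_comp (Equiv.swap (prevIdx r) r)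
        (fun l => Finsupp.single (ν l) 1 + Finsupp.single (D.θ (ν l)) 1)⟩

end CoeffDatum

/-! ### Orientifold KLR algebras -/

/-- Symbols `e(ν)`, `x_l` and `τ_r`; the symbol `x l` stands for `x_{l+1}`, whereas `tau r` stands
for `τ_r`, `0 ≤ r ≤ n - 1`. -/
inductive OGen (C : Type*) (n : ℕ) : Type _
  | e (ν : C) : OGen C n
  | x (l : Fin n) : OGen C n
  | tau (r : Fin n) : OGen C n

namespace OGen

/-- `deg e(ν) = deg x_l = 0` and `deg τ_r = 1`. -/
def deg {C : Type*} {n : ℕ} : OGen C n → ℕ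
  | e _ => 0
  | x _ => 0
  | tau _ => 1

end OGen

namespace CoeffDatum

variable {k J : Type*} [Field k] (D : CoeffDatum k J) (β : J →₀ ℕ) (n : ℕ)

/-- The free algebra on the symbols `e(ν)`, `x_l`, `τ_r`. -/
abbrev Free : Type _ := FreeAlgebra k (OGen (D.IsoComp β n) n)

variable {β n}

/-- `e(ν)` in the free algebra. -/
abbrev fe (ν : D.IsoComp β n) : D.Free β n := FreeAlgebra.ι k (OGen.e ν)

variable (β) in
/-- `x_l` in the free algebra. -/
abbrev fx (l : Fin n) : D.Free β n := FreeAlgebra.ι k (OGen.x l)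

variable (β) in
/-- `τ_r` in the free algebra. -/
abbrev ft (r : Fin n) : D.Free β n := FreeAlgebra.ι k (OGen.tau r)

variable (β) in
/-- `p(x_1, …, x_n)` in the free algebra. -/
abbrev fpoly (p : MvPolynomial (Fin n) k) : D.Free β n := ordEval (D.fx β) p

open MvPolynomial in
variable (β n) in
/-- The defining relations of the orientifold KLR algebra. A relation `b = (num / den) c` whose
right-hand side contains a fraction is imposed as `d b = g c` for all polynomials `g`, `d` with
`g / d = num / den`. If `num / den` is a polynomial, then this amounts to the single relation
with `d = 1`. -/
inductive Rel : D.Free β n → D.Free β n → Prop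
  -- idempotent relations
  | e_mul_self (ν : D.IsoComp β n) : Rel (D.fe ν * D.fe ν) (D.fe ν)
  | e_mul_ne (ν μ : D.IsoComp β n) (h : ν ≠ μ) : Rel (D.fe ν * D.fe μ) 0
  | e_sum : Rel (∑ ν : D.IsoComp β n, D.fe ν) 1
  | x_e (l : Fin n) (ν : D.IsoComp β n) : Rel (D.fx β l * D.fe ν) (D.fe ν * D.fx β l)
  | tau_e (r : Fin n) (ν : D.IsoComp β n) :
      Rel (D.ft β r * D.fe ν) (D.fe (D.refl r ν) * D.ft β r)
  -- polynomial relations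
  | x_x (l l' : Fin n) : Rel (D.fx β l * D.fx β l') (D.fx β l' * D.fx β l)
  -- quadratic relations
  | quad (r : Fin n) (hr : (r : ℕ) ≠ 0) (ν : D.IsoComp β n) :
      Rel (D.ft β r * D.ft β r * D.fe ν)
        (D.fpoly β (subst₂ (D.Q (ν.1 (prevIdx r)) (ν.1 r)) (X r) (X (prevIdx r))) * D.fe ν)
  | quad_zero (r : Fin n) (hr : (r : ℕ) = 0) (ν : D.IsoComp β n) :
      Rel (D.ft β r * D.ft β r * D.fe ν)
        (D.fpoly β (Polynomial.aeval (-X r) (D.Q' (ν.1 r))) * D.fe ν)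
  -- deformed braid relations, for distant, for adjacent positive, and for the indices 0 and 1
  | tau_comm (r s : Fin n) (h : (r : ℕ) + 1 < s) :
      Rel (D.ft β r * D.ft β s) (D.ft β s * D.ft β r)
  | braid_eq (r s : Fin n) (hr : (r : ℕ) ≠ 0) (hs : (s : ℕ) = r + 1) (ν : D.IsoComp β n)
      (hν : ν.1 (prevIdx r) = ν.1 s) (g d : MvPolynomial (Fin n) k)
      (hg : g * (X (prevIdx r) - X s) =
        d * (subst₂ (D.Q (ν.1 (prevIdx r)) (ν.1 r)) (X r) (X (prevIdx r)) -
          subst₂ (D.Q (ν.1 (prevIdx r)) (ν.1 r)) (X r) (X s))) :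
      Rel (D.fpoly β d *
          (D.ft β s * D.ft β r * D.ft β s - D.ft β r * D.ft β s * D.ft β r) * D.fe ν)
        (D.fpoly β g * D.fe ν)
  | braid_ne (r s : Fin n) (hr : (r : ℕ) ≠ 0) (hs : (s : ℕ) = r + 1) (ν : D.IsoComp β n)
      (hν : ν.1 (prevIdx r) ≠ ν.1 s) :
      Rel ((D.ft β s * D.ft β r * D.ft β s - D.ft β r * D.ft β s * D.ft β r) * D.fe ν) 0
  | braid_zero_conj (r s : Fin n) (hr : (r : ℕ) = 0) (hs : (s : ℕ) = 1) (ν : D.IsoComp β n)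
      (h₁ : ν.1 r ≠ ν.1 s) (h₂ : ν.1 s = D.θ (ν.1 r)) (g d : MvPolynomial (Fin n) k)
      (hg : g * (X r + X s) =
        d * (Polynomial.aeval (X s) (D.Q' (ν.1 s)) - Polynomial.aeval (X r) (D.Q' (ν.1 r)))) :
      Rel (D.fpoly β d * ((D.ft β s * D.ft β r) ^ 2 - (D.ft β r * D.ft β s) ^ 2) * D.fe ν)
        (D.fpoly β g * D.ft β s * D.fe ν)
  | braid_zero_fix (r s : Fin n) (hr : (r : ℕ) = 0) (hs : (s : ℕ) = 1) (ν : D.IsoComp β n)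
      (h₁ : ν.1 r ≠ D.θ (ν.1 r)) (h₂ : ν.1 s = D.θ (ν.1 s)) (g d : MvPolynomial (Fin n) k)
      (hg : g * X s =
        d * (subst₂ (D.Q (ν.1 r) (ν.1 s)) (X s) (-X r) -
          subst₂ (D.Q (ν.1 r) (ν.1 s)) (-X s) (-X r))) :
      Rel (D.fpoly β d * ((D.ft β s * D.ft β r) ^ 2 - (D.ft β r * D.ft β s) ^ 2) * D.fe ν)
        (D.fpoly β g * D.ft β r * D.fe ν)
  | braid_zero_fix_fix (r s : Fin n) (hr : (r : ℕ) = 0) (hs : (s : ℕ) = 1) (ν : D.IsoComp β n)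
      (h₁ : D.θ (ν.1 r) = ν.1 r) (h₂ : ν.1 r ≠ ν.1 s) (h₃ : ν.1 s = D.θ (ν.1 s))
      (g d : MvPolynomial (Fin n) k)
      (hg : g * (X r * X s) =
        d * (subst₂ (D.Q (ν.1 r) (ν.1 s)) (X s) (-X r) -
          subst₂ (D.Q (ν.1 r) (ν.1 s)) (X s) (X r))) :
      Rel (D.fpoly β d * ((D.ft β s * D.ft β r) ^ 2 - (D.ft β r * D.ft β s) ^ 2) * D.fe ν)
        (D.fpoly β g * (D.fx β r * D.ft β r + 1) * D.fe ν)
  | braid_zero_else (r s : Fin n) (hr : (r : ℕ) = 0) (hs : (s : ℕ) = 1) (ν : D.IsoComp β n)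
      (h₁ : ¬ (ν.1 r ≠ ν.1 s ∧ ν.1 s = D.θ (ν.1 r)))
      (h₂ : ¬ (ν.1 r ≠ D.θ (ν.1 r) ∧ ν.1 s = D.θ (ν.1 s)))
      (h₃ : ¬ (D.θ (ν.1 r) = ν.1 r ∧ ν.1 r ≠ ν.1 s ∧ ν.1 s = D.θ (ν.1 s))) :
      Rel (((D.ft β s * D.ft β r) ^ 2 - (D.ft β r * D.ft β s) ^ 2) * D.fe ν) 0
  -- mixed relations
  | mixed_left (r : Fin n) (hr : (r : ℕ) ≠ 0) (ν : D.IsoComp β n)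
      (hν : ν.1 (prevIdx r) = ν.1 r) :
      Rel ((D.ft β r * D.fx β (prevIdx r) - D.fx β r * D.ft β r) * D.fe ν) (-D.fe ν)
  | mixed_right (r : Fin n) (hr : (r : ℕ) ≠ 0) (ν : D.IsoComp β n)
      (hν : ν.1 (prevIdx r) = ν.1 r) :
      Rel ((D.ft β r * D.fx β r - D.fx β (prevIdx r) * D.ft β r) * D.fe ν) (D.fe ν)
  | mixed_else (r : Fin n) (hr : (r : ℕ) ≠ 0) (l : Fin n) (ν : D.IsoComp β n)
      (h : ¬ ((l = prevIdx r ∨ l = r) ∧ ν.1 (prevIdx r) = ν.1 r)) :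
      Rel ((D.ft β r * D.fx β l - D.fx β (Equiv.swap (prevIdx r) r l) * D.ft β r) * D.fe ν) 0
  | mixed_zero_ne (r : Fin n) (hr : (r : ℕ) = 0) (ν : D.IsoComp β n)
      (hν : ν.1 r ≠ D.θ (ν.1 r)) :
      Rel ((D.ft β r * D.fx β r + D.fx β r * D.ft β r) * D.fe ν) 0
  | mixed_zero_eq (r : Fin n) (hr : (r : ℕ) = 0) (ν : D.IsoComp β n)
      (hν : ν.1 r = D.θ (ν.1 r)) :
      Rel ((D.ft β r * D.fx β r + D.fx β r * D.ft β r) * D.fe ν) (-2 * D.fe ν)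
  | mixed_zero_comm (r : Fin n) (hr : (r : ℕ) = 0) (l : Fin n) (hl : l ≠ r) :
      Rel (D.ft β r * D.fx β l) (D.fx β l * D.ft β r)

variable (β n) in
/-- The orientifold KLR algebra associated to `(J, θ, Q, Q', β)`, where `n = ‖β‖_θ`. -/
def OKLR : Type _ := RingQuot (Rel D β n)

instance : Ring (D.OKLR β n) := inferInstanceAs (Ring (RingQuot (Rel D β n)))

instance : Algebra k (D.OKLR β n) := inferInstanceAs (Algebra k (RingQuot (Rel D β n)))

variable (β n) in
/-- The generators of the orientifold KLR algebra. -/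
def gen (s : OGen (D.IsoComp β n) n) : D.OKLR β n :=
  RingQuot.mkAlgHom k (Rel D β n) (FreeAlgebra.ι k s)

variable (β n) in
/-- The filtration of the orientifold KLR algebra with `deg e(ν) = deg x_l = 0`, `deg τ_r = 1`. -/
def filtration : AlgFiltration k (D.OKLR β n) := degFiltration k (D.gen β n) OGen.deg

end CoeffDatum

/-! ### The Weyl group and the nil-Hecke algebra of type B -/

/-- The Coxeter matrix of type `B_n` with nodes `0, 1, …, n - 1`, the double bond joining the nodes
`0` and `1`. -/
def coxB (n : ℕ) : CoxeterMatrix (Fin n) := (CoxeterMatrix.B n).reindex Fin.revPerm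

/-- The Weyl group of type `B_n`. -/
abbrev WeylB (n : ℕ) : Type := (coxB n).Group

/-- The Coxeter system `s_0, …, s_{n-1}` of the Weyl group of type `B_n`. -/
abbrev weylSystem (n : ℕ) : CoxeterSystem (coxB n) (WeylB n) := (coxB n).toCoxeterSystem

/-- `red` chooses a reduced expression of each element of the Weyl group of type `B_n`. -/
def IsReducedChoice {n : ℕ} (red : WeylB n → List (Fin n)) : Prop :=
  ∀ w, (weylSystem n).IsReduced (red w) ∧ (weylSystem n).wordProd (red w) = w

namespace CoeffDatum

variable {k J : Type*} [Field k] (D : CoeffDatum k J) {β : J →₀ ℕ} {n : ℕ}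

variable (β n) in
/-- The defining relations of the semidirect (smash) product of the nil-Hecke algebra of type `B_n`
(generators `T_r` with `T_r ^ 2 = 0` and the braid relations, where `T_r` is written `ft r`) and the
algebra `⨁_ν k[x_1, …, x_n] e(ν)`, on which the Weyl group acts by
`s_r (f e(ν)) = s_r(f) e(s_r ν)`: the cross relations are `T_r p = s_r(p) T_r`. -/
inductive NilRel : D.Free β n → D.Free β n → Prop
  -- the relations of the algebra of polynomials
  | e_mul_self (ν : D.IsoComp β n) : NilRel (D.fe ν * D.fe ν) (D.fe ν)
  | e_mul_ne (ν μ : D.IsoComp β n) (h : ν ≠ μ) : NilRel (D.fe ν * D.fe μ) 0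
  | e_sum : NilRel (∑ ν : D.IsoComp β n, D.fe ν) 1
  | x_e (l : Fin n) (ν : D.IsoComp β n) : NilRel (D.fx β l * D.fe ν) (D.fe ν * D.fx β l)
  | x_x (l l' : Fin n) : NilRel (D.fx β l * D.fx β l') (D.fx β l' * D.fx β l)
  -- the relations of the nil-Hecke algebra
  | sq (r : Fin n) : NilRel (D.ft β r * D.ft β r) 0
  | braid (r s : Fin n) :
      NilRel ((CoxeterSystem.alternatingWord r s (coxB n r s)).map (D.ft β)).prod
        ((CoxeterSystem.alternatingWord s r (coxB n r s)).map (D.ft β)).prod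
  -- the cross relations
  | tau_e (r : Fin n) (ν : D.IsoComp β n) :
      NilRel (D.ft β r * D.fe ν) (D.fe (D.refl r ν) * D.ft β r)
  | tau_x (r : Fin n) (hr : (r : ℕ) ≠ 0) (l : Fin n) :
      NilRel (D.ft β r * D.fx β l) (D.fx β (Equiv.swap (prevIdx r) r l) * D.ft β r)
  | tau_zero_x (r : Fin n) (hr : (r : ℕ) = 0) : NilRel (D.ft β r * D.fx β r) (-D.fx β r * D.ft β r)
  | tau_zero_x_ne (r : Fin n) (hr : (r : ℕ) = 0) (l : Fin n) (hl : l ≠ r) :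
      NilRel (D.ft β r * D.fx β l) (D.fx β l * D.ft β r)

variable (β n) in
/-- The semidirect product of the nil-Hecke algebra of type `B_n` with `⨁_ν k[x_1, …, x_n] e(ν)`. -/
def NilSmash : Type _ := RingQuot (NilRel D β n)

instance : Ring (D.NilSmash β n) := inferInstanceAs (Ring (RingQuot (NilRel D β n)))

instance : Algebra k (D.NilSmash β n) := inferInstanceAs (Algebra k (RingQuot (NilRel D β n)))

variable (β n) in
/-- The generators of the semidirect product. -/
def nilGen (s : OGen (D.IsoComp β n) n) : D.NilSmash β n :=
  RingQuot.mkAlgHom k (NilRel D β n) (FreeAlgebra.ι k s)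

variable (β n) in
/-- The component of degree `d` of the semidirect product, graded by `deg T_r = 1` and
`deg x_l = deg e(ν) = 0`. -/
def nilPiece (d : ℕ) : Submodule k (D.NilSmash β n) := spanDegEq k (D.nilGen β n) OGen.deg d

/-! ### The PBW property, the PBW basis and perfectness -/

variable (β n) in
/-- The PBW property: the associated graded algebra of the orientifold KLR algebra is isomorphic,
as a graded algebra, to the semidirect product of the nil-Hecke algebra of type `B_n` with
`⨁_ν k[x_1, …, x_n] e(ν)`. -/
def PBWProperty : Prop :=
  ∃ Φ : (D.filtration β n).Gr ≃ₐ[k] D.NilSmash β n,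
    ∀ d, ((D.filtration β n).grPiece d).map Φ.toLinearMap = D.nilPiece β n d

variable (β n) in
/-- The PBW property with an isomorphism that identifies the symbols of the generators `e(ν)`,
`x_l`, `τ_r` with `e(ν)`, `x_l`, `T_r`. -/
def CanonicalPBWProperty : Prop :=
  ∃ Φ : (D.filtration β n).Gr ≃ₐ[k] D.NilSmash β n,
    (∀ d, ((D.filtration β n).grPiece d).map Φ.toLinearMap = D.nilPiece β n d) ∧
    ∀ s : OGen (D.IsoComp β n) n,
      Φ ((D.filtration β n).symbol s.deg (D.gen β n s) (mem_degFiltration k _ _ s _ le_rfl)) =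
        D.nilGen β n s

variable (β) in
/-- `τ_w x_1^{a_1} ⋯ x_n^{a_n} e(ν)`, where `τ_w` is formed with the reduced expression `red w`. -/
def pbwElement (red : WeylB n → List (Fin n))
    (t : WeylB n × (Fin n → ℕ) × D.IsoComp β n) : D.OKLR β n :=
  ((red t.1).map fun r => D.gen β n (OGen.tau r)).prod *
    ordMonomial (fun l => D.gen β n (OGen.x l)) t.2.1 * D.gen β n (OGen.e t.2.2)

variable (β) in
/-- The elements `τ_w x^a e(ν)` form a basis of the orientifold KLR algebra. -/
def HasPBWBasis (red : WeylB n → List (Fin n)) : Prop :=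
  LinearIndependent k (D.pbwElement β red) ∧
    Submodule.span k (Set.range (D.pbwElement β red)) = ⊤

variable (β n) in
/-- The conditions (M4) and (V3) for those entries of `Q` and `Q'` that are indexed by consecutive
entries, respectively by entries, of isotropic compositions of `β`. These are the only entries of
`Q` and `Q'` that occur in the orientifold KLR algebra of `β`. -/
def PerfectAlong : Prop :=
  (∀ (ν : D.IsoComp β n) (r : Fin n), (r : ℕ) ≠ 0 → D.HermitianAt (ν.1 (prevIdx r)) (ν.1 r)) ∧
    ∀ (ν : D.IsoComp β n) (r : Fin n), D.SelfConjugateAt (ν.1 r)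

end CoeffDatum

end

/-! All conditions are compared with one statement, `PolyFaithful`: p(x) e(ν) = 0 only for p = 0.

Necessity of (M4) and (V3). If colours are not fixed by s_k, then τ_k moves past polynomials by a
substitution S of the variables. Computing τ_k³ e(ν) in two ways shows that S carries the
coefficient of τ_k² at ν to the one at s_k ν, and this is (M4) or (V3); see `PolyFaithful.eq_of_sq`.
A PBW basis contains the x^a e(ν), so it gives faithfulness at once. For an isomorphism of gr with
the semidirect product that need not respect generators, the polynomials map onto degree 0 of gr,
this is isomorphic to degree 0 of the semidirect product, and killing the T_k leads back to the
polynomials. The composite is a surjective endomorphism of a Noetherian ring, hence injective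
(`PBWProperty.polyFaithful`).

Sufficiency, linear independence. The algebra acts on functions of points (`exists_rep`). A point is
a word of letters, each with a colour in J, a value in a field and an integer mark, together with an
element of the Weyl group. Where s_k fixes the colours, τ_k is a divided difference; elsewhere it is
the reflection times a coefficient. The coefficients of a crossing and of the opposite crossing
multiply to Q_{ij}: one of them is 1 and the other Q_{ij}, and the marks make this choice compatibly
with the involution. On functions concentrated at the trivial group element, τ_w reaches the element
w with a leading coefficient that is nonzero by (M3) and (V2), and shorter or different elements do
not reach it. This separates the τ_w, and values that are independent variables separate the x^a
e(ν); see `linearIndependent_pbwElement`.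

Sufficiency, spanning. Under (M4) and (V3) the fractions in the relations are polynomials, so the
symbols of the generators satisfy the relations of the semidirect product (`sym_rel`). The resulting
map Ψ from the semidirect product to gr is surjective. By the exchange property and Matsumoto's
theorem the T_w x^a e(ν) span its source, and `filtration_le_span` lifts this to the algebra. With
linear independence, the PBW elements form a basis and Ψ is bijective. -/

/-! ### The exchange property and Matsumoto's theorem -/

namespace CoxeterSystem

open List

variable {B W : Type*} [Group W] {M : CoxeterMatrix B} (cs : CoxeterSystem M W)

/-- The word `i, j, i, j, …` of length `p`. -/
def altFrom (i j : B) : ℕ → List B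
  | 0 => []
  | p + 1 => i :: altFrom j i p

@[simp]
theorem length_altFrom (i j : B) (p : ℕ) : (altFrom i j p).length = p := by
  induction p generalizing i j with
  | zero => rfl
  | succ p ih => simp [altFrom, ih]

theorem alternatingWord_eq_altFrom (i j : B) (p : ℕ) :
    alternatingWord i j p = if Even p then altFrom i j p else altFrom j i p := by
  induction p with
  | zero => simp [alternatingWord, altFrom]
  | succ p ih =>
    rw [alternatingWord_succ', ih]
    by_cases h : Even p
    · simp [h, altFrom, Nat.even_add_one]
    · simp [h, altFrom, Nat.even_add_one]

theorem leftInvSeq_altFrom (i j : B) (p : ℕ) :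
    cs.leftInvSeq (altFrom i j p) =
      (range p).map fun q => cs.simple i * (cs.simple j * cs.simple i) ^ q := by
  induction p generalizing i j with
  | zero => rfl
  | succ p ih =>
    rw [altFrom, leftInvSeq, ih, range_succ_eq_map]
    simp only [map_cons, map_map, pow_zero, mul_one]
    congr 1
    refine map_congr_left fun q hq => ?_
    clear hq
    simp only [Function.comp_apply, MulAut.conj_apply, inv_simple]
    have h : cs.simple i * cs.simple j * (cs.simple i * cs.simple j) ^ q * cs.simple i =
        cs.simple i * (cs.simple j * cs.simple i) ^ (q + 1) := by
      rw [← pow_succ']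
      induction q with
      | zero => simp [mul_assoc]
      | succ q ihq => rw [pow_succ', mul_assoc, ihq, pow_succ' _ (q + 1)]; simp only [mul_assoc]
    rw [← h]
    simp only [mul_assoc]

theorem wordProd_altFrom_two_mul (i j : B) (p : ℕ) {G : Type*} [Monoid G] (f : B → G) :
    ((altFrom i j (2 * p)).map f).prod = (f i * f j) ^ p := by
  induction p with
  | zero => simp [altFrom]
  | succ p ih =>
    rw [show 2 * (p + 1) = 2 * p + 1 + 1 by ring, altFrom, altFrom, pow_succ', ← ih]
    simp [mul_assoc]

/-- The inversion sequence has period `M i j`, because (s_j s_i) ^ M i j = 1; hence its two halves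
are equal lists. -/
theorem count_leftInvSeq_altFrom [DecidableEq W] (i j : B) (t : W) :
    Even ((cs.leftInvSeq (altFrom i j (2 * M i j))).count t) := by
  rw [leftInvSeq_altFrom, two_mul, range_add]
  simp only [map_append, map_map, count_append]
  refine ⟨_, congrArg₂ _ rfl (congrArg (count t) ?_)⟩
  refine map_congr_left fun q _ => ?_
  simp [pow_add]

open Classical in
/-- The involution `(t, z) ↦ (s t s, z + δ_{t, s})` attached to the simple reflection `s`. -/
noncomputable def signPerm (i : B) : Equiv.Perm (W × ZMod 2) :=
  Function.Involutive.toPerm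
    (fun p => (cs.simple i * p.1 * cs.simple i, p.2 + if p.1 = cs.simple i then 1 else 0)) (by
      rintro ⟨t, z⟩
      have h : cs.simple i * t * cs.simple i = cs.simple i ↔ t = cs.simple i := by
        constructor
        · intro h
          have h' := congrArg (fun u => cs.simple i * u * cs.simple i) h
          simpa [mul_assoc] using h'
        · rintro rfl
          simp
      have h2 : (1 : ZMod 2) + 1 = 0 := by decide
      simp only [h, Prod.mk.injEq]
      refine ⟨by simp [mul_assoc], ?_⟩
      split_ifs <;> simp [add_assoc, h2])

-- The second component records modulo 2 how often `t` is an inversion of the word. The inverse is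
-- taken so that the letters act in the order in which they are written.
open Classical in
theorem signPerm_word_inv (ω : List B) (t : W) (z : ZMod 2) :
    ((ω.map cs.signPerm).prod)⁻¹ (t, z) =
      ((cs.wordProd ω)⁻¹ * t * cs.wordProd ω, z + ((cs.leftInvSeq ω).count t : ℕ)) := by
  induction ω generalizing t z with
  | nil => simp
  | cons i ω ih =>
    have hi : (cs.signPerm i)⁻¹ (t, z) =
        (cs.simple i * t * cs.simple i, z + if t = cs.simple i then 1 else 0) := rfl
    rw [map_cons, prod_cons, mul_inv_rev, Equiv.Perm.mul_apply, hi, ih, wordProd_cons]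
    refine Prod.ext (by simp [mul_assoc]) ?_
    have hc : ((cs.leftInvSeq ω).map (MulAut.conj (cs.simple i))).count t =
        (cs.leftInvSeq ω).count (cs.simple i * t * cs.simple i) := by
      have ht : t = MulAut.conj (cs.simple i) (cs.simple i * t * cs.simple i) := by
        simp [mul_assoc]
      conv_lhs => rw [ht]
      exact count_map_of_injective _ _ (MulAut.conj (cs.simple i)).injective _
    simp only [leftInvSeq, count_cons, hc, beq_iff_eq]
    push_cast
    rw [add_assoc, add_comm (if t = cs.simple i then (1 : ZMod 2) else 0)]
    congr 2
    by_cases h : t = cs.simple i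
    · simp [h]
    · simp [h, Ne.symm h]

/-- The word (i j) ^ M i j has trivial product, and every reflection occurs an even number of times
in its inversion sequence, so it acts trivially on both components. -/
theorem signPerm_isLiftable : M.IsLiftable cs.signPerm := by
  classical
  intro i j
  rw [← wordProd_altFrom_two_mul, ← inv_eq_one]
  refine Equiv.ext fun p => ?_
  obtain ⟨t, z⟩ := p
  rw [signPerm_word_inv, wordProd, wordProd_altFrom_two_mul, simple_mul_simple_pow]
  have h : (((cs.leftInvSeq (altFrom i j (2 * M i j))).count t : ℕ) : ZMod 2) = 0 :=
    (ZMod.natCast_eq_zero_iff_even).mpr (cs.count_leftInvSeq_altFrom i j t)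
  simp [h]

/-- Since the permutations `signPerm` define an action of the whole group, the parity of a
multiplicity depends only on the product of the word. -/
theorem count_leftInvSeq_eq [DecidableEq W] {ω ω' : List B}
    (h : cs.wordProd ω = cs.wordProd ω') (t : W) :
    (((cs.leftInvSeq ω).count t : ℕ) : ZMod 2) = ((cs.leftInvSeq ω').count t : ℕ) := by
  have key : ∀ ω : List B, (ω.map cs.signPerm).prod =
      cs.lift ⟨cs.signPerm, cs.signPerm_isLiftable⟩ (cs.wordProd ω) := by
    intro ω
    rw [wordProd, map_list_prod, map_map]
    congr 1
    refine map_congr_left fun i _ => ?_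
    simp
  have h' := signPerm_word_inv cs ω t 0
  rw [key, h, ← key, signPerm_word_inv] at h'
  have := congrArg Prod.snd h'
  simp only [zero_add] at this
  convert this.symm

/-- The exchange property, in terms of inversion sequences. -/
theorem simple_mem_leftInvSeq {ω : List B} {i : B} (h : cs.IsLeftDescent (cs.wordProd ω) i) :
    cs.simple i ∈ cs.leftInvSeq ω := by
  classical
  -- A reduced word of s_i w with `i` put in front is a reduced word of w. There s_i occurs exactly
  -- once as an inversion, so by parity it also occurs for `ω`.
  obtain ⟨α, hα, hw⟩ := cs.exists_isReduced (cs.simple i * cs.wordProd ω)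
  have hp : cs.wordProd (i :: α) = cs.wordProd ω := by
    rw [wordProd_cons, ← hw, simple_mul_simple_cancel_left]
  have hr : cs.IsReduced (i :: α) := by
    rw [IsReduced, hp, length_cons, ← hα.eq, ← hw]
    exact (cs.isLeftDescent_iff.mp h).symm
  have h1 : (cs.leftInvSeq (i :: α)).count (cs.simple i) = 1 :=
    count_eq_one_of_mem hr.nodup_leftInvSeq (by simp [leftInvSeq])
  have h2 := cs.count_leftInvSeq_eq hp (cs.simple i)
  rw [h1] at h2
  by_contra hn
  rw [count_eq_zero_of_not_mem hn] at h2
  simp at h2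

theorem leftInvSeq_append (α ω : List B) :
    cs.leftInvSeq (α ++ ω) =
      cs.leftInvSeq α ++ (cs.leftInvSeq ω).map (MulAut.conj (cs.wordProd α)) := by
  induction α with
  | nil => simp
  | cons i α ih => simp [leftInvSeq, ih, wordProd_cons]

variable {cs} in
theorem IsReduced.of_append_right {α ω : List B} (h : cs.IsReduced (α ++ ω)) : cs.IsReduced ω := by
  simpa using h.drop α.length

/-- If `i` is a left descent of the product of a reduced word `α ω` and `s_i` does not occur
in the inversion sequence of `α`, then a letter of `ω` can be exchanged. -/
theorem exists_exchange_append {α ω : List B} {i : B} (hr : cs.IsReduced (α ++ ω))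
    (h : cs.IsLeftDescent (cs.wordProd (α ++ ω)) i) (hi : cs.simple i ∉ cs.leftInvSeq α) :
    ∃ ω', cs.IsReduced (i :: (α ++ ω')) ∧
      cs.wordProd (i :: (α ++ ω')) = cs.wordProd (α ++ ω) := by
  have hm := cs.simple_mem_leftInvSeq h
  rw [leftInvSeq_append, mem_append] at hm
  obtain ⟨t, ht, hti⟩ := mem_map.mp (hm.resolve_left hi)
  obtain ⟨q, hq, rfl⟩ := mem_iff_getElem.mp ht
  rw [MulAut.conj_apply] at hti
  have hq' : q < ω.length := by simpa using hq
  have he := cs.getD_leftInvSeq_mul_wordProd ω q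
  rw [getD_eq_getElem _ _ hq] at he
  -- Erasing the letter `q` multiplies `ω` on the left by a reflection whose conjugate by `α` is
  -- s_i; the new letter `i` cancels it.
  have hp : cs.wordProd (i :: (α ++ ω.eraseIdx q)) = cs.wordProd (α ++ ω) := by
    rw [wordProd_cons, wordProd_append, ← he, ← hti, wordProd_append]
    have hsq := cs.simple_mul_simple_self i
    rw [← hti] at hsq
    simp only [mul_assoc, inv_mul_cancel_left] at hsq ⊢
    have h2 : (cs.leftInvSeq ω)[q] * (cs.leftInvSeq ω)[q] = 1 := by
      have := cs.getD_leftInvSeq_mul_self ω q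
      rwa [getD_eq_getElem _ _ hq] at this
    rw [← mul_assoc (cs.leftInvSeq ω)[q] (cs.leftInvSeq ω)[q], h2, one_mul]
  refine ⟨_, ?_, hp⟩
  rw [IsReduced, hp, hr.eq]
  have := length_eraseIdx_add_one hq'
  simp only [length_append, length_cons]
  omega

/-- The elements `s_i s_j` have no smaller order than prescribed, which is positive. -/
def HasExactOrders : Prop :=
  ∀ i j, 0 < M i j ∧ ∀ q, 0 < q → q < M i j → (cs.simple i * cs.simple j) ^ q ≠ 1

/-- An equality s_i = s_j (s_i s_j) ^ q with q < p would give (s_i s_j) ^ (q + 1) = 1, where q + 1 ≤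
p < M i j. -/
theorem simple_notMem_leftInvSeq_altFrom (hM : cs.HasExactOrders) {i j : B} {p : ℕ}
    (hp : p < M i j) : cs.simple i ∉ cs.leftInvSeq (altFrom j i p) := by
  rw [leftInvSeq_altFrom, mem_map]
  rintro ⟨q, hq, h⟩
  rw [mem_range] at hq
  refine (hM i j).2 (q + 1) q.succ_pos (by omega) ?_
  rw [pow_succ', mul_assoc, h, simple_mul_simple_self]

/-- The letters `i` and `j` are exchanged to the front in turn. By
`simple_notMem_leftInvSeq_altFrom` the exchanged letter never lies in the alternating prefix, which
therefore grows up to length `M i j`. -/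
theorem exists_reduced_altFrom (hM : cs.HasExactOrders) {w : W} {i j : B}
    (hi : cs.IsLeftDescent w i) (hj : cs.IsLeftDescent w j) (p : ℕ) (hp : p ≤ M i j) :
    ∃ ω, cs.IsReduced (altFrom i j p ++ ω) ∧ cs.wordProd (altFrom i j p ++ ω) = w := by
  induction p generalizing i j with
  | zero =>
    obtain ⟨ω, hω, rfl⟩ := cs.exists_isReduced w
    exact ⟨ω, hω, rfl⟩
  | succ p ih =>
    obtain ⟨ω, hω, rfl⟩ := ih hj hi (by rw [M.symmetric]; omega)
    exact cs.exists_exchange_append hω hi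
      (cs.simple_notMem_leftInvSeq_altFrom hM hp)

section Matsumoto

variable {G : Type*} [Monoid G] (f : B → G)

theorem prod_altFrom_eq
    (hf : ∀ i j, ((alternatingWord i j (M i j)).map f).prod =
      ((alternatingWord j i (M i j)).map f).prod) (i j : B) :
    ((altFrom i j (M i j)).map f).prod = ((altFrom j i (M i j)).map f).prod := by
  have h := hf i j
  rw [alternatingWord_eq_altFrom, alternatingWord_eq_altFrom] at h
  split_ifs at h
  · exact h
  · exact h.symm

/-- Matsumoto's theorem. -/
theorem prod_map_eq_of_isReduced (hM : cs.HasExactOrders)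
    (hf : ∀ i j, ((alternatingWord i j (M i j)).map f).prod =
      ((alternatingWord j i (M i j)).map f).prod)
    {ω ω' : List B} (hω : cs.IsReduced ω) (hω' : cs.IsReduced ω')
    (h : cs.wordProd ω = cs.wordProd ω') : (ω.map f).prod = (ω'.map f).prod := by
  induction hn : ω.length generalizing ω ω' with
  | zero =>
    have h0 : ω'.length = 0 := by rw [← hω'.eq, ← h, hω.eq, hn]
    rw [List.length_eq_zero_iff.mp hn, List.length_eq_zero_iff.mp h0]
  | succ m ih =>
    have hn' : ω'.length = m + 1 := by rw [← hω'.eq, ← h, hω.eq, hn]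
    -- words of this length with a common first letter
    have step : ∀ (i : B) (α α' : List B), cs.IsReduced (i :: α) → cs.IsReduced (i :: α') →
        cs.wordProd (i :: α) = cs.wordProd ω → cs.wordProd (i :: α') = cs.wordProd ω →
        ((i :: α).map f).prod = ((i :: α').map f).prod := by
      intro i α α' hα hα' h1 h2
      have hl : α.length = m := by
        have := hα.eq
        rw [h1, hω.eq, hn, length_cons] at this
        omega
      rw [map_cons, map_cons, prod_cons, prod_cons,
        ih (IsReduced.of_append_right (α := [i]) hα) (IsReduced.of_append_right (α := [i]) hα')
          (by simpa [wordProd_cons] using h1.trans h2.symm) hl]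
    obtain ⟨i, α, rfl⟩ := exists_cons_of_length_eq_add_one hn
    obtain ⟨j, β, rfl⟩ := exists_cons_of_length_eq_add_one hn'
    have descent : ∀ (i : B) (α : List B), cs.IsReduced (i :: α) →
        cs.IsLeftDescent (cs.wordProd (i :: α)) i := by
      intro i α hα
      rw [IsLeftDescent, hα.eq, wordProd_cons, simple_mul_simple_cancel_left]
      exact (cs.length_wordProd_le α).trans_lt (by simp)
    have hi := descent i α hω
    have hj := descent j β hω'
    rw [← h] at hj
    -- Both first letters are descents, so there are reduced words that start with either
    -- alternating word of full length. One braid move joins them, and each shares its first letter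
    -- with one of the given words.
    obtain ⟨γ, hγ, hγw⟩ := cs.exists_reduced_altFrom hM hi hj (M i j) le_rfl
    have hsw : cs.wordProd (altFrom j i (M i j)) = cs.wordProd (altFrom i j (M i j)) := by
      exact prod_altFrom_eq (M := M) cs.simple (fun i j => by
        have := cs.wordProd_braidWord_eq i j
        rwa [braidWord, braidWord, M.symmetric j i] at this) i j |>.symm
    have hγw' : cs.wordProd (altFrom j i (M i j) ++ γ) = cs.wordProd (i :: α) := by
      rw [wordProd_append, hsw, ← wordProd_append, hγw]
    have hγ' : cs.IsReduced (altFrom j i (M i j) ++ γ) := by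
      rw [IsReduced, hγw', ← hγw, hγ.eq]
      simp
    obtain ⟨m', hm'⟩ : ∃ m', M i j = m' + 1 := ⟨M i j - 1, by have := (hM i j).1; omega⟩
    have e1 := prod_altFrom_eq f hf i j
    rw [hm'] at hγ hγ' hγw hγw' e1
    calc ((i :: α).map f).prod = ((altFrom i j (m' + 1) ++ γ).map f).prod :=
          step i α _ hω hγ rfl hγw
      _ = ((altFrom j i (m' + 1) ++ γ).map f).prod := by
          rw [map_append, map_append, prod_append, prod_append, e1]
      _ = ((j :: β).map f).prod := step j _ β hγ' hω' hγw' h.symm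

end Matsumoto

/-- In a monoid with zero, a product along a non-reduced word vanishes if the factors satisfy the
braid relations and have square zero. -/
theorem prod_map_eq_zero_of_not_isReduced {G : Type*} [MonoidWithZero G] (f : B → G)
    (hM : cs.HasExactOrders)
    (hf : ∀ i j, ((alternatingWord i j (M i j)).map f).prod =
      ((alternatingWord j i (M i j)).map f).prod)
    (hsq : ∀ i, f i * f i = 0) {ω : List B} (hω : ¬ cs.IsReduced ω) : (ω.map f).prod = 0 := by
  induction ω with
  | nil => exact absurd (by simp [IsReduced]) hω
  | cons i ω ih =>
    by_cases hr : cs.IsReduced ω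
    · have hd : cs.IsLeftDescent (cs.wordProd ω) i := by
        rcases cs.length_simple_mul (cs.wordProd ω) i with h | h
        · refine absurd ?_ hω
          rw [IsReduced, wordProd_cons, h, hr.eq, length_cons]
        · rw [isLeftDescent_iff]
          exact h
      -- The reduced word `ω` may be replaced by one that begins with `i`, and then the square of `f
      -- i` appears.
      obtain ⟨ω', hω', hw⟩ := cs.exists_exchange_append (α := []) hr hd (by simp)
      rw [map_cons, prod_cons, cs.prod_map_eq_of_isReduced f hM hf hr hω' hw.symm, nil_append,
        map_cons, prod_cons, ← mul_assoc, hsq, zero_mul]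
    · rw [map_cons, prod_cons, ih hr, mul_zero]

end CoxeterSystem

/-! ### The Weyl group of type `B` and its action on words -/

theorem coxB_apply {n : ℕ} (r s : Fin n) :
    coxB n r s = if r = s then 1 else
      if ((r : ℕ) = 0 ∧ (s : ℕ) = 1) ∨ ((s : ℕ) = 0 ∧ (r : ℕ) = 1) then 4 else
        if (s : ℕ) + 1 = r ∨ (r : ℕ) + 1 = s then 3 else 2 := by
  have h : coxB n r s = CoxeterMatrix.B n (Fin.rev r) (Fin.rev s) := rfl
  rw [h]
  change (if Fin.rev r = Fin.rev s then 1 else _) = _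
  have hr := r.2
  have hs := s.2
  simp only [Fin.rev_inj, Fin.val_rev]
  split_ifs <;> first | rfl | omega

section Words

variable {A : Type*} {n : ℕ}

/-- The action of `s_r` on words in an alphabet with a map `θ`: `s_0` applies `θ` to the first
letter, and `s_r` with `r ≥ 1` exchanges two consecutive letters. -/
def wordRefl (θ : A → A) (r : Fin n) (ν : Fin n → A) : Fin n → A :=
  if (r : ℕ) = 0 then Function.update ν r (θ (ν r)) else ν ∘ Equiv.swap (prevIdx r) r

theorem wordRefl_apply (θ : A → A) (r : Fin n) (ν : Fin n → A) (l : Fin n) :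
    wordRefl θ r ν l = if (r : ℕ) = 0 then (if l = r then θ (ν r) else ν l) else
      if l = r then ν (prevIdx r) else if l = prevIdx r then ν r else ν l := by
  unfold wordRefl
  split_ifs with h1 h2 h2 h3
  · subst h2; simp
  · simp [h2]
  · subst h2; simp
  · subst h3; simp
  · simp [Equiv.swap_apply_of_ne_of_ne h3 h2]

theorem prevIdx_val (r : Fin n) : (prevIdx r : ℕ) = r - 1 := rfl

theorem prevIdx_ne {r : Fin n} (hr : (r : ℕ) ≠ 0) : prevIdx r ≠ r := by
  simp only [ne_eq, Fin.ext_iff, prevIdx_val]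
  omega

theorem prevIdx_eq {r s : Fin n} (h : (s : ℕ) = r + 1) : prevIdx s = r := by
  simp only [Fin.ext_iff, prevIdx_val]
  omega

theorem wordRefl_zero (θ : A → A) {r : Fin n} (hr : (r : ℕ) = 0) (ν : Fin n → A) :
    wordRefl θ r ν = Function.update ν r (θ (ν r)) := if_pos hr

theorem wordRefl_pos (θ : A → A) {r : Fin n} (hr : (r : ℕ) ≠ 0) (ν : Fin n → A) :
    wordRefl θ r ν = ν ∘ Equiv.swap (prevIdx r) r := if_neg hr

variable {θ : A → A}

theorem wordRefl_wordRefl (hθ : Function.Involutive θ) (r : Fin n) (ν : Fin n → A) :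
    wordRefl θ r (wordRefl θ r ν) = ν := by
  by_cases hr : (r : ℕ) = 0
  · simp [wordRefl_zero _ hr, hθ (ν r)]
  · rw [wordRefl_pos _ hr, wordRefl_pos _ hr]
    funext l
    simp

theorem wordRefl_comm {r s : Fin n} (h : (r : ℕ) + 1 < s) (ν : Fin n → A) :
    wordRefl θ r (wordRefl θ s ν) = wordRefl θ s (wordRefl θ r ν) := by
  have hs : (s : ℕ) ≠ 0 := by omega
  have h1 : r ≠ s := by simp only [ne_eq, Fin.ext_iff]; omega
  have h2 : r ≠ prevIdx s := by simp only [ne_eq, Fin.ext_iff, prevIdx_val]; omega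
  by_cases hr : (r : ℕ) = 0
  · rw [wordRefl_pos _ hs, wordRefl_pos _ hs, wordRefl_zero _ hr, wordRefl_zero _ hr]
    funext l
    by_cases hl : l = r
    · subst hl
      simp [Equiv.swap_apply_of_ne_of_ne h2 h1]
    · have : Equiv.swap (prevIdx s) s l ≠ r := by
        rw [ne_eq, Equiv.swap_apply_eq_iff, Equiv.swap_apply_of_ne_of_ne h2 h1]
        exact hl
      simp [hl, this]
  · have h3 : prevIdx r ≠ s := by simp only [ne_eq, Fin.ext_iff, prevIdx_val]; omega
    have h4 : prevIdx r ≠ prevIdx s := by simp only [ne_eq, Fin.ext_iff, prevIdx_val]; omega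
    simp only [wordRefl_pos _ hs, wordRefl_pos _ hr, Function.comp_assoc]
    congr 1
    have hd : Equiv.Perm.Disjoint (Equiv.swap (prevIdx s) s) (Equiv.swap (prevIdx r) r) := by
      intro l
      by_cases hl : l = prevIdx r ∨ l = r
      · left
        rcases hl with rfl | rfl
        · exact Equiv.swap_apply_of_ne_of_ne h4 h3
        · exact Equiv.swap_apply_of_ne_of_ne h2 h1
      · right
        rw [not_or] at hl
        exact Equiv.swap_apply_of_ne_of_ne hl.1 hl.2
    funext l
    exact congrArg (fun g : Equiv.Perm (Fin n) => g l) hd.commute.eq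

theorem wordRefl_braid {r s : Fin n} (hr : (r : ℕ) ≠ 0) (hs : (s : ℕ) = r + 1) (ν : Fin n → A) :
    wordRefl θ s (wordRefl θ r (wordRefl θ s ν)) =
      wordRefl θ r (wordRefl θ s (wordRefl θ r ν)) := by
  have hs' : (s : ℕ) ≠ 0 := by omega
  simp only [wordRefl_pos _ hs', wordRefl_pos _ hr, prevIdx_eq hs]
  have h1 := prevIdx_ne hr
  have h2 : r ≠ s := by simp only [ne_eq, Fin.ext_iff]; omega
  have h3 : prevIdx r ≠ s := by simp only [ne_eq, Fin.ext_iff, prevIdx_val]; omega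
  generalize prevIdx r = a at *
  funext l
  simp only [Function.comp_apply]
  congr 1
  by_cases ha : l = a
  · subst ha
    simp [Equiv.swap_apply_of_ne_of_ne, *, Ne.symm]
  by_cases hb : l = r
  · subst hb
    simp [Equiv.swap_apply_of_ne_of_ne, *, Ne.symm]
  by_cases hc : l = s
  · subst hc
    simp [Equiv.swap_apply_of_ne_of_ne, *, Ne.symm]
  simp [Equiv.swap_apply_of_ne_of_ne, *]

theorem wordRefl_braid_zero {r s : Fin n} (hr : (r : ℕ) = 0) (hs : (s : ℕ) = 1)
    (ν : Fin n → A) :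
    wordRefl θ s (wordRefl θ r (wordRefl θ s (wordRefl θ r ν))) =
      wordRefl θ r (wordRefl θ s (wordRefl θ r (wordRefl θ s ν))) := by
  have hs' : (s : ℕ) ≠ 0 := by omega
  have h2 : r ≠ s := by simp only [ne_eq, Fin.ext_iff]; omega
  simp only [wordRefl_pos _ hs', wordRefl_zero _ hr, prevIdx_eq (show (s : ℕ) = r + 1 by omega)]
  funext l
  by_cases ha : l = r
  · subst ha
    simp [h2.symm]
  by_cases hb : l = s
  · subst hb
    simp [ha]
  simp [Equiv.swap_apply_of_ne_of_ne, *]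

/-- The permutation of words given by `s_r`. -/
def wordPerm (hθ : Function.Involutive θ) (r : Fin n) : Equiv.Perm (Fin n → A) :=
  Function.Involutive.toPerm (wordRefl θ r) (wordRefl_wordRefl hθ r)

theorem wordPerm_mul_self (hθ : Function.Involutive θ) (r : Fin n) :
    wordPerm hθ r * wordPerm hθ r = 1 :=
  Equiv.ext fun ν => wordRefl_wordRefl hθ r ν

/-- For involutions the braid relations are equivalent to the power relations of the Coxeter
presentation, which is the form needed to extend an action of generators to the Weyl group. -/
theorem pow_coxB_eq_one {G : Type*} [Monoid G] (f : Fin n → G) (h1 : ∀ r, f r * f r = 1)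
    (h2 : ∀ r s : Fin n, (r : ℕ) + 1 < s → f r * f s = f s * f r)
    (h3 : ∀ r s : Fin n, (r : ℕ) ≠ 0 → (s : ℕ) = r + 1 → f s * f r * f s = f r * f s * f r)
    (h4 : ∀ r s : Fin n, (r : ℕ) = 0 → (s : ℕ) = 1 →
      f s * f r * f s * f r = f r * f s * f r * f s) (r s : Fin n) :
    (f r * f s) ^ coxB n r s = 1 := by
  have cancel : ∀ (r : Fin n) (g : G), f r * (f r * g) = g := fun r g => by
    rw [← mul_assoc, h1, one_mul]
  -- it suffices to treat one of the two orders of `r` and `s`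
  have flip : ∀ (r s : Fin n) (m : ℕ), (f r * f s) ^ m = 1 → (f s * f r) ^ m = 1 := by
    intro r s m h
    have : f s * (f r * f s) ^ m * f s = (f s * f r) ^ m * (f s * f s) := by
      induction m with
      | zero => simp
      | succ m _ =>
        clear h
        have e : ∀ m : ℕ, f s * (f r * f s) ^ m = (f s * f r) ^ m * f s := by
          intro m
          induction m with
          | zero => simp
          | succ m ih => rw [pow_succ, ← mul_assoc, ih, pow_succ]; simp only [mul_assoc]
        rw [e, mul_assoc]
    rw [h, mul_one, h1, mul_one] at this
    exact this.symm
  have main : ∀ r s : Fin n, (r : ℕ) < s → (f r * f s) ^ coxB n r s = 1 := by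
    intro r s hrs
    have hne : r ≠ s := by simp only [ne_eq, Fin.ext_iff]; omega
    rw [coxB_apply, if_neg hne]
    split_ifs with hc hd
    · have hb := h4 r s (by omega) (by omega)
      simp only [mul_assoc] at hb
      rw [show (f r * f s) ^ 4 = (f r * (f s * (f r * f s))) * (f r * (f s * (f r * f s))) by
        simp only [pow_succ, pow_zero, one_mul, mul_assoc]]
      nth_rewrite 1 [← hb]
      simp only [mul_assoc, cancel, h1]
    · have hb := h3 r s (by omega) (by omega)
      simp only [mul_assoc] at hb
      simp only [pow_succ, pow_zero, one_mul, mul_assoc, hb, cancel]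
      rw [h1]
    · have hb := h2 r s (by omega)
      rw [pow_two]
      nth_rewrite 1 [hb]
      simp only [mul_assoc, cancel, h1]
  rcases lt_trichotomy (r : ℕ) s with h | h | h
  · exact main r s h
  · have : r = s := Fin.ext h
    subst this
    rw [coxB_apply, if_pos rfl, pow_one, h1]
  · rw [(coxB n).symmetric]
    exact flip _ _ _ (main s r h)

theorem wordPerm_isLiftable (hθ : Function.Involutive θ) :
    (coxB n).IsLiftable (wordPerm hθ : Fin n → Equiv.Perm (Fin n → A)) :=
  pow_coxB_eq_one _ (wordPerm_mul_self hθ)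
    (fun _ _ h => Equiv.ext fun ν => wordRefl_comm h ν)
    (fun _ _ hr hs => Equiv.ext fun ν => wordRefl_braid hr hs ν)
    (fun _ _ hr hs => Equiv.ext fun ν => wordRefl_braid_zero hr hs ν)

end Words

/-! ### Exact orders of products of two simple reflections in type B. -/

theorem wordRefl_neg_ne {n : ℕ} {r s : Fin n} (h : (r : ℕ) < s) :
    wordRefl (fun y : ℤ => -y) r (fun l => (l : ℤ) + 1) ≠
      wordRefl (fun y : ℤ => -y) s (fun l => (l : ℤ) + 1) := by
  intro he
  have h0 := congrFun he r
  have hne : r ≠ s := by simp only [ne_eq, Fin.ext_iff]; omega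
  simp only [wordRefl_apply, hne, if_true, if_false, if_neg (show ¬ (s : ℕ) = 0 by omega)] at h0
  have hp := prevIdx_val r
  split_ifs at h0 <;> omega

/-- In a group given by a presentation the order of s_r s_s is only known to divide the entry of the
Coxeter matrix. The action on words of integers, with negation as involution, excludes proper
divisors; the word 1 2 3 ⋯ is moved by every element that matters. -/
theorem weylSystem_hasExactOrders (n : ℕ) : (weylSystem n).HasExactOrders := by
  intro r s
  have hneg : Function.Involutive (fun y : ℤ => -y) := fun y => neg_neg y
  set ρ := (weylSystem n).lift ⟨wordPerm hneg, wordPerm_isLiftable hneg⟩ with hρ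
  have hρs : ∀ r, ρ ((weylSystem n).simple r) = wordPerm hneg r := fun r =>
    (weylSystem n).lift_apply_simple (wordPerm_isLiftable hneg) r
  have hne : ∀ r s : Fin n, r ≠ s →
      (weylSystem n).simple r * (weylSystem n).simple s ≠ 1 := by
    intro r s hrs h
    have h1 : (weylSystem n).simple r = (weylSystem n).simple s := by
      rw [eq_comm, ← (weylSystem n).inv_simple r]
      exact (inv_eq_of_mul_eq_one_right h).symm
    have h2 : wordPerm hneg r = wordPerm hneg s := by rw [← hρs, h1, hρs]
    have h3 := congrArg (fun g : Equiv.Perm (Fin n → ℤ) => g fun l => (l : ℤ) + 1) h2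
    rcases lt_trichotomy (r : ℕ) s with h | h | h
    · exact wordRefl_neg_ne h h3
    · exact hrs (Fin.ext h)
    · exact wordRefl_neg_ne h h3.symm
  have hsq : ∀ r s : Fin n, (r : ℕ) = 0 → (s : ℕ) = 1 →
      ((weylSystem n).simple r * (weylSystem n).simple s) ^ 2 ≠ 1 := by
    intro r s hr hs h
    have h2 := congrArg ρ h
    rw [map_pow, map_mul, hρs, hρs, map_one] at h2
    have h3 := congrArg (fun g : Equiv.Perm (Fin n → ℤ) => g (fun l => (l : ℤ) + 1) r) h2
    -- The element (s_0 s_1)² changes the signs of the first two letters, so the first letter 1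
    -- becomes -1.
    have h4 : wordRefl (fun y : ℤ => -y) r (wordRefl (fun y : ℤ => -y) s
        (wordRefl (fun y : ℤ => -y) r (wordRefl (fun y : ℤ => -y) s
          fun l => (l : ℤ) + 1))) r = (r : ℤ) + 1 := by
      rw [pow_two] at h3
      exact h3
    have hrs : r ≠ s := by simp only [ne_eq, Fin.ext_iff]; omega
    simp [wordRefl_apply, hr, hs, prevIdx_eq (show (s : ℕ) = r + 1 by omega), hrs, hrs.symm] at h4
  have hpow := (weylSystem n).simple_mul_simple_pow r s
  by_cases hrs : r = s
  · subst hrs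
    rw [coxB_apply, if_pos rfl]
    exact ⟨one_pos, fun q h1 h2 => by omega⟩
  have h1 := hne r s hrs
  rw [coxB_apply, if_neg hrs] at hpow ⊢
  generalize hg : (weylSystem n).simple r * (weylSystem n).simple s = g at *
  split_ifs at hpow ⊢ with hc hd
  · refine ⟨by norm_num, fun q hq hq' => ?_⟩
    -- Only the powers 1 and 2 need the action: g³ = 1 together with g⁴ = 1 would give g = 1.
    have h2 : g ^ 2 ≠ 1 := by
      rcases hc with hc | hc
      · rw [← hg]
        exact hsq r s hc.1 hc.2
      · intro h
        refine hsq s r hc.1 hc.2 ?_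
        rw [← inv_inj, ← inv_pow, mul_inv_rev, CoxeterSystem.inv_simple, CoxeterSystem.inv_simple,
          hg, h, inv_one]
    interval_cases q
    · simpa using h1
    · exact h2
    · intro h
      apply h1
      rw [pow_succ, h, one_mul] at hpow
      exact hpow
  · refine ⟨by norm_num, fun q hq hq' => ?_⟩
    interval_cases q
    · simpa using h1
    · intro h
      apply h1
      rw [pow_succ, h, one_mul] at hpow
      exact hpow
  · refine ⟨by norm_num, fun q hq hq' => ?_⟩
    interval_cases q
    simpa using h1

/-! ### Polynomials in commuting elements -/

section OrdEval

variable {k A A' : Type*} [CommRing k] [Ring A] [Algebra k A] [Ring A'] [Algebra k A'] {n : ℕ}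

theorem map_ordMonomial {A A' G : Type*} [Monoid A] [Monoid A'] [FunLike G A A']
    [MonoidHomClass G A A'] (f : G) (X : Fin n → A) (a : Fin n → ℕ) :
    f (ordMonomial X a) = ordMonomial (fun l => f (X l)) a := by
  simp only [ordMonomial, map_list_prod, List.map_ofFn]
  congr 2
  funext l
  simp

theorem map_ordEval (f : A →ₐ[k] A') (X : Fin n → A) (p : MvPolynomial (Fin n) k) :
    f (ordEval X p) = ordEval (fun l => f (X l)) p := by
  simp only [ordEval, map_sum, map_smul]
  refine Finset.sum_congr rfl fun a _ => ?_
  congr 1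
  exact map_ordMonomial f X a

theorem ordMonomial_eq_prod {A : Type*} [CommMonoid A] (X : Fin n → A) (a : Fin n → ℕ) :
    ordMonomial X a = ∏ l, X l ^ a l := by
  rw [ordMonomial, List.prod_ofFn]

theorem ordEval_eq_aeval {A : Type*} [CommRing A] [Algebra k A] (X : Fin n → A)
    (p : MvPolynomial (Fin n) k) : ordEval X p = MvPolynomial.aeval X p := by
  rw [MvPolynomial.aeval_def, MvPolynomial.eval₂_eq', ordEval]
  exact Finset.sum_congr rfl fun a _ => by rw [ordMonomial_eq_prod, Algebra.smul_def]

open scoped IsMulCommutative in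
/-- Evaluation of polynomials at a commuting family. -/
theorem exists_algHom_of_commute (X : Fin n → A) (h : ∀ l l', X l * X l' = X l' * X l) :
    ∃ f : MvPolynomial (Fin n) k →ₐ[k] A, (∀ p, f p = ordEval X p) ∧
      ∀ l, f (MvPolynomial.X l) = X l := by
  let S := Algebra.adjoin k (Set.range X)
  have : IsMulCommutative S := Algebra.isMulCommutative_adjoin k (by
    rintro _ ⟨l, rfl⟩ _ ⟨l', rfl⟩
    exact h l l')
  let Y : Fin n → S := fun l => ⟨X l, Algebra.subset_adjoin ⟨l, rfl⟩⟩
  refine ⟨S.val.comp (MvPolynomial.aeval Y), fun p => ?_, fun l => ?_⟩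
  · rw [AlgHom.comp_apply, ← ordEval_eq_aeval]
    exact map_ordEval S.val Y p
  · rw [AlgHom.comp_apply, MvPolynomial.aeval_X]
    rfl

end OrdEval

/-! ### Letters and regular points -/

/-- A letter carries a colour, a nonzero mark and a value. -/
structure Letter (J F : Type*) where
  col : J
  mark : ℤ
  val : F

namespace CoeffDatum

variable {k J : Type*} [Field k] (D : CoeffDatum k J)

theorem aeval_subst₂ {σ R : Type*} [CommRing R] [Algebra k R] (f : MvPolynomial (Fin 2) k)
    (a b : MvPolynomial σ k) (x : σ → R) : MvPolynomial.aeval x (subst₂ f a b) =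
      MvPolynomial.aeval ![MvPolynomial.aeval x a, MvPolynomial.aeval x b] f := by
  rw [subst₂, ← AlgHom.comp_apply, MvPolynomial.comp_aeval]
  congr 2
  funext i
  fin_cases i <;> rfl

variable {D} in
theorem HermitianAt.aeval {R : Type*} [CommRing R] [Algebra k R] {i j : J} (h : D.HermitianAt i j)
    (u v : R) :
    MvPolynomial.aeval ![u, v] (D.Q i j) = MvPolynomial.aeval ![v, u] (D.Q j i) := by
  rw [h, aeval_subst₂]
  simp

variable {D} in
theorem MatThetaSymmetric.aeval {R : Type*} [CommRing R] [Algebra k R] (h : D.MatThetaSymmetric)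
    (i j : J) (u v : R) :
    MvPolynomial.aeval ![u, v] (D.Q i j) =
      MvPolynomial.aeval ![-v, -u] (D.Q (D.θ j) (D.θ i)) := by
  rw [h i j, aeval_subst₂]
  simp

variable {D} in
theorem SelfConjugateAt.aeval {R : Type*} [CommRing R] [Algebra k R] {i : J}
    (h : D.SelfConjugateAt i) (u : R) :
    Polynomial.aeval u (D.Q' i) = Polynomial.aeval (-u) (D.Q' (D.θ i)) := by
  rw [h, Polynomial.aeval_comp]
  simp

variable {F : Type*} [Field F]

/-- The involution of the set of letters. -/
def conj (l : Letter J F) : Letter J F := ⟨D.θ l.col, -l.mark, -l.val⟩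

@[simp] theorem conj_col (l : Letter J F) : (D.conj l).col = D.θ l.col := rfl
@[simp] theorem conj_mark (l : Letter J F) : (D.conj l).mark = -l.mark := rfl
@[simp] theorem conj_val (l : Letter J F) : (D.conj l).val = -l.val := rfl

theorem conj_conj : Function.Involutive (D.conj : Letter J F → Letter J F) := by
  rintro ⟨i, y, x⟩
  simp [conj, D.θ_invol i]

variable [Algebra k F]

/-- The coefficient of a crossing of letters of different colours. -/
noncomputable def crossCoeff (l m : Letter J F) : F :=
  if l.mark < m.mark then 1 else MvPolynomial.aeval ![m.val, l.val] (D.Q l.col m.col)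

/-- The coefficient of the conjugation of a letter whose colour is not fixed by `θ`. -/
noncomputable def poleCoeff (l : Letter J F) : F :=
  if 0 < l.mark then 1 else Polynomial.aeval (-l.val) (D.Q' l.col)

/-- The marks decide which of the two opposite crossings carries the factor 1. If the other one
carries Q_{ml} instead of Q_{lm}, then (M4) makes up for it. -/
theorem crossCoeff_mul {l m : Letter J F} (h : D.HermitianAt l.col m.col)
    (hlm : l.mark ≠ m.mark) :
    D.crossCoeff l m * D.crossCoeff m l =
      MvPolynomial.aeval ![m.val, l.val] (D.Q l.col m.col) := by
  rcases lt_or_gt_of_ne hlm with h' | h'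
  · rw [crossCoeff, crossCoeff, if_pos h', if_neg h'.not_gt, one_mul, h.aeval]
  · rw [crossCoeff, crossCoeff, if_pos h', if_neg h'.not_gt, mul_one]

/-- Conjugation negates marks, so exchanging the two letters restores their comparison; for the
values this is (M2). It matches the coefficients on the two sides of the braid relation of length
four. -/
theorem crossCoeff_conj (hM2 : D.MatThetaSymmetric) (l m : Letter J F) :
    D.crossCoeff (D.conj m) (D.conj l) = D.crossCoeff l m := by
  simp only [crossCoeff, conj_mark, conj_val, conj_col, neg_lt_neg_iff]
  rw [hM2.aeval l.col]

/-- A letter and its conjugate have marks of opposite sign, so exactly one of the two factors is 1;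
(V3) is used when the polynomial sits at the conjugate letter. -/
theorem poleCoeff_mul {l : Letter J F} (h : D.SelfConjugateAt l.col) (hl : l.mark ≠ 0) :
    D.poleCoeff l * D.poleCoeff (D.conj l) = Polynomial.aeval (-l.val) (D.Q' l.col) := by
  rcases lt_or_gt_of_ne hl with h' | h'
  · rw [poleCoeff, poleCoeff, conj_mark, if_neg h'.not_gt, if_pos (by omega), mul_one]
  · rw [poleCoeff, poleCoeff, conj_mark, if_pos h', if_neg (by omega), one_mul, h.aeval]
    rfl

variable (k) in
/-- A word is regular if the marks are nonzero and distinct up to sign and the values are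
pairwise algebraically independent. -/
structure _root_.Letter.IsRegular {n : ℕ} (w : Fin n → Letter J F) : Prop where
  mark_ne_zero : ∀ a, (w a).mark ≠ 0
  val_transcendental : ∀ a, Transcendental k (w a).val
  mark_ne : ∀ a b, a ≠ b → (w a).mark ≠ (w b).mark
  mark_ne_neg : ∀ a b, a ≠ b → (w a).mark ≠ -(w b).mark
  val_algebraicIndependent : ∀ a b, a ≠ b →
    ∀ f : MvPolynomial (Fin 2) k, MvPolynomial.aeval ![(w a).val, (w b).val] f = 0 → f = 0

end CoeffDatum

namespace Letter.IsRegular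

variable {k J : Type*} [Field k] {F : Type*} [Field F] [Algebra k F] {n : ℕ}
  {w : Fin n → Letter J F}

theorem val_ne_zero (h : Letter.IsRegular k w) (a : Fin n) : (w a).val ≠ 0 :=
  fun h0 => h.val_transcendental a (h0 ▸ isAlgebraic_zero)

theorem val_sub_ne_zero (h : Letter.IsRegular k w) {a b : Fin n} (hab : a ≠ b) :
    (w a).val - (w b).val ≠ 0 := by
  intro h0
  have := h.val_algebraicIndependent a b hab (MvPolynomial.X 0 - MvPolynomial.X 1) (by simpa)
  rw [sub_eq_zero] at this
  exact absurd (MvPolynomial.X_injective this) (by decide)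

theorem val_add_ne_zero (h : Letter.IsRegular k w) {a b : Fin n} (hab : a ≠ b) :
    (w a).val + (w b).val ≠ 0 := by
  intro h0
  have := h.val_algebraicIndependent a b hab (MvPolynomial.X 0 + MvPolynomial.X 1) (by simpa)
  have h1 := congrArg (MvPolynomial.aeval ![(1 : k), 0]) this
  simp at h1

theorem comp (h : Letter.IsRegular k w) {n' : ℕ} {g : Fin n' → Fin n} (hg : Function.Injective g) :
    Letter.IsRegular k (w ∘ g) where
  mark_ne_zero a := h.mark_ne_zero (g a)
  val_transcendental a := h.val_transcendental (g a)
  mark_ne _ _ hab := h.mark_ne _ _ (hg.ne hab)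
  mark_ne_neg _ _ hab := h.mark_ne_neg _ _ (hg.ne hab)
  val_algebraicIndependent _ _ hab := h.val_algebraicIndependent _ _ (hg.ne hab)

theorem transcendental_neg {x : F} (hx : Transcendental k x) : Transcendental k (-x) :=
  fun h => hx (by simpa using h.neg)

/-- The substitution u ↦ -u is an involution of k[u, v], so a polynomial relation of (-x, y) is one
of (x, y). -/
theorem neg_left_independent {x y : F}
    (hxy : ∀ f : MvPolynomial (Fin 2) k, MvPolynomial.aeval ![x, y] f = 0 → f = 0)
    (f : MvPolynomial (Fin 2) k) (hf : MvPolynomial.aeval ![-x, y] f = 0) : f = 0 := by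
  have h1 := hxy (CoeffDatum.subst₂ f (-MvPolynomial.X 0) (MvPolynomial.X 1))
    (by rw [CoeffDatum.aeval_subst₂]; simpa using hf)
  have h2 : CoeffDatum.subst₂ (CoeffDatum.subst₂ f (-MvPolynomial.X 0) (MvPolynomial.X 1))
      (-MvPolynomial.X 0) (MvPolynomial.X 1) = f := by
    rw [CoeffDatum.subst₂, CoeffDatum.subst₂, ← AlgHom.comp_apply, MvPolynomial.comp_aeval]
    conv_rhs => rw [← MvPolynomial.aeval_X_left_apply (R := k) f]
    congr 2
    funext i
    fin_cases i <;> simp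
  rw [← h2, h1, CoeffDatum.subst₂, map_zero]

theorem independent_symm {x y : F}
    (hxy : ∀ f : MvPolynomial (Fin 2) k, MvPolynomial.aeval ![x, y] f = 0 → f = 0)
    (f : MvPolynomial (Fin 2) k) (hf : MvPolynomial.aeval ![y, x] f = 0) : f = 0 := by
  have h1 := hxy (CoeffDatum.subst₂ f (MvPolynomial.X 1) (MvPolynomial.X 0))
    (by rw [CoeffDatum.aeval_subst₂]; simpa using hf)
  have h2 : CoeffDatum.subst₂ (CoeffDatum.subst₂ f (MvPolynomial.X 1) (MvPolynomial.X 0))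
      (MvPolynomial.X 1) (MvPolynomial.X 0) = f := by
    rw [CoeffDatum.subst₂, CoeffDatum.subst₂, ← AlgHom.comp_apply, MvPolynomial.comp_aeval]
    conv_rhs => rw [← MvPolynomial.aeval_X_left_apply (R := k) f]
    congr 2
    funext i
    fin_cases i <;> simp
  rw [← h2, h1, CoeffDatum.subst₂, map_zero]

/-- Conjugation changes the sign of one mark and one value. This is why regularity asks for marks
that are distinct up to sign. -/
theorem update_conj (h : Letter.IsRegular k w) (D : CoeffDatum k J) (r : Fin n) :
    Letter.IsRegular k (Function.update w r (D.conj (w r))) where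
  mark_ne_zero a := by
    by_cases ha : a = r
    · subst ha; simpa using h.mark_ne_zero a
    · simpa [ha] using h.mark_ne_zero a
  val_transcendental a := by
    by_cases ha : a = r
    · subst ha; simpa using transcendental_neg (h.val_transcendental a)
    · simpa [ha] using h.val_transcendental a
  mark_ne a b hab := by
    by_cases ha : a = r
    · subst ha
      have := h.mark_ne_neg a b hab
      simp only [Function.update_self, Function.update_of_ne hab.symm, CoeffDatum.conj_mark]
      omega
    · by_cases hb : b = r
      · subst hb
        simpa [hab] using h.mark_ne_neg a b hab
      · simpa [ha, hb] using h.mark_ne a b hab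
  mark_ne_neg a b hab := by
    by_cases ha : a = r
    · subst ha
      have := h.mark_ne a b hab
      simp only [Function.update_self, Function.update_of_ne hab.symm, CoeffDatum.conj_mark]
      omega
    · by_cases hb : b = r
      · subst hb
        simpa [hab] using h.mark_ne a b hab
      · simpa [ha, hb] using h.mark_ne_neg a b hab
  val_algebraicIndependent a b hab := by
    have h0 := h.val_algebraicIndependent a b hab
    by_cases ha : a = r
    · subst ha
      simpa [hab.symm] using neg_left_independent h0
    · by_cases hb : b = r
      · subst hb
        simpa [hab] using independent_symm (neg_left_independent (independent_symm h0))
      · simpa [ha, hb] using h0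

theorem wordRefl (h : Letter.IsRegular k w) (D : CoeffDatum k J) (r : Fin n) :
    Letter.IsRegular k (wordRefl D.conj r w) := by
  by_cases hr : (r : ℕ) = 0
  · rw [wordRefl_zero _ hr]
    exact h.update_conj D r
  · rw [wordRefl_pos _ hr]
    exact h.comp (Equiv.injective _)

end Letter.IsRegular

/-! ### Operators on functions of regular points -/

namespace CoeffDatum

variable {k J : Type*} [Field k] (D : CoeffDatum k J) (β : J →₀ ℕ) (n : ℕ)
  (F : Type*) [Field F] [Algebra k F]

/-- A point: a regular word whose colours form an isotropic composition of `β`, together with an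
element of the Weyl group. -/
@[ext]
structure Point where
  w : WeylB n
  word : Fin n → Letter J F
  comp : D.IsoComp β n
  comp_eq : ∀ l, comp.1 l = (word l).col
  regular : Letter.IsRegular k word

variable {β n F}

theorem refl_val (r : Fin n) (ν : D.IsoComp β n) : (D.refl r ν).1 = wordRefl D.θ r ν.1 := rfl

theorem refl_refl (r : Fin n) (ν : D.IsoComp β n) : D.refl r (D.refl r ν) = ν :=
  Subtype.ext (wordRefl_wordRefl D.θ_invol r ν.1)

theorem refl_comm {r s : Fin n} (h : (r : ℕ) + 1 < s) (ν : D.IsoComp β n) :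
    D.refl r (D.refl s ν) = D.refl s (D.refl r ν) :=
  Subtype.ext (wordRefl_comm h ν.1)

theorem refl_braid {r s : Fin n} (hr : (r : ℕ) ≠ 0) (hs : (s : ℕ) = r + 1)
    (ν : D.IsoComp β n) :
    D.refl s (D.refl r (D.refl s ν)) = D.refl r (D.refl s (D.refl r ν)) :=
  Subtype.ext (wordRefl_braid hr hs ν.1)

theorem refl_braid_zero {r s : Fin n} (hr : (r : ℕ) = 0) (hs : (s : ℕ) = 1)
    (ν : D.IsoComp β n) :
    D.refl s (D.refl r (D.refl s (D.refl r ν))) = D.refl r (D.refl s (D.refl r (D.refl s ν))) :=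
  Subtype.ext (wordRefl_braid_zero hr hs ν.1)

namespace Point

variable {D}

/-- The action of `s_r` on points. -/
def refl (r : Fin n) (p : D.Point β n F) : D.Point β n F where
  w := (weylSystem n).simple r * p.w
  word := wordRefl D.conj r p.word
  comp := D.refl r p.comp
  comp_eq l := by
    rw [refl_val, wordRefl_apply, wordRefl_apply]
    split_ifs <;> simp [p.comp_eq]
  regular := p.regular.wordRefl D r

theorem refl_refl (r : Fin n) (p : D.Point β n F) : (p.refl r).refl r = p := by
  refine Point.ext ?_ (wordRefl_wordRefl D.conj_conj r p.word) (D.refl_refl r p.comp)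
  exact (weylSystem n).simple_mul_simple_cancel_left r

theorem simple_mul_comm {r s : Fin n} (h : (r : ℕ) + 1 < s) :
    (weylSystem n).simple r * (weylSystem n).simple s =
      (weylSystem n).simple s * (weylSystem n).simple r := by
  have h0 := (weylSystem n).wordProd_braidWord_eq r s
  rw [CoxeterSystem.braidWord, CoxeterSystem.braidWord, coxB_apply, coxB_apply,
    if_neg (by simp only [Fin.ext_iff]; omega), if_neg (by omega), if_neg (by omega),
    if_neg (by simp only [Fin.ext_iff]; omega), if_neg (by omega), if_neg (by omega)] at h0
  simpa [CoxeterSystem.alternatingWord, CoxeterSystem.wordProd] using h0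

theorem simple_braid {r s : Fin n} (hr : (r : ℕ) ≠ 0) (hs : (s : ℕ) = r + 1) :
    (weylSystem n).simple s * ((weylSystem n).simple r * (weylSystem n).simple s) =
      (weylSystem n).simple r * ((weylSystem n).simple s * (weylSystem n).simple r) := by
  have h0 := (weylSystem n).wordProd_braidWord_eq r s
  rw [CoxeterSystem.braidWord, CoxeterSystem.braidWord, coxB_apply, coxB_apply,
    if_neg (by simp only [Fin.ext_iff]; omega), if_neg (by omega), if_pos (by omega),
    if_neg (by simp only [Fin.ext_iff]; omega), if_neg (by omega), if_pos (by omega)] at h0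
  simpa [CoxeterSystem.alternatingWord, CoxeterSystem.wordProd] using h0

theorem simple_braid_zero {r s : Fin n} (hr : (r : ℕ) = 0) (hs : (s : ℕ) = 1) :
    (weylSystem n).simple s * ((weylSystem n).simple r *
      ((weylSystem n).simple s * (weylSystem n).simple r)) =
      (weylSystem n).simple r * ((weylSystem n).simple s *
        ((weylSystem n).simple r * (weylSystem n).simple s)) := by
  have h0 := (weylSystem n).wordProd_braidWord_eq s r
  rw [CoxeterSystem.braidWord, CoxeterSystem.braidWord, coxB_apply, coxB_apply,
    if_neg (by simp only [Fin.ext_iff]; omega), if_pos (by omega),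
    if_neg (by simp only [Fin.ext_iff]; omega), if_pos (by omega)] at h0
  simpa [CoxeterSystem.alternatingWord, CoxeterSystem.wordProd] using h0

theorem refl_comm {r s : Fin n} (h : (r : ℕ) + 1 < s) (p : D.Point β n F) :
    (p.refl s).refl r = (p.refl r).refl s := by
  refine Point.ext ?_ (wordRefl_comm h p.word) (D.refl_comm h p.comp)
  simp only [refl, ← mul_assoc, simple_mul_comm h]

theorem refl_braid {r s : Fin n} (hr : (r : ℕ) ≠ 0) (hs : (s : ℕ) = r + 1)
    (p : D.Point β n F) :
    ((p.refl s).refl r).refl s = ((p.refl r).refl s).refl r := by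
  refine Point.ext ?_ (wordRefl_braid hr hs p.word) (D.refl_braid hr hs p.comp)
  have := congrArg (· * p.w) (simple_braid hr hs)
  simpa only [refl, mul_assoc] using this

theorem refl_braid_zero {r s : Fin n} (hr : (r : ℕ) = 0) (hs : (s : ℕ) = 1)
    (p : D.Point β n F) :
    (((p.refl s).refl r).refl s).refl r = (((p.refl r).refl s).refl r).refl s := by
  refine Point.ext ?_ (wordRefl_braid_zero hr hs p.word).symm (D.refl_braid_zero hr hs p.comp).symm
  have := congrArg (· * p.w) (simple_braid_zero hr hs).symm
  simpa only [refl, mul_assoc] using this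

theorem word_refl (r l : Fin n) (p : D.Point β n F) :
    (p.refl r).word l = if (r : ℕ) = 0 then (if l = r then D.conj (p.word r) else p.word l) else
      if l = r then p.word (prevIdx r) else if l = prevIdx r then p.word r else p.word l :=
  wordRefl_apply _ _ _ _

end Point

open Classical in
/-- The coefficient of the reflection in the operator of a crossing. -/
noncomputable def crossA (l m : Letter J F) : F :=
  if l.col = m.col then 1 / (l.val - m.val) else D.crossCoeff l m

open Classical in
/-- The coefficient of the identity in the operator of a crossing. -/
noncomputable def crossB (l m : Letter J F) : F :=
  if l.col = m.col then -(1 / (l.val - m.val)) else 0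

open Classical in
/-- The coefficient of the reflection in the operator of a conjugation. -/
noncomputable def poleA (l : Letter J F) : F :=
  if D.θ l.col = l.col then 1 / l.val else D.poleCoeff l

open Classical in
/-- The coefficient of the identity in the operator of a conjugation. -/
noncomputable def poleB (l : Letter J F) : F :=
  if D.θ l.col = l.col then -(1 / l.val) else 0

/-- The coefficient of the reflection in `τ_r`. -/
noncomputable def tauA (r : Fin n) (p : D.Point β n F) : F :=
  if (r : ℕ) = 0 then D.poleA (p.word r) else D.crossA (p.word (prevIdx r)) (p.word r)

/-- The coefficient of the identity in `τ_r`. -/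
noncomputable def tauB (r : Fin n) (p : D.Point β n F) : F :=
  if (r : ℕ) = 0 then D.poleB (p.word r) else crossB (p.word (prevIdx r)) (p.word r)

variable (β F) in
/-- The operator `τ_r` on functions of points. -/
noncomputable def tauOp (r : Fin n) : Module.End k (D.Point β n F → F) where
  toFun φ p := D.tauA r p * φ (p.refl r) + D.tauB r p * φ p
  map_add' φ ψ := by
    funext p
    simp only [Pi.add_apply]
    ring
  map_smul' c φ := by
    funext p
    simp only [Pi.smul_apply, RingHom.id_apply, smul_add, mul_smul_comm]

variable (β n F) in
/-- Multiplication by a function of points. -/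
noncomputable def mulOp : (D.Point β n F → F) →ₐ[k] Module.End k (D.Point β n F → F) :=
  Algebra.lmul k _

/-- The operator of multiplication by a coordinate. -/
noncomputable def xOp (l : Fin n) : Module.End k (D.Point β n F → F) :=
  D.mulOp β n F fun p => (p.word l).val

open Classical in
variable (F) in
/-- The operator of restriction to a given composition. -/
noncomputable def eOp (ν : D.IsoComp β n) : Module.End k (D.Point β n F → F) :=
  D.mulOp β n F fun p => if p.comp = ν then 1 else 0

theorem tauOp_apply (r : Fin n) (φ : D.Point β n F → F) (p : D.Point β n F) :
    D.tauOp β F r φ p = D.tauA r p * φ (p.refl r) + D.tauB r p * φ p := rfl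

theorem mulOp_apply (f φ : D.Point β n F → F) (p : D.Point β n F) :
    D.mulOp β n F f φ p = f p * φ p := rfl

theorem xOp_apply (l : Fin n) (φ : D.Point β n F → F) (p : D.Point β n F) :
    D.xOp l φ p = (p.word l).val * φ p := rfl

open Classical in
theorem eOp_apply (ν : D.IsoComp β n) (φ : D.Point β n F → F) (p : D.Point β n F) :
    D.eOp F ν φ p = (if p.comp = ν then 1 else 0) * φ p := rfl

variable {D} in
/-- The values of the letters of a point. -/
def Point.vals (p : D.Point β n F) : Fin n → F := fun l => (p.word l).val

theorem ordEval_xOp (f : MvPolynomial (Fin n) k) :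
    ordEval (D.xOp (β := β) (F := F)) f = D.mulOp β n F fun p => MvPolynomial.aeval p.vals f := by
  have h := map_ordEval (D.mulOp β n F) (fun l (p : D.Point β n F) => (p.word l).val) f
  change _ = ordEval (D.xOp (β := β) (F := F)) f at h
  rw [← h, ordEval_eq_aeval]
  congr 1
  funext p
  have h2 : (Pi.evalAlgHom k (fun _ : D.Point β n F => F) p).comp
      (MvPolynomial.aeval (fun l (p : D.Point β n F) => (p.word l).val)) =
      MvPolynomial.aeval p.vals := by
    ext l
    simp [Point.vals]
  exact congrArg (fun g : MvPolynomial (Fin n) k →ₐ[k] F => g f) h2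

/-- The identity term is present only for two equal colours or for a fixed first colour, that is,
only where s_r fixes the composition. Hence τ_r respects the decomposition by compositions. -/
theorem tauB_eq_zero {r : Fin n} {p : D.Point β n F} (h : (p.refl r).comp ≠ p.comp) :
    D.tauB r p = 0 := by
  by_contra h0
  apply h
  refine Subtype.ext (funext fun l => ?_)
  rw [Point.comp_eq, Point.comp_eq, Point.word_refl]
  unfold tauB poleB crossB at h0
  split_ifs at h0 ⊢ <;> simp_all

theorem eOp_mul_self (ν : D.IsoComp β n) : D.eOp F ν * D.eOp F ν = D.eOp F ν := by
  rw [eOp, ← map_mul]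
  congr 1
  funext p
  simp

theorem eOp_mul_ne {ν μ : D.IsoComp β n} (h : ν ≠ μ) : D.eOp F ν * D.eOp F μ = 0 := by
  rw [eOp, eOp, ← map_mul, ← map_zero (D.mulOp β n F)]
  congr 1
  funext p
  by_cases h1 : p.comp = ν
  · simp [h1, h]
  · simp [h1]

theorem sum_eOp : ∑ ν : D.IsoComp β n, D.eOp F ν = 1 := by
  classical
  simp only [eOp, ← map_sum]
  rw [← map_one (D.mulOp β n F)]
  congr 1
  funext p
  simp

theorem tauOp_mul_eOp (r : Fin n) (ν : D.IsoComp β n) :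
    D.tauOp β F r * D.eOp F ν = D.eOp F (D.refl r ν) * D.tauOp β F r := by
  refine LinearMap.ext fun φ => funext fun p => ?_
  simp only [Module.End.mul_apply, tauOp_apply, eOp_apply]
  have h1 : (p.refl r).comp = ν ↔ p.comp = D.refl r ν := by
    constructor
    · rintro rfl
      exact (D.refl_refl r p.comp).symm
    · intro h
      change D.refl r p.comp = ν
      rw [h, D.refl_refl]
  by_cases h2 : (p.refl r).comp = p.comp
  · rw [h2] at h1
    by_cases h3 : p.comp = ν
    · rw [if_pos (h2.trans h3), if_pos h3, if_pos (h1.mp h3)]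
      ring
    · rw [if_neg (fun h => h3 (h2.symm.trans h)), if_neg h3, if_neg (fun h => h3 (h1.mpr h))]
      ring
  · rw [D.tauB_eq_zero h2]
    by_cases h3 : p.comp = D.refl r ν
    · simp [h1, h3]
    · simp [h1, h3]

/-- To compare `a e(ν)` and `b e(ν)` it suffices to compare values at the points of a suitable
composition. -/
theorem mul_eOp_eq {a b : Module.End k (D.Point β n F → F)} {ν ν' : D.IsoComp β n}
    (ha : a * D.eOp F ν = D.eOp F ν' * a) (hb : b * D.eOp F ν = D.eOp F ν' * b)
    (h : ∀ (φ : D.Point β n F → F) (p : D.Point β n F), p.comp = ν' → a φ p = b φ p) :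
    a * D.eOp F ν = b * D.eOp F ν := by
  rw [ha, hb]
  refine LinearMap.ext fun φ => funext fun p => ?_
  simp only [Module.End.mul_apply, eOp_apply]
  by_cases hp : p.comp = ν'
  · rw [h φ p hp]
  · simp [hp]

theorem mulOp_mul_eOp (f : D.Point β n F → F) (ν : D.IsoComp β n) :
    D.mulOp β n F f * D.eOp F ν = D.eOp F ν * D.mulOp β n F f := by
  rw [eOp, ← map_mul, ← map_mul, mul_comm]

end CoeffDatum

/-! ### The relations between the operators -/

namespace CoeffDatum

variable {k J : Type*} [Field k] {D : CoeffDatum k J} {β : J →₀ ℕ} {n : ℕ}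
  {F : Type*} [Field F]

theorem poleB_eq {l : Letter J F} (h : D.θ l.col = l.col) : D.poleB l = -(1 / l.val) := if_pos h

theorem poleB_ne {l : Letter J F} (h : D.θ l.col ≠ l.col) : D.poleB l = 0 := if_neg h

variable [Algebra k F]

theorem PerfectAlong.hermitianAt (h : D.PerfectAlong β n) {r : Fin n} (hr : (r : ℕ) ≠ 0)
    (p : D.Point β n F) : D.HermitianAt (p.word (prevIdx r)).col (p.word r).col := by
  rw [← p.comp_eq, ← p.comp_eq]
  exact h.1 p.comp r hr

theorem PerfectAlong.selfConjugateAt (h : D.PerfectAlong β n) (r : Fin n)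
    (p : D.Point β n F) : D.SelfConjugateAt (p.word r).col := by
  rw [← p.comp_eq]
  exact h.2 p.comp r

theorem tauOp_apply_zero {r : Fin n} (hr : (r : ℕ) = 0) (φ : D.Point β n F → F)
    (p : D.Point β n F) :
    D.tauOp β F r φ p = D.poleA (p.word r) * φ (p.refl r) + D.poleB (p.word r) * φ p := by
  rw [tauOp_apply, tauA, tauB, if_pos hr, if_pos hr]

theorem tauOp_apply_pos {r : Fin n} (hr : (r : ℕ) ≠ 0) (φ : D.Point β n F → F)
    (p : D.Point β n F) :
    D.tauOp β F r φ p = D.crossA (p.word (prevIdx r)) (p.word r) * φ (p.refl r) +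
      crossB (p.word (prevIdx r)) (p.word r) * φ p := by
  rw [tauOp_apply, tauA, tauB, if_neg hr, if_neg hr]

theorem crossA_eq {l m : Letter J F} (h : l.col = m.col) :
    D.crossA l m = 1 / (l.val - m.val) := if_pos h

theorem crossA_ne {l m : Letter J F} (h : l.col ≠ m.col) :
    D.crossA l m = D.crossCoeff l m := if_neg h

theorem crossB_eq {l m : Letter J F} (h : l.col = m.col) :
    crossB l m = -(1 / (l.val - m.val)) := if_pos h

theorem crossB_ne {l m : Letter J F} (h : l.col ≠ m.col) : crossB l m = 0 := if_neg h

theorem poleA_eq {l : Letter J F} (h : D.θ l.col = l.col) : D.poleA l = 1 / l.val := if_pos h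

theorem poleA_ne {l : Letter J F} (h : D.θ l.col ≠ l.col) : D.poleA l = D.poleCoeff l := if_neg h

namespace Point

theorem word_refl_self {r : Fin n} (hr : (r : ℕ) ≠ 0) (p : D.Point β n F) :
    (p.refl r).word r = p.word (prevIdx r) := by
  rw [word_refl, if_neg hr, if_pos rfl]

theorem word_refl_prev {r : Fin n} (hr : (r : ℕ) ≠ 0) (p : D.Point β n F) :
    (p.refl r).word (prevIdx r) = p.word r := by
  rw [word_refl, if_neg hr, if_neg (prevIdx_ne hr), if_pos rfl]

theorem word_refl_ne {r l : Fin n} (hr : (r : ℕ) ≠ 0) (h1 : l ≠ r) (h2 : l ≠ prevIdx r)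
    (p : D.Point β n F) : (p.refl r).word l = p.word l := by
  rw [word_refl, if_neg hr, if_neg h1, if_neg h2]

theorem word_refl_zero {r : Fin n} (hr : (r : ℕ) = 0) (p : D.Point β n F) :
    (p.refl r).word r = D.conj (p.word r) := by
  rw [word_refl, if_pos hr, if_pos rfl]

theorem word_refl_zero_ne {r l : Fin n} (hr : (r : ℕ) = 0) (h : l ≠ r) (p : D.Point β n F) :
    (p.refl r).word l = p.word l := by
  rw [word_refl, if_pos hr, if_neg h]

end Point

/-- For equal colours the operator is a divided difference and has square zero, as (M1) demands. For
different colours the reflection is applied twice, and the two coefficients multiply to Q. -/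
theorem tauOp_sq (hP : D.PerfectAlong β n) (hM1 : D.MatRegular) {r : Fin n} (hr : (r : ℕ) ≠ 0)
    (φ : D.Point β n F → F) (p : D.Point β n F) :
    D.tauOp β F r (D.tauOp β F r φ) p =
      MvPolynomial.aeval ![(p.word r).val, (p.word (prevIdx r)).val]
        (D.Q (p.word (prevIdx r)).col (p.word r).col) * φ p := by
  simp only [tauOp_apply_pos hr, Point.word_refl_self hr, Point.word_refl_prev hr, Point.refl_refl]
  have hd := p.regular.val_sub_ne_zero (prevIdx_ne hr)
  have hd' := p.regular.val_sub_ne_zero (prevIdx_ne hr).symm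
  by_cases h : (p.word (prevIdx r)).col = (p.word r).col
  · rw [crossA_eq h, crossB_eq h, crossA_eq h.symm, crossB_eq h.symm, h, hM1]
    simp only [map_zero, zero_mul]
    field_simp
    ring
  · rw [crossA_ne h, crossB_ne h, crossA_ne (Ne.symm h), crossB_ne (Ne.symm h),
      ← D.crossCoeff_mul (hP.hermitianAt hr p) (p.regular.mark_ne _ _ (prevIdx_ne hr))]
    ring

theorem tauOp_sq_zero (hP : D.PerfectAlong β n) (hV1 : D.VecRegular) {r : Fin n}
    (hr : (r : ℕ) = 0) (φ : D.Point β n F → F) (p : D.Point β n F) :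
    D.tauOp β F r (D.tauOp β F r φ) p =
      Polynomial.aeval (-(p.word r).val) (D.Q' (p.word r).col) * φ p := by
  simp only [tauOp_apply_zero hr, Point.word_refl_zero hr, Point.refl_refl]
  have hd := p.regular.val_ne_zero r
  by_cases h : D.θ (p.word r).col = (p.word r).col
  · have h' : D.θ (D.conj (p.word r)).col = (D.conj (p.word r)).col := by simp [h]
    rw [poleA_eq h, poleB_eq h, poleA_eq h', poleB_eq h', hV1 _ h, conj_val]
    simp only [map_zero, zero_mul]
    field_simp
    ring
  · have h' : D.θ (D.conj (p.word r)).col ≠ (D.conj (p.word r)).col := by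
      simpa [D.θ_invol (p.word r).col] using Ne.symm h
    rw [poleA_ne h, poleB_ne h, poleA_ne h', poleB_ne h',
      ← D.poleCoeff_mul (hP.selfConjugateAt r p) (p.regular.mark_ne_zero r)]
    ring

theorem tauOp_comm {r s : Fin n} (h : (r : ℕ) + 1 < s) :
    D.tauOp β F r * D.tauOp β F s = D.tauOp β F s * D.tauOp β F r := by
  have hs : (s : ℕ) ≠ 0 := by omega
  have h1 : r ≠ s := by simp only [ne_eq, Fin.ext_iff]; omega
  have h2 : r ≠ prevIdx s := by simp only [ne_eq, Fin.ext_iff, prevIdx_val]; omega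
  have key : ∀ q : D.Point β n F, D.tauA r (q.refl s) = D.tauA r q ∧
      D.tauB r (q.refl s) = D.tauB r q ∧ D.tauA s (q.refl r) = D.tauA s q ∧
      D.tauB s (q.refl r) = D.tauB s q := by
    intro q
    have e1 := Point.word_refl_ne hs h1 h2 q
    by_cases hr : (r : ℕ) = 0
    · have e2 := Point.word_refl_zero_ne hr h1.symm q
      have e3 := Point.word_refl_zero_ne hr h2.symm q
      simp only [tauA, tauB, if_pos hr, if_neg hs, e1, e2, e3, and_self]
    · have h3 : prevIdx r ≠ s := by simp only [ne_eq, Fin.ext_iff, prevIdx_val]; omega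
      have h4 : prevIdx r ≠ prevIdx s := by simp only [ne_eq, Fin.ext_iff, prevIdx_val]; omega
      have e2 := Point.word_refl_ne hs h3 h4 q
      have e3 := Point.word_refl_ne hr h1.symm h3.symm q
      have e4 := Point.word_refl_ne hr h2.symm h4.symm q
      simp only [tauA, tauB, if_neg hr, if_neg hs, e1, e2, e3, e4, and_self]
  refine LinearMap.ext fun φ => funext fun p => ?_
  obtain ⟨k1, k2, k3, k4⟩ := key p
  simp only [Module.End.mul_apply, tauOp_apply, k1, k2, k3, k4, Point.refl_comm h]
  ring

-- The proof is an identity of rational functions for each of the five patterns of equal colours. A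
-- correction survives only when the outer letters share a colour that differs from the middle one:
-- the identity term of their divided difference leaves the middle letter crossed twice with the
-- same outer letter, a different one on each side.
open Classical in
theorem tauOp_braid (hP : D.PerfectAlong β n) (hM1 : D.MatRegular) {r s : Fin n}
    (hr : (r : ℕ) ≠ 0) (hs : (s : ℕ) = r + 1) (φ : D.Point β n F → F) (p : D.Point β n F) :
    D.tauOp β F s (D.tauOp β F r (D.tauOp β F s φ)) p -
      D.tauOp β F r (D.tauOp β F s (D.tauOp β F r φ)) p =
    (if (p.word (prevIdx r)).col = (p.word s).col then
      (MvPolynomial.aeval ![(p.word r).val, (p.word (prevIdx r)).val]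
          (D.Q (p.word (prevIdx r)).col (p.word r).col) -
        MvPolynomial.aeval ![(p.word r).val, (p.word s).val]
          (D.Q (p.word (prevIdx r)).col (p.word r).col)) /
        ((p.word (prevIdx r)).val - (p.word s).val) else 0) * φ p := by
  have hs' : (s : ℕ) ≠ 0 := by omega
  have hps := prevIdx_eq hs
  have h1 := prevIdx_ne hr
  have h2 : r ≠ s := by simp only [ne_eq, Fin.ext_iff]; omega
  have h3 : prevIdx r ≠ s := by simp only [ne_eq, Fin.ext_iff, prevIdx_val]; omega
  have w1 : ∀ q : D.Point β n F, (q.refl r).word r = q.word (prevIdx r) :=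
    Point.word_refl_self hr
  have w2 : ∀ q : D.Point β n F, (q.refl r).word (prevIdx r) = q.word r :=
    Point.word_refl_prev hr
  have w3 : ∀ q : D.Point β n F, (q.refl r).word s = q.word s :=
    Point.word_refl_ne hr h2.symm h3.symm
  have w4 : ∀ q : D.Point β n F, (q.refl s).word s = q.word r := fun q => by
    rw [Point.word_refl_self hs', hps]
  have w5 : ∀ q : D.Point β n F, (q.refl s).word r = q.word s := fun q => by
    conv_lhs => rw [← hps]
    rw [Point.word_refl_prev hs']
  have w6 : ∀ q : D.Point β n F, (q.refl s).word (prevIdx r) = q.word (prevIdx r) :=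
    Point.word_refl_ne hs' h3 (by rw [hps]; exact h1)
  simp only [tauOp_apply_pos hs', tauOp_apply_pos hr, hps, w1, w2, w3, w4, w5, w6,
    Point.refl_refl, Point.refl_braid hr hs]
  have d1 := p.regular.val_sub_ne_zero h1
  have d1' := p.regular.val_sub_ne_zero h1.symm
  have d2 := p.regular.val_sub_ne_zero h2
  have d2' := p.regular.val_sub_ne_zero h2.symm
  have d3 := p.regular.val_sub_ne_zero h3
  have d3' := p.regular.val_sub_ne_zero h3.symm
  have c1 : (p.word (prevIdx r)).col ≠ (p.word r).col →
      D.crossCoeff (p.word (prevIdx r)) (p.word r) * D.crossCoeff (p.word r) (p.word (prevIdx r)) =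
      MvPolynomial.aeval ![(p.word r).val, (p.word (prevIdx r)).val]
        (D.Q (p.word (prevIdx r)).col (p.word r).col) :=
    fun _ => D.crossCoeff_mul (hP.hermitianAt hr p) (p.regular.mark_ne _ _ h1)
  have c2 : (p.word (prevIdx r)).col = (p.word s).col →
      D.crossCoeff (p.word s) (p.word r) * D.crossCoeff (p.word r) (p.word s) =
      MvPolynomial.aeval ![(p.word r).val, (p.word s).val]
        (D.Q (p.word (prevIdx r)).col (p.word r).col) := by
    intro h
    have hH := hP.hermitianAt hr p
    rw [h] at hH ⊢
    exact D.crossCoeff_mul hH (p.regular.mark_ne _ _ h2.symm)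
  generalize p.word (prevIdx r) = a at *
  generalize p.word r = b at *
  generalize p.word s = c at *
  by_cases hab : a.col = b.col
  · by_cases hbc : b.col = c.col
    · have hac := hab.trans hbc
      rw [if_pos hac, hab, hM1]
      rw [crossA_eq hab, crossA_eq hbc, crossA_eq hac, crossB_eq hab, crossB_eq hbc, crossB_eq hac]
      simp only [crossA_eq hab.symm, crossA_eq hbc.symm, crossB_eq hab.symm, crossB_eq hbc.symm,
        map_zero, sub_zero, zero_div, zero_mul]
      field_simp
      ring
    · have hac : a.col ≠ c.col := hab ▸ hbc
      rw [if_neg hac]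
      simp only [crossA_eq hab, crossA_ne hbc, crossA_ne hac, crossB_eq hab, crossB_ne hbc,
        crossB_ne hac]
      field_simp
      ring
  · by_cases hbc : b.col = c.col
    · have hac : a.col ≠ c.col := hbc ▸ hab
      rw [if_neg hac]
      simp only [crossA_ne hab, crossA_eq hbc, crossA_ne hac, crossB_ne hab, crossB_eq hbc,
        crossB_ne hac]
      field_simp
      ring
    · by_cases hac : a.col = c.col
      · rw [if_pos hac, ← c1 hab, ← c2 hac]
        simp only [crossA_ne hab, crossA_ne hbc, crossA_eq hac, crossB_ne hab, crossB_ne hbc,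
          crossB_eq hac, crossA_ne (Ne.symm hab), crossA_ne (Ne.symm hbc), crossB_ne (Ne.symm hab),
          crossB_ne (Ne.symm hbc)]
        field_simp
        ring
      · rw [if_neg hac]
        simp only [crossA_ne hab, crossA_ne hbc, crossA_ne hac, crossB_ne hab, crossB_ne hbc,
          crossB_ne hac]
        ring

end CoeffDatum

/-! ### The braid relation of length four for the operators of s_0 and s_1. -/

namespace CoeffDatum

variable {k J : Type*} [Field k] {D : CoeffDatum k J} {β : J →₀ ℕ} {n : ℕ}
  {F : Type*} [Field F] [Algebra k F]

variable (D) in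
/-- The difference of the two sides of the braid relation of length four, in terms of the first two
letters `a`, `b` of a point and the values of a function on the orbit of the point. -/
noncomputable def braidFour (a b : Letter J F) (f₀ f₁ f₂ f₁₂ f₂₁ f₁₂₁ f₂₁₂ f₄ : F) : F :=
  (D.crossA a b *
      (D.poleA b *
          (D.crossA (D.conj b) a * (D.poleA a * f₄ + D.poleB a * f₂₁₂) +
            crossB (D.conj b) a * (D.poleA (D.conj b) * f₂ + D.poleB (D.conj b) * f₁₂)) +
        D.poleB b *
          (D.crossA b a * (D.poleA a * f₁ + D.poleB a * f₀) +
            crossB b a * (D.poleA b * f₁₂ + D.poleB b * f₂))) +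
    crossB a b *
      (D.poleA a *
          (D.crossA (D.conj a) b * (D.poleA b * f₁₂₁ + D.poleB b * f₂₁) +
            crossB (D.conj a) b * (D.poleA (D.conj a) * f₀ + D.poleB (D.conj a) * f₁)) +
        D.poleB a *
          (D.crossA a b * (D.poleA b * f₁₂ + D.poleB b * f₂) +
            crossB a b * (D.poleA a * f₁ + D.poleB a * f₀)))) -
  (D.poleA a *
      (D.crossA (D.conj a) b *
          (D.poleA b *
              (D.crossA (D.conj b) (D.conj a) * f₄ + crossB (D.conj b) (D.conj a) * f₁₂₁) +
            D.poleB b * (D.crossA b (D.conj a) * f₁ + crossB b (D.conj a) * f₂₁)) +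
        crossB (D.conj a) b *
          (D.poleA (D.conj a) * (D.crossA a b * f₂ + crossB a b * f₀) +
            D.poleB (D.conj a) * (D.crossA (D.conj a) b * f₂₁ + crossB (D.conj a) b * f₁))) +
    D.poleB a *
      (D.crossA a b *
          (D.poleA b * (D.crossA (D.conj b) a * f₂₁₂ + crossB (D.conj b) a * f₁₂) +
            D.poleB b * (D.crossA b a * f₀ + crossB b a * f₂)) +
        crossB a b *
          (D.poleA a * (D.crossA (D.conj a) b * f₂₁ + crossB (D.conj a) b * f₁) +
            D.poleB a * (D.crossA a b * f₂ + crossB a b * f₀))))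

/-- The eight values on the orbit under s_0 and s_1 become independent unknowns. In their names 1
stands for s_0 and 2 for s_1, the rightmost acting first; `f₄` belongs to the longest element. -/
theorem tauOp_braidFour {r s : Fin n} (hr : (r : ℕ) = 0) (hs : (s : ℕ) = 1)
    (φ : D.Point β n F → F) (p : D.Point β n F) :
    D.tauOp β F s (D.tauOp β F r (D.tauOp β F s (D.tauOp β F r φ))) p -
      D.tauOp β F r (D.tauOp β F s (D.tauOp β F r (D.tauOp β F s φ))) p =
    D.braidFour (p.word r) (p.word s) (φ p) (φ (p.refl r)) (φ (p.refl s)) (φ ((p.refl s).refl r))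
      (φ ((p.refl r).refl s)) (φ (((p.refl r).refl s).refl r)) (φ (((p.refl s).refl r).refl s))
      (φ ((((p.refl r).refl s).refl r).refl s)) := by
  have hs' : (s : ℕ) ≠ 0 := by omega
  have hps : prevIdx s = r := prevIdx_eq (by omega)
  have hrs : r ≠ s := by simp only [ne_eq, Fin.ext_iff]; omega
  have w1 : ∀ q : D.Point β n F, (q.refl r).word r = D.conj (q.word r) :=
    Point.word_refl_zero hr
  have w2 : ∀ q : D.Point β n F, (q.refl r).word s = q.word s :=
    Point.word_refl_zero_ne hr hrs.symm
  have w3 : ∀ q : D.Point β n F, (q.refl s).word s = q.word r := fun q => by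
    rw [Point.word_refl_self hs', hps]
  have w4 : ∀ q : D.Point β n F, (q.refl s).word r = q.word s := fun q => by
    conv_lhs => rw [← hps]
    rw [Point.word_refl_prev hs']
  simp only [tauOp_apply_pos hs', tauOp_apply_zero hr, hps, w1, w2, w3, w4, Point.refl_refl,
    Point.refl_braid_zero hr hs, braidFour]

section Local

variable {a b : Letter J F} (f₀ f₁ f₂ f₁₂ f₂₁ f₁₂₁ f₂₁₂ f₄ : F)

/-- All operators involved are divided differences, and those of type B_2 satisfy the braid
relation. -/
theorem braidFour_fixed_eq (hab : a.col = b.col) (hθ : D.θ a.col = a.col) (ha : a.val ≠ 0)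
    (hb : b.val ≠ 0) (hsub : a.val - b.val ≠ 0) (hadd : a.val + b.val ≠ 0) :
    D.braidFour a b f₀ f₁ f₂ f₁₂ f₂₁ f₁₂₁ f₂₁₂ f₄ = 0 := by
  rw [hab] at hθ
  have hsub' : b.val - a.val ≠ 0 := by rwa [← neg_sub, neg_ne_zero] at hsub
  have h1 : -b.val - a.val ≠ 0 := by rwa [← neg_ne_zero, neg_sub, sub_neg_eq_add]
  have h2 : -a.val - b.val ≠ 0 := by
    rw [← neg_ne_zero, neg_sub, sub_neg_eq_add, add_comm]
    exact hadd
  have h3 : -b.val - -a.val ≠ 0 := by rwa [neg_sub_neg]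
  have h4 : b.val - -a.val ≠ 0 := by rwa [sub_neg_eq_add, add_comm]
  simp only [braidFour, crossA, crossB, poleA, poleB, conj_col, conj_val, hab, hθ, if_true]
  field_simp
  ring

/-- Letters of the colour of `a` and `b` cross by divided differences, as do their conjugates. A
conjugate and an unconjugated letter have different colours, and `crossCoeff_conj` equates the
coefficients of their crossings. -/
theorem braidFour_eq (hab : a.col = b.col) (hθ : D.θ a.col ≠ a.col)
    (hM2 : D.MatThetaSymmetric) (hsub : a.val - b.val ≠ 0) :
    D.braidFour a b f₀ f₁ f₂ f₁₂ f₂₁ f₁₂₁ f₂₁₂ f₄ = 0 := by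
  have hc := D.crossCoeff_conj hM2 (D.conj a) b
  rw [D.conj_conj a] at hc
  rw [hab] at hθ
  have hθ' := Ne.symm hθ
  have h3 : -b.val - -a.val ≠ 0 := by rwa [neg_sub_neg]
  simp only [braidFour, crossA, crossB, poleA, poleB, conj_col, conj_val, hab, hθ, hθ',
    D.θ_invol b.col, if_true, if_false, hc]
  field_simp
  ring

/-- There are no identity terms, so each side is `f₄` times a product of four coefficients, and
these agree by (M2). -/
theorem braidFour_else (hab : a.col ≠ b.col) (hab' : D.θ b.col ≠ a.col)
    (ha : D.θ a.col ≠ a.col) (hb : D.θ b.col ≠ b.col) (hM2 : D.MatThetaSymmetric) :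
    D.braidFour a b f₀ f₁ f₂ f₁₂ f₂₁ f₁₂₁ f₂₁₂ f₄ = 0 := by
  have hc := D.crossCoeff_conj hM2 (D.conj a) b
  rw [D.conj_conj a] at hc
  have hc' := D.crossCoeff_conj hM2 a b
  have e1 : D.θ a.col ≠ b.col := fun h => hab' (by rw [← h, D.θ_invol])
  have e2 : D.θ b.col ≠ D.θ a.col := fun h => hab (D.θ_invol.injective h).symm
  simp only [braidFour, crossA, crossB, poleA, poleB, conj_col, hab, hab', e1, e2, ha, hb,
    if_false, hc, hc']
  ring

/-- The only identity term is that of the conjugation of `a`, which is applied first on one side and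
last on the other. Both sides consist of the same two terms, in `f₄` and `f₂₁₂`. -/
theorem braidFour_fixed_left (ha : D.θ a.col = a.col) (hb : D.θ b.col ≠ b.col)
    (hM2 : D.MatThetaSymmetric) :
    D.braidFour a b f₀ f₁ f₂ f₁₂ f₂₁ f₁₂₁ f₂₁₂ f₄ = 0 := by
  have hc := D.crossCoeff_conj hM2 (D.conj a) b
  rw [D.conj_conj a] at hc
  have hc' := D.crossCoeff_conj hM2 a b
  have hab : a.col ≠ b.col := fun h => hb (h ▸ ha)
  have hab' : D.θ b.col ≠ a.col := fun h => hab (by rw [← ha, ← h, D.θ_invol])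
  have e1 : D.θ a.col ≠ b.col := fun h => hab' (by rw [← h, D.θ_invol])
  have e2 : D.θ b.col ≠ D.θ a.col := fun h => hab (D.θ_invol.injective h).symm
  simp only [braidFour, crossA, crossB, poleA, poleB, conj_col, hab, hab', ha, hb,
    if_false, if_true, hc, hc']
  ring

/-- The conjugate of `a` has the colour of `b`, so their crossing is a divided difference with
denominator a + b up to sign. Its identity term leaves one letter conjugated twice: `b` on one side,
giving `qb`, and `a` on the other, giving `qa`. -/
theorem braidFour_conj (hab : a.col ≠ b.col) (hab' : D.θ b.col = a.col)
    (hM2 : D.MatThetaSymmetric) (hadd : a.val + b.val ≠ 0) {qa qb : F}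
    (hqa : D.poleCoeff a * D.poleCoeff (D.conj a) = qa)
    (hqb : D.poleCoeff b * D.poleCoeff (D.conj b) = qb) :
    D.braidFour a b f₀ f₁ f₂ f₁₂ f₂₁ f₁₂₁ f₂₁₂ f₄ * (a.val + b.val) =
      (qb - qa) * (D.crossA a b * f₂ + crossB a b * f₀) := by
  have hc' := D.crossCoeff_conj hM2 a b
  have e1 : D.θ a.col = b.col := by rw [← hab', D.θ_invol]
  have hba := Ne.symm hab
  have h1 : -b.val - a.val ≠ 0 := by rwa [← neg_ne_zero, neg_sub, sub_neg_eq_add]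
  have h2 : -a.val - b.val ≠ 0 := by
    rw [← neg_ne_zero, neg_sub, sub_neg_eq_add, add_comm]
    exact hadd
  simp only [braidFour, crossA, crossB, poleA, poleB, conj_col, conj_val, hab, hba, hab', e1,
    if_false, if_true, hc', ← hqa, ← hqb]
  field_simp
  ring

/-- The identity term in the conjugation of `b` leaves two opposite crossings, of `b` with `a` on
one side and of `b` with the conjugate of `a` on the other. This produces `q'` and `q` over the
value of `b`. -/
theorem braidFour_fixed_right (ha : D.θ a.col ≠ a.col) (hb : D.θ b.col = b.col)
    (hM2 : D.MatThetaSymmetric) (hb0 : b.val ≠ 0) {q q' : F}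
    (hq : D.crossCoeff (D.conj a) b * D.crossCoeff b (D.conj a) = q)
    (hq' : D.crossCoeff a b * D.crossCoeff b a = q') :
    D.braidFour a b f₀ f₁ f₂ f₁₂ f₂₁ f₁₂₁ f₂₁₂ f₄ * b.val =
      (q - q') * (D.poleA a * f₁ + D.poleB a * f₀) := by
  have hc := D.crossCoeff_conj hM2 (D.conj a) b
  rw [D.conj_conj a] at hc
  have hc' := D.crossCoeff_conj hM2 a b
  have hab : a.col ≠ b.col := fun h => ha (h ▸ hb)
  have hab' : D.θ a.col ≠ b.col := fun h => hab (by rw [← hb, ← h, D.θ_invol])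
  have e1 := Ne.symm hab
  have e2 := Ne.symm hab'
  simp only [braidFour, crossA, crossB, poleA, poleB, conj_col, hab, hab', e1, e2, ha, hb,
    if_false, if_true, hc, hc', ← hq, ← hq']
  field_simp
  ring

/-- Here the conjugation of `a` is a divided difference, so x_1 τ_0 + 1 is the plain reflection and
the bracket on the right equals `f₁`. On the left the terms in `f₀` cancel as well. -/
theorem braidFour_fixed_ne (ha : D.θ a.col = a.col) (hb : D.θ b.col = b.col)
    (hab : a.col ≠ b.col) (hM2 : D.MatThetaSymmetric) (ha0 : a.val ≠ 0) (hb0 : b.val ≠ 0)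
    {q q' : F} (hq : D.crossCoeff (D.conj a) b * D.crossCoeff b (D.conj a) = q)
    (hq' : D.crossCoeff a b * D.crossCoeff b a = q') :
    D.braidFour a b f₀ f₁ f₂ f₁₂ f₂₁ f₁₂₁ f₂₁₂ f₄ * (a.val * b.val) =
      (q - q') * (a.val * (D.poleA a * f₁ + D.poleB a * f₀) + f₀) := by
  have hc := D.crossCoeff_conj hM2 (D.conj a) b
  rw [D.conj_conj a] at hc
  have hc' := D.crossCoeff_conj hM2 a b
  have e1 := Ne.symm hab
  simp only [braidFour, crossA, crossB, poleA, poleB, conj_col, hab, e1, ha, hb,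
    if_false, if_true, hc, hc', ← hq, ← hq']
  field_simp
  ring

end Local

end CoeffDatum

/-! ### Operators that shift one composition to another. -/

namespace CoeffDatum

variable {k J : Type*} [Field k] {D : CoeffDatum k J} {β : J →₀ ℕ} {n : ℕ}

theorem refl_three_val {r s : Fin n} (hr : (r : ℕ) ≠ 0) (hs : (s : ℕ) = r + 1)
    (ν : D.IsoComp β n) :
    (D.refl s (D.refl r (D.refl s ν))).1 = ν.1 ∘ Equiv.swap (prevIdx r) s := by
  have hs' : (s : ℕ) ≠ 0 := by omega
  have h1 := prevIdx_ne hr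
  have h2 : r ≠ s := by simp only [ne_eq, Fin.ext_iff]; omega
  have h3 : prevIdx r ≠ s := by simp only [ne_eq, Fin.ext_iff, prevIdx_val]; omega
  funext l
  simp only [refl_val, wordRefl_pos _ hs', wordRefl_pos _ hr, prevIdx_eq hs, Function.comp_apply]
  generalize prevIdx r = a at *
  by_cases ha : l = a
  · subst ha
    simp [Equiv.swap_apply_of_ne_of_ne, *]
  by_cases hb : l = r
  · subst hb
    simp [Equiv.swap_apply_of_ne_of_ne, *, Ne.symm]
  by_cases hc : l = s
  · subst hc
    simp [Equiv.swap_apply_of_ne_of_ne, *, Ne.symm]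
  simp [Equiv.swap_apply_of_ne_of_ne, *]

theorem refl_four_apply {r s : Fin n} (hr : (r : ℕ) = 0) (hs : (s : ℕ) = 1)
    (ν : D.IsoComp β n) (l : Fin n) :
    (D.refl s (D.refl r (D.refl s (D.refl r ν)))).1 l =
      if l = r ∨ l = s then D.θ (ν.1 l) else ν.1 l := by
  have hs' : (s : ℕ) ≠ 0 := by omega
  have h2 : r ≠ s := by simp only [ne_eq, Fin.ext_iff]; omega
  have hps : prevIdx s = r := prevIdx_eq (by omega)
  by_cases ha : l = r
  · subst ha
    simp [refl_val, wordRefl_apply, hs', hr, hps, h2, h2.symm]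
  by_cases hb : l = s
  · subst hb
    simp [refl_val, wordRefl_apply, hs', hr, hps, h2, h2.symm]
  simp [refl_val, wordRefl_apply, hs', hr, hps, ha, hb]

variable {F : Type*} [Field F] [Algebra k F]

variable (D β n F) in
/-- The operators attached to the generators of the orientifold KLR algebra. -/
noncomputable def opGen : OGen (D.IsoComp β n) n → Module.End k (D.Point β n F → F)
  | .e ν => D.eOp F ν
  | .x l => D.xOp l
  | .tau r => D.tauOp β F r

/-- The operator `a` maps functions supported on `ν` to functions supported on `ν'`. -/
def Shifts (a : Module.End k (D.Point β n F → F)) (ν ν' : D.IsoComp β n) : Prop :=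
  a * D.eOp F ν = D.eOp F ν' * a

theorem Shifts.mul {a b : Module.End k (D.Point β n F → F)} {ν ν' ν'' : D.IsoComp β n}
    (ha : Shifts a ν' ν'') (hb : Shifts b ν ν') : Shifts (a * b) ν ν'' := by
  unfold Shifts at *
  rw [mul_assoc, hb, ← mul_assoc, ha, mul_assoc]

theorem Shifts.sub {a b : Module.End k (D.Point β n F → F)} {ν ν' : D.IsoComp β n}
    (ha : Shifts a ν ν') (hb : Shifts b ν ν') : Shifts (a - b) ν ν' := by
  unfold Shifts at *
  rw [sub_mul, mul_sub, ha, hb]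

theorem Shifts.add {a b : Module.End k (D.Point β n F → F)} {ν ν' : D.IsoComp β n}
    (ha : Shifts a ν ν') (hb : Shifts b ν ν') : Shifts (a + b) ν ν' := by
  unfold Shifts at *
  rw [add_mul, mul_add, ha, hb]

theorem shifts_one (ν : D.IsoComp β n) : Shifts (F := F) 1 ν ν := by simp [Shifts]

theorem shifts_zero (ν ν' : D.IsoComp β n) : Shifts (F := F) 0 ν ν' := by simp [Shifts]

theorem shifts_tau (r : Fin n) (ν : D.IsoComp β n) :
    Shifts (D.tauOp β F r) ν (D.refl r ν) := D.tauOp_mul_eOp r ν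

theorem shifts_mulOp (f : D.Point β n F → F) (ν : D.IsoComp β n) :
    Shifts (D.mulOp β n F f) ν ν := D.mulOp_mul_eOp f ν

theorem shifts_xOp (l : Fin n) (ν : D.IsoComp β n) :
    Shifts (D.xOp (F := F) l) ν ν := D.mulOp_mul_eOp _ ν

theorem shifts_three {r s : Fin n} (hr : (r : ℕ) ≠ 0) (hs : (s : ℕ) = r + 1)
    (ν : D.IsoComp β n) :
    Shifts (D.tauOp β F s * D.tauOp β F r * D.tauOp β F s -
      D.tauOp β F r * D.tauOp β F s * D.tauOp β F r) ν
      (D.refl s (D.refl r (D.refl s ν))) := by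
  refine Shifts.sub (((shifts_tau _ _).mul (shifts_tau _ _)).mul (shifts_tau _ _)) ?_
  rw [D.refl_braid hr hs]
  exact ((shifts_tau _ _).mul (shifts_tau _ _)).mul (shifts_tau _ _)

theorem shifts_four {r s : Fin n} (hr : (r : ℕ) = 0) (hs : (s : ℕ) = 1)
    (ν : D.IsoComp β n) :
    Shifts ((D.tauOp β F s * D.tauOp β F r) ^ 2 - (D.tauOp β F r * D.tauOp β F s) ^ 2) ν
      (D.refl s (D.refl r (D.refl s (D.refl r ν)))) := by
  rw [pow_two, pow_two]
  refine Shifts.sub (((shifts_tau _ _).mul (shifts_tau _ _)).mul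
    ((shifts_tau _ _).mul (shifts_tau _ _))) ?_
  rw [D.refl_braid_zero hr hs]
  exact ((shifts_tau _ _).mul (shifts_tau _ _)).mul ((shifts_tau _ _).mul (shifts_tau _ _))

theorem Shifts.eq {a b : Module.End k (D.Point β n F → F)} {ν ν' : D.IsoComp β n}
    (ha : Shifts a ν ν') (hb : Shifts b ν ν')
    (h : ∀ (φ : D.Point β n F → F) (p : D.Point β n F), p.comp = ν' → a φ p = b φ p) :
    a * D.eOp F ν = b * D.eOp F ν := D.mul_eOp_eq ha hb h

theorem refl_eq_self {r : Fin n} (hr : (r : ℕ) ≠ 0) {ν : D.IsoComp β n}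
    (h : ν.1 (prevIdx r) = ν.1 r) : D.refl r ν = ν := by
  refine Subtype.ext (funext fun l => ?_)
  rw [refl_val, wordRefl_apply, if_neg hr]
  split_ifs with h1 h2
  · rw [h1, h]
  · rw [h2, h]
  · rfl

theorem refl_zero_eq_self {r : Fin n} (hr : (r : ℕ) = 0) {ν : D.IsoComp β n}
    (h : D.θ (ν.1 r) = ν.1 r) : D.refl r ν = ν := by
  refine Subtype.ext (funext fun l => ?_)
  rw [refl_val, wordRefl_apply, if_pos hr]
  split_ifs with h1
  · rw [h1, h]
  · rfl

theorem aeval_vals_X (p : D.Point β n F) (l : Fin n) :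
    MvPolynomial.aeval p.vals (MvPolynomial.X l : MvPolynomial (Fin n) k) = (p.word l).val := by
  rw [MvPolynomial.aeval_X]
  rfl

theorem aeval_polynomial {σ : Type*} (x : σ → F) (f : Polynomial k) (a : MvPolynomial σ k) :
    MvPolynomial.aeval x (Polynomial.aeval a f) = Polynomial.aeval (MvPolynomial.aeval x a) f :=
  (Polynomial.aeval_algHom_apply _ _ _).symm

end CoeffDatum

/-! ### The quadratic and braid relations for the operators. -/

namespace CoeffDatum

variable {k J : Type*} [Field k] {D : CoeffDatum k J} {β : J →₀ ℕ} {n : ℕ}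
  {F : Type*} [Field F] [Algebra k F]

theorem opGen_quad (hP : D.PerfectAlong β n) (hM1 : D.MatRegular) {r : Fin n}
    (hr : (r : ℕ) ≠ 0) (ν : D.IsoComp β n) :
    D.tauOp β F r * D.tauOp β F r * D.eOp F ν =
      ordEval (D.xOp (F := F)) (subst₂ (D.Q (ν.1 (prevIdx r)) (ν.1 r)) (MvPolynomial.X r)
        (MvPolynomial.X (prevIdx r))) * D.eOp F ν := by
  rw [ordEval_xOp]
  refine Shifts.eq (ν' := ν) ?_ (shifts_mulOp _ _) fun φ p hp => ?_
  · have h := (shifts_tau (F := F) r (D.refl r ν)).mul (shifts_tau r ν)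
    rwa [D.refl_refl] at h
  · subst hp
    rw [Module.End.mul_apply, tauOp_sq hP hM1 hr, mulOp_apply, aeval_subst₂, aeval_vals_X,
      aeval_vals_X, p.comp_eq, p.comp_eq]

theorem opGen_quad_zero (hP : D.PerfectAlong β n) (hV1 : D.VecRegular) {r : Fin n}
    (hr : (r : ℕ) = 0) (ν : D.IsoComp β n) :
    D.tauOp β F r * D.tauOp β F r * D.eOp F ν =
      ordEval (D.xOp (F := F)) (Polynomial.aeval (-MvPolynomial.X r : MvPolynomial (Fin n) k)
        (D.Q' (ν.1 r))) * D.eOp F ν := by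
  rw [ordEval_xOp]
  refine Shifts.eq (ν' := ν) ?_ (shifts_mulOp _ _) fun φ p hp => ?_
  · have h := (shifts_tau (F := F) r (D.refl r ν)).mul (shifts_tau r ν)
    rwa [D.refl_refl] at h
  · subst hp
    rw [Module.End.mul_apply, tauOp_sq_zero hP hV1 hr, mulOp_apply, aeval_polynomial, map_neg,
      aeval_vals_X, p.comp_eq]

theorem opGen_braid_eq (hP : D.PerfectAlong β n) (hM1 : D.MatRegular) {r s : Fin n}
    (hr : (r : ℕ) ≠ 0) (hs : (s : ℕ) = r + 1) {ν : D.IsoComp β n}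
    (hν : ν.1 (prevIdx r) = ν.1 s) {g d : MvPolynomial (Fin n) k}
    (hg : g * (MvPolynomial.X (prevIdx r) - MvPolynomial.X s) =
      d * (subst₂ (D.Q (ν.1 (prevIdx r)) (ν.1 r)) (MvPolynomial.X r) (MvPolynomial.X (prevIdx r)) -
        subst₂ (D.Q (ν.1 (prevIdx r)) (ν.1 r)) (MvPolynomial.X r) (MvPolynomial.X s))) :
    ordEval (D.xOp (F := F)) d * (D.tauOp β F s * D.tauOp β F r * D.tauOp β F s -
      D.tauOp β F r * D.tauOp β F s * D.tauOp β F r) * D.eOp F ν =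
    ordEval (D.xOp (F := F)) g * D.eOp F ν := by
  have h3 : prevIdx r ≠ s := by simp only [ne_eq, Fin.ext_iff, prevIdx_val]; omega
  have hν' : D.refl s (D.refl r (D.refl s ν)) = ν := by
    refine Subtype.ext ?_
    rw [refl_three_val hr hs]
    funext l
    by_cases h1 : l = prevIdx r
    · simp [h1, hν]
    by_cases h2 : l = s
    · simp [h2, hν]
    simp [Equiv.swap_apply_of_ne_of_ne h1 h2]
  have hsh := shifts_three (F := F) hr hs ν
  rw [hν'] at hsh
  rw [ordEval_xOp, ordEval_xOp]
  refine Shifts.eq ((shifts_mulOp _ _).mul hsh) (shifts_mulOp _ _) fun φ p hp => ?_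
  subst hp
  have hb := tauOp_braid hP hM1 hr hs φ p
  rw [p.comp_eq, p.comp_eq] at hν
  rw [if_pos hν] at hb
  have hd := p.regular.val_sub_ne_zero h3
  have hg' := congrArg (MvPolynomial.aeval p.vals) hg
  simp only [map_mul, map_sub, aeval_subst₂, aeval_vals_X, p.comp_eq] at hg'
  simp only [Module.End.mul_apply, LinearMap.sub_apply, Pi.sub_apply, mulOp_apply]
  -- A fraction enters the relation through a pair `g`, `d`. At a regular point its denominator does
  -- not vanish, so the identity `hg` can be divided by it.
  rw [hb, ← mul_assoc, ← mul_div_assoc, ← hg', mul_div_cancel_right₀ _ hd]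

theorem opGen_braid_ne (hP : D.PerfectAlong β n) (hM1 : D.MatRegular) {r s : Fin n}
    (hr : (r : ℕ) ≠ 0) (hs : (s : ℕ) = r + 1) {ν : D.IsoComp β n}
    (hν : ν.1 (prevIdx r) ≠ ν.1 s) :
    (D.tauOp β F s * D.tauOp β F r * D.tauOp β F s -
      D.tauOp β F r * D.tauOp β F s * D.tauOp β F r) * D.eOp F ν = 0 := by
  rw [← zero_mul (D.eOp F ν)]
  refine Shifts.eq (shifts_three hr hs ν) (shifts_zero _ _) fun φ p hp => ?_
  have hb := tauOp_braid hP hM1 hr hs φ p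
  have hp' : p.comp.1 = ν.1 ∘ Equiv.swap (prevIdx r) s := by rw [hp, refl_three_val hr hs]
  rw [if_neg, zero_mul] at hb
  · exact hb
  · rw [← p.comp_eq, ← p.comp_eq, hp']
    simpa using hν.symm

/-- The setup for the braid relations of length four. -/
theorem opGen_braid_four {r s : Fin n} (hr : (r : ℕ) = 0) (hs : (s : ℕ) = 1)
    {ν : D.IsoComp β n} {p : D.Point β n F}
    (hp : p.comp = D.refl s (D.refl r (D.refl s (D.refl r ν)))) :
    (ν.1 r = D.θ (p.word r).col ∧ ν.1 s = D.θ (p.word s).col) ∧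
      ∀ φ : D.Point β n F → F, ((D.tauOp β F s * D.tauOp β F r) ^ 2 -
        (D.tauOp β F r * D.tauOp β F s) ^ 2) φ p =
      D.braidFour (p.word r) (p.word s) (φ p) (φ (p.refl r)) (φ (p.refl s))
        (φ ((p.refl s).refl r)) (φ ((p.refl r).refl s)) (φ (((p.refl r).refl s).refl r))
        (φ (((p.refl s).refl r).refl s)) (φ ((((p.refl r).refl s).refl r).refl s)) := by
  refine ⟨⟨?_, ?_⟩, fun φ => ?_⟩
  -- The relation refers to the colours of the source ν, whereas values are taken at a point of the
  -- target, which differs by θ in the first two entries.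
  · rw [← p.comp_eq, hp, refl_four_apply hr hs, if_pos (Or.inl rfl), D.θ_invol]
  · rw [← p.comp_eq, hp, refl_four_apply hr hs, if_pos (Or.inr rfl), D.θ_invol]
  · rw [← tauOp_braidFour hr hs, pow_two, pow_two]
    rfl

theorem PerfectAlong.hermitianAt_conj (hP : D.PerfectAlong β n) {r s : Fin n}
    (hr : (r : ℕ) = 0) (hs : (s : ℕ) = 1) (p : D.Point β n F) :
    D.HermitianAt (D.conj (p.word r)).col (p.word s).col := by
  have h := hP.hermitianAt (r := s) (by omega) (p.refl r)
  rwa [prevIdx_eq (show (s : ℕ) = r + 1 by omega), Point.word_refl_zero hr,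
    Point.word_refl_zero_ne hr (by simp only [ne_eq, Fin.ext_iff]; omega)] at h

theorem PerfectAlong.hermitianAt_zero (hP : D.PerfectAlong β n) {r s : Fin n}
    (hr : (r : ℕ) = 0) (hs : (s : ℕ) = 1) (p : D.Point β n F) :
    D.HermitianAt (p.word r).col (p.word s).col := by
  have h := hP.hermitianAt (r := s) (by omega) p
  rwa [prevIdx_eq (show (s : ℕ) = r + 1 by omega)] at h

theorem mark_conj_ne {w : Fin n → Letter J F} (h : Letter.IsRegular k w) {a b : Fin n}
    (hab : a ≠ b) : (D.conj (w a)).mark ≠ (w b).mark := by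
  have := h.mark_ne_neg a b hab
  rw [conj_mark]
  omega

theorem opGen_braid_zero_conj (hP : D.PerfectAlong β n) (hM2 : D.MatThetaSymmetric) {r s : Fin n}
    (hr : (r : ℕ) = 0) (hs : (s : ℕ) = 1) {ν : D.IsoComp β n}
    (h₁ : ν.1 r ≠ ν.1 s) (h₂ : ν.1 s = D.θ (ν.1 r)) {g d : MvPolynomial (Fin n) k}
    (hg : g * (MvPolynomial.X r + MvPolynomial.X s) =
      d * (Polynomial.aeval (MvPolynomial.X s) (D.Q' (ν.1 s)) -
        Polynomial.aeval (MvPolynomial.X r) (D.Q' (ν.1 r)))) :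
    ordEval (D.xOp (F := F)) d * ((D.tauOp β F s * D.tauOp β F r) ^ 2 -
      (D.tauOp β F r * D.tauOp β F s) ^ 2) * D.eOp F ν =
    ordEval (D.xOp (F := F)) g * D.tauOp β F s * D.eOp F ν := by
  have hs' : (s : ℕ) ≠ 0 := by omega
  have hrs : r ≠ s := by simp only [ne_eq, Fin.ext_iff]; omega
  have hps : prevIdx s = r := prevIdx_eq (by omega)
  have hν' : D.refl s (D.refl r (D.refl s (D.refl r ν))) = D.refl s ν := by
    refine Subtype.ext (funext fun l => ?_)
    rw [refl_four_apply hr hs, refl_val, wordRefl_apply, if_neg hs', hps]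
    by_cases h1 : l = r
    · rw [h1, if_pos (Or.inl rfl), if_neg hrs, if_pos rfl, h₂]
    by_cases h2 : l = s
    · rw [h2, if_pos (Or.inr rfl), if_pos rfl, h₂, D.θ_invol]
    simp [h1, h2]
  have hsh := shifts_four (F := F) hr hs ν
  rw [ordEval_xOp, ordEval_xOp]
  refine Shifts.eq ((shifts_mulOp _ _).mul hsh) ?_ fun φ p hp => ?_
  · rw [hν']
    exact (shifts_mulOp _ _).mul (shifts_tau _ _)
  obtain ⟨⟨c1, c2⟩, hB⟩ := opGen_braid_four hr hs hp
  have hd := p.regular.val_add_ne_zero hrs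
  rw [c1, c2, D.θ_invol] at h₂
  have hab : (p.word r).col ≠ (p.word s).col := fun h => h₁ (by rw [c1, c2, h])
  have hK := braidFour_conj (φ p) (φ (p.refl r)) (φ (p.refl s))
        (φ ((p.refl s).refl r)) (φ ((p.refl r).refl s)) (φ (((p.refl r).refl s).refl r))
        (φ (((p.refl s).refl r).refl s)) (φ ((((p.refl r).refl s).refl r).refl s)) hab h₂ hM2 hd
    (D.poleCoeff_mul (hP.selfConjugateAt r p) (p.regular.mark_ne_zero r))
    (D.poleCoeff_mul (hP.selfConjugateAt s p) (p.regular.mark_ne_zero s))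
  have hg' := congrArg (MvPolynomial.aeval p.vals) hg
  simp only [map_mul, map_sub, map_add, aeval_polynomial, aeval_vals_X, c1, c2] at hg'
  -- The products of coefficients involve the colours at `p` and negated values, the relation
  -- involves the conjugate colours; (V3) identifies the two.
  rw [(hP.selfConjugateAt r p).aeval, (hP.selfConjugateAt s p).aeval, neg_neg, neg_neg,
    ← hB φ] at hK
  rw [← hps, ← tauOp_apply_pos hs', hps] at hK
  simp only [Module.End.mul_apply, mulOp_apply]
  refine mul_right_cancel₀ hd ?_
  linear_combination MvPolynomial.aeval p.vals d * hK - D.tauOp β F s φ p * hg'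

theorem opGen_braid_zero_fix (hP : D.PerfectAlong β n) (hM2 : D.MatThetaSymmetric) {r s : Fin n}
    (hr : (r : ℕ) = 0) (hs : (s : ℕ) = 1) {ν : D.IsoComp β n}
    (h₁ : ν.1 r ≠ D.θ (ν.1 r)) (h₂ : ν.1 s = D.θ (ν.1 s)) {g d : MvPolynomial (Fin n) k}
    (hg : g * MvPolynomial.X s =
      d * (subst₂ (D.Q (ν.1 r) (ν.1 s)) (MvPolynomial.X s) (-MvPolynomial.X r) -
        subst₂ (D.Q (ν.1 r) (ν.1 s)) (-MvPolynomial.X s) (-MvPolynomial.X r))) :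
    ordEval (D.xOp (F := F)) d * ((D.tauOp β F s * D.tauOp β F r) ^ 2 -
      (D.tauOp β F r * D.tauOp β F s) ^ 2) * D.eOp F ν =
    ordEval (D.xOp (F := F)) g * D.tauOp β F r * D.eOp F ν := by
  have hrs : r ≠ s := by simp only [ne_eq, Fin.ext_iff]; omega
  have hν' : D.refl s (D.refl r (D.refl s (D.refl r ν))) = D.refl r ν := by
    refine Subtype.ext (funext fun l => ?_)
    rw [refl_four_apply hr hs, refl_val, wordRefl_apply, if_pos hr]
    by_cases h1 : l = r
    · rw [h1, if_pos (Or.inl rfl), if_pos rfl]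
    by_cases h2 : l = s
    · rw [h2, if_pos (Or.inr rfl), if_neg hrs.symm, ← h₂]
    simp [h1, h2]
  have hsh := shifts_four (F := F) hr hs ν
  rw [ordEval_xOp, ordEval_xOp]
  refine Shifts.eq ((shifts_mulOp _ _).mul hsh) ?_ fun φ p hp => ?_
  · rw [hν']
    exact (shifts_mulOp _ _).mul (shifts_tau _ _)
  obtain ⟨⟨c1, c2⟩, hB⟩ := opGen_braid_four hr hs hp
  have hd := p.regular.val_ne_zero s
  rw [c1, D.θ_invol] at h₁
  rw [c2, D.θ_invol] at h₂
  have hK := braidFour_fixed_right (φ p) (φ (p.refl r)) (φ (p.refl s))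
        (φ ((p.refl s).refl r)) (φ ((p.refl r).refl s)) (φ (((p.refl r).refl s).refl r))
        (φ (((p.refl s).refl r).refl s)) (φ ((((p.refl r).refl s).refl r).refl s)) h₁ h₂ hM2 hd
    (D.crossCoeff_mul (hP.hermitianAt_conj hr hs p) (mark_conj_ne p.regular hrs))
    (D.crossCoeff_mul (hP.hermitianAt_zero hr hs p) (p.regular.mark_ne _ _ hrs))
  have hg' := congrArg (MvPolynomial.aeval p.vals) hg
  simp only [map_mul, map_sub, map_neg, aeval_subst₂, aeval_vals_X, c1, c2, h₂] at hg'
  -- Since the second colour is fixed by θ, (M2) followed by (M4) turns Q at the colours of `p` into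
  -- the second term of the relation, with the colours of ν and both values negated.
  have e : MvPolynomial.aeval ![(p.word s).val, (p.word r).val]
      (D.Q (p.word r).col (p.word s).col) =
      MvPolynomial.aeval ![-(p.word s).val, -(p.word r).val]
        (D.Q (D.θ (p.word r).col) (p.word s).col) := by
    rw [hM2.aeval, h₂, ← (h₂ ▸ hP.hermitianAt_conj hr hs p : D.HermitianAt _ _).aeval]
  rw [← hB φ, e, ← tauOp_apply_zero hr, conj_col, conj_val] at hK
  simp only [Module.End.mul_apply, mulOp_apply]
  refine mul_right_cancel₀ hd ?_
  linear_combination MvPolynomial.aeval p.vals d * hK - D.tauOp β F r φ p * hg'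

theorem opGen_braid_zero_fix_fix (hP : D.PerfectAlong β n) (hM2 : D.MatThetaSymmetric)
    {r s : Fin n} (hr : (r : ℕ) = 0) (hs : (s : ℕ) = 1) {ν : D.IsoComp β n}
    (h₁ : D.θ (ν.1 r) = ν.1 r) (h₂ : ν.1 r ≠ ν.1 s) (h₃ : ν.1 s = D.θ (ν.1 s))
    {g d : MvPolynomial (Fin n) k}
    (hg : g * (MvPolynomial.X r * MvPolynomial.X s) =
      d * (subst₂ (D.Q (ν.1 r) (ν.1 s)) (MvPolynomial.X s) (-MvPolynomial.X r) -
        subst₂ (D.Q (ν.1 r) (ν.1 s)) (MvPolynomial.X s) (MvPolynomial.X r))) :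
    ordEval (D.xOp (F := F)) d * ((D.tauOp β F s * D.tauOp β F r) ^ 2 -
      (D.tauOp β F r * D.tauOp β F s) ^ 2) * D.eOp F ν =
    ordEval (D.xOp (F := F)) g * (D.xOp r * D.tauOp β F r + 1) * D.eOp F ν := by
  have hrs : r ≠ s := by simp only [ne_eq, Fin.ext_iff]; omega
  have hν' : D.refl s (D.refl r (D.refl s (D.refl r ν))) = ν := by
    refine Subtype.ext (funext fun l => ?_)
    rw [refl_four_apply hr hs]
    by_cases h1 : l = r
    · rw [h1, if_pos (Or.inl rfl), h₁]
    by_cases h2 : l = s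
    · rw [h2, if_pos (Or.inr rfl), ← h₃]
    simp [h1, h2]
  have hsh := shifts_four (F := F) hr hs ν
  rw [ordEval_xOp, ordEval_xOp]
  refine Shifts.eq ((shifts_mulOp _ _).mul hsh) ?_ fun φ p hp => ?_
  · rw [hν']
    refine (shifts_mulOp _ _).mul (((shifts_xOp _ _).mul ?_).add (shifts_one _))
    have := shifts_tau (F := F) r ν
    rwa [refl_zero_eq_self hr h₁] at this
  obtain ⟨⟨c1, c2⟩, hB⟩ := opGen_braid_four hr hs hp
  have hd1 := p.regular.val_ne_zero r
  have hd2 := p.regular.val_ne_zero s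
  rw [c1, D.θ_invol] at h₁
  rw [c2, D.θ_invol] at h₃
  rw [c1, c2, ← h₁, h₃] at h₂
  rw [← h₁] at c1
  rw [h₃] at c2
  have hK := braidFour_fixed_ne (φ p) (φ (p.refl r)) (φ (p.refl s))
        (φ ((p.refl s).refl r)) (φ ((p.refl r).refl s)) (φ (((p.refl r).refl s).refl r))
        (φ (((p.refl s).refl r).refl s)) (φ ((((p.refl r).refl s).refl r).refl s)) h₁.symm h₃
      h₂ hM2 hd1 hd2
    (D.crossCoeff_mul (hP.hermitianAt_conj hr hs p) (mark_conj_ne p.regular hrs))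
    (D.crossCoeff_mul (hP.hermitianAt_zero hr hs p) (p.regular.mark_ne _ _ hrs))
  have hg' := congrArg (MvPolynomial.aeval p.vals) hg
  simp only [map_mul, map_sub, map_neg, aeval_subst₂, aeval_vals_X, c1, c2] at hg'
  rw [← hB φ, ← tauOp_apply_zero hr, conj_col, conj_val, ← h₁] at hK
  simp only [Module.End.mul_apply, mulOp_apply, LinearMap.add_apply, Pi.add_apply, xOp_apply,
    Module.End.one_apply]
  refine mul_right_cancel₀ (mul_ne_zero hd1 hd2) ?_
  linear_combination MvPolynomial.aeval p.vals d * hK -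
    ((p.word r).val * D.tauOp β F r φ p + φ p) * hg'

theorem opGen_braid_zero_else (hM2 : D.MatThetaSymmetric)
    {r s : Fin n} (hr : (r : ℕ) = 0) (hs : (s : ℕ) = 1) {ν : D.IsoComp β n}
    (h₁ : ¬ (ν.1 r ≠ ν.1 s ∧ ν.1 s = D.θ (ν.1 r)))
    (h₂ : ¬ (ν.1 r ≠ D.θ (ν.1 r) ∧ ν.1 s = D.θ (ν.1 s)))
    (h₃ : ¬ (D.θ (ν.1 r) = ν.1 r ∧ ν.1 r ≠ ν.1 s ∧ ν.1 s = D.θ (ν.1 s))) :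
    ((D.tauOp β F s * D.tauOp β F r) ^ 2 - (D.tauOp β F r * D.tauOp β F s) ^ 2) *
      D.eOp F ν = 0 := by
  have hrs : r ≠ s := by simp only [ne_eq, Fin.ext_iff]; omega
  rw [← zero_mul (D.eOp F ν)]
  refine Shifts.eq (shifts_four hr hs ν) (shifts_zero _ _) fun φ p hp => ?_
  obtain ⟨⟨c1, c2⟩, hB⟩ := opGen_braid_four hr hs hp
  rw [hB, LinearMap.zero_apply, Pi.zero_apply]
  rw [c1, c2] at h₁ h₂ h₃
  simp only [D.θ_invol _, ne_eq, D.θ_invol.injective.eq_iff] at h₁ h₂ h₃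
  by_cases ha : D.θ (p.word r).col = (p.word r).col
  · by_cases hb : D.θ (p.word s).col = (p.word s).col
    · have hab : (p.word r).col = (p.word s).col := by
        by_contra h
        exact h₃ ⟨ha.symm, h, hb⟩
      exact braidFour_fixed_eq _ _ _ _ _ _ _ _ hab ha (p.regular.val_ne_zero r)
        (p.regular.val_ne_zero s) (p.regular.val_sub_ne_zero hrs) (p.regular.val_add_ne_zero hrs)
    · exact braidFour_fixed_left _ _ _ _ _ _ _ _ ha hb hM2
  · have hb : D.θ (p.word s).col ≠ (p.word s).col := fun h => h₂ ⟨ha, h⟩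
    by_cases hab : (p.word r).col = (p.word s).col
    · exact braidFour_eq _ _ _ _ _ _ _ _ hab ha hM2 (p.regular.val_sub_ne_zero hrs)
    · exact braidFour_else _ _ _ _ _ _ _ _ hab (fun h => h₁ ⟨hab, h⟩) ha hb hM2

end CoeffDatum

/-! ### The mixed relations and the resulting representation. -/

namespace CoeffDatum

variable {k J : Type*} [Field k] {D : CoeffDatum k J} {β : J →₀ ℕ} {n : ℕ}
  {F : Type*} [Field F] [Algebra k F]

theorem opGen_mixed_left {r : Fin n} (hr : (r : ℕ) ≠ 0) {ν : D.IsoComp β n}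
    (hν : ν.1 (prevIdx r) = ν.1 r) :
    (D.tauOp β F r * D.xOp (prevIdx r) - D.xOp r * D.tauOp β F r) * D.eOp F ν =
      -D.eOp F ν := by
  have hsh := shifts_tau (F := F) r ν
  rw [refl_eq_self hr hν] at hsh
  rw [← neg_one_mul (D.eOp F ν)]
  refine Shifts.eq ((hsh.mul (shifts_xOp _ _)).sub ((shifts_xOp _ _).mul hsh)) (by simp [Shifts])
    fun φ p hp => ?_
  subst hp
  rw [p.comp_eq, p.comp_eq] at hν
  have hd := p.regular.val_sub_ne_zero (prevIdx_ne hr)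
  simp only [LinearMap.sub_apply, Pi.sub_apply, Module.End.mul_apply, tauOp_apply_pos hr,
    xOp_apply, Point.word_refl_prev hr, crossA_eq hν, crossB_eq hν, LinearMap.neg_apply,
    Pi.neg_apply, Module.End.one_apply]
  field_simp
  ring

theorem opGen_mixed_right {r : Fin n} (hr : (r : ℕ) ≠ 0) {ν : D.IsoComp β n}
    (hν : ν.1 (prevIdx r) = ν.1 r) :
    (D.tauOp β F r * D.xOp r - D.xOp (prevIdx r) * D.tauOp β F r) * D.eOp F ν =
      D.eOp F ν := by
  have hsh := shifts_tau (F := F) r ν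
  rw [refl_eq_self hr hν] at hsh
  conv_rhs => rw [← one_mul (D.eOp F ν)]
  refine Shifts.eq ((hsh.mul (shifts_xOp _ _)).sub ((shifts_xOp _ _).mul hsh)) (shifts_one _)
    fun φ p hp => ?_
  subst hp
  rw [p.comp_eq, p.comp_eq] at hν
  have hd := p.regular.val_sub_ne_zero (prevIdx_ne hr)
  simp only [LinearMap.sub_apply, Pi.sub_apply, Module.End.mul_apply, tauOp_apply_pos hr,
    xOp_apply, Point.word_refl_self hr, crossA_eq hν, crossB_eq hν, Module.End.one_apply]
  field_simp
  ring

theorem opGen_mixed_else {r : Fin n} (hr : (r : ℕ) ≠ 0) {l : Fin n} {ν : D.IsoComp β n}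
    (h : ¬ ((l = prevIdx r ∨ l = r) ∧ ν.1 (prevIdx r) = ν.1 r)) :
    (D.tauOp β F r * D.xOp l - D.xOp (Equiv.swap (prevIdx r) r l) * D.tauOp β F r) *
      D.eOp F ν = 0 := by
  rw [← zero_mul (D.eOp F ν)]
  refine Shifts.eq (((shifts_tau _ _).mul (shifts_xOp _ _)).sub
    ((shifts_xOp _ _).mul (shifts_tau _ _))) (shifts_zero _ _) fun φ p hp => ?_
  have hw : ((p.refl r).word l) = p.word (Equiv.swap (prevIdx r) r l) := by
    change wordRefl D.conj r p.word l = _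
    rw [wordRefl_pos _ hr]
    rfl
  simp only [LinearMap.sub_apply, Pi.sub_apply, Module.End.mul_apply, tauOp_apply_pos hr,
    xOp_apply, hw, LinearMap.zero_apply, Pi.zero_apply]
  by_cases hl : l = prevIdx r ∨ l = r
  · have hc : (p.word (prevIdx r)).col ≠ (p.word r).col := by
      rw [← p.comp_eq, ← p.comp_eq, hp, refl_val, wordRefl_pos _ hr]
      intro h'
      exact h ⟨hl, by simpa using h'.symm⟩
    rw [crossB_ne hc]
    ring
  · rw [not_or] at hl
    rw [Equiv.swap_apply_of_ne_of_ne hl.1 hl.2]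
    ring

theorem opGen_mixed_zero_ne {r : Fin n} (hr : (r : ℕ) = 0) {ν : D.IsoComp β n}
    (hν : ν.1 r ≠ D.θ (ν.1 r)) :
    (D.tauOp β F r * D.xOp r + D.xOp r * D.tauOp β F r) * D.eOp F ν = 0 := by
  rw [← zero_mul (D.eOp F ν)]
  refine Shifts.eq (((shifts_tau _ _).mul (shifts_xOp _ _)).add
    ((shifts_xOp _ _).mul (shifts_tau _ _))) (shifts_zero _ _) fun φ p hp => ?_
  have hc : D.θ (p.word r).col ≠ (p.word r).col := by
    rw [← p.comp_eq, hp, refl_val, wordRefl_zero _ hr, Function.update_self, D.θ_invol]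
    exact hν
  simp only [LinearMap.add_apply, Pi.add_apply, Module.End.mul_apply, tauOp_apply_zero hr,
    xOp_apply, Point.word_refl_zero hr, poleB_ne hc, LinearMap.zero_apply, Pi.zero_apply,
    conj_val]
  ring

theorem opGen_mixed_zero_eq {r : Fin n} (hr : (r : ℕ) = 0) {ν : D.IsoComp β n}
    (hν : ν.1 r = D.θ (ν.1 r)) :
    (D.tauOp β F r * D.xOp r + D.xOp r * D.tauOp β F r) * D.eOp F ν = -2 * D.eOp F ν := by
  have hsh := shifts_tau (F := F) r ν
  rw [refl_zero_eq_self hr hν.symm] at hsh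
  have h2 : Shifts (F := F) (-2) ν ν := by
    rw [show (-2 : Module.End k (D.Point β n F → F)) = 0 - (1 + 1) by norm_num]
    exact (shifts_zero _ _).sub ((shifts_one _).add (shifts_one _))
  refine Shifts.eq ((hsh.mul (shifts_xOp _ _)).add ((shifts_xOp _ _).mul hsh)) h2
    fun φ p hp => ?_
  subst hp
  rw [p.comp_eq] at hν
  have hd := p.regular.val_ne_zero r
  have e2 : (-2 : Module.End k (D.Point β n F → F)) φ p = -2 * φ p := by
    rw [show (-2 : Module.End k (D.Point β n F → F)) = 0 - (1 + 1) by norm_num]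
    simp only [LinearMap.sub_apply, LinearMap.add_apply, LinearMap.zero_apply, Pi.sub_apply,
      Pi.add_apply, Module.End.one_apply, Pi.zero_apply]
    ring
  rw [e2]
  simp only [LinearMap.add_apply, Pi.add_apply, Module.End.mul_apply, tauOp_apply_zero hr,
    xOp_apply, Point.word_refl_zero hr, poleB_eq hν.symm, poleA_eq hν.symm, conj_val]
  field_simp
  ring

theorem opGen_mixed_zero_comm {r : Fin n} (hr : (r : ℕ) = 0) {l : Fin n} (hl : l ≠ r) :
    D.tauOp β F r * D.xOp l = D.xOp l * D.tauOp β F r := by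
  refine LinearMap.ext fun φ => funext fun p => ?_
  simp only [Module.End.mul_apply, tauOp_apply, xOp_apply, Point.word_refl_zero_ne hr hl]
  ring

theorem opGen_rel (hP : D.PerfectAlong β n) (hM1 : D.MatRegular) (hM2 : D.MatThetaSymmetric)
    (hV1 : D.VecRegular) {a b : D.Free β n} (h : Rel D β n a b) :
    FreeAlgebra.lift k (D.opGen β n F) a = FreeAlgebra.lift k (D.opGen β n F) b := by
  have hp : ∀ f, FreeAlgebra.lift k (D.opGen β n F) (D.fpoly β f) =
      ordEval (D.xOp (F := F)) f := fun f => by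
    rw [map_ordEval]
    simp only [FreeAlgebra.lift_ι_apply]
    rfl
  have h2 : FreeAlgebra.lift k (D.opGen β n F) (-2) = -2 := by
    rw [map_neg, map_ofNat]
  cases h <;>
    simp only [map_mul, map_sub, map_add, map_neg, map_pow, map_sum, map_one, map_zero, hp, h2,
      FreeAlgebra.lift_ι_apply, opGen]
  case e_mul_self ν => exact D.eOp_mul_self ν
  case e_mul_ne ν μ h => exact D.eOp_mul_ne h
  case e_sum => exact D.sum_eOp
  case x_e l ν => exact D.mulOp_mul_eOp _ ν
  case tau_e r ν => exact D.tauOp_mul_eOp r ν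
  case x_x l l' => rw [xOp, xOp, ← map_mul, ← map_mul, mul_comm]
  case quad r hr ν => exact opGen_quad hP hM1 hr ν
  case quad_zero r hr ν => exact opGen_quad_zero hP hV1 hr ν
  case tau_comm r s h => exact tauOp_comm h
  case braid_eq r s hr hs ν hν g d hg => exact opGen_braid_eq hP hM1 hr hs hν hg
  case braid_ne r s hr hs ν hν => exact opGen_braid_ne hP hM1 hr hs hν
  case braid_zero_conj r s hr hs ν h₁ h₂ g d hg =>
    exact opGen_braid_zero_conj hP hM2 hr hs h₁ h₂ hg
  case braid_zero_fix r s hr hs ν h₁ h₂ g d hg =>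
    exact opGen_braid_zero_fix hP hM2 hr hs h₁ h₂ hg
  case braid_zero_fix_fix r s hr hs ν h₁ h₂ h₃ g d hg =>
    exact opGen_braid_zero_fix_fix hP hM2 hr hs h₁ h₂ h₃ hg
  case braid_zero_else r s hr hs ν h₁ h₂ h₃ => exact opGen_braid_zero_else hM2 hr hs h₁ h₂ h₃
  case mixed_left r hr ν hν => exact opGen_mixed_left hr hν
  case mixed_right r hr ν hν => exact opGen_mixed_right hr hν
  case mixed_else r hr l ν h => exact opGen_mixed_else hr h
  case mixed_zero_ne r hr ν hν => exact opGen_mixed_zero_ne hr hν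
  case mixed_zero_eq r hr ν hν => exact opGen_mixed_zero_eq hr hν
  case mixed_zero_comm r hr l hl => exact opGen_mixed_zero_comm hr hl

variable (F) in
/-- If `Q` and `Q'` are perfect along `β`, then the orientifold KLR algebra acts on functions of
points. -/
theorem exists_rep (hP : D.PerfectAlong β n) (hM1 : D.MatRegular) (hM2 : D.MatThetaSymmetric)
    (hV1 : D.VecRegular) :
    ∃ ρ : D.OKLR β n →ₐ[k] Module.End k (D.Point β n F → F),
      ∀ s, ρ (D.gen β n s) = D.opGen β n F s := by
  refine ⟨RingQuot.liftAlgHom k ⟨FreeAlgebra.lift k (D.opGen β n F),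
    fun _ _ h => opGen_rel hP hM1 hM2 hV1 h⟩, fun s => ?_⟩
  rw [gen]
  erw [RingQuot.liftAlgHom_mkAlgHom_apply]
  rw [FreeAlgebra.lift_ι_apply]

end CoeffDatum

/-! ### Linear independence -/

namespace CoeffDatum

variable {k J : Type*} [Field k] {D : CoeffDatum k J} {β : J →₀ ℕ} {n : ℕ}
  {F : Type*} [Field F] [Algebra k F]

/-- Values of a regular word are algebraically independent, so a nonzero polynomial has a nonzero
value; this is how (M3) is used. -/
theorem crossA_ne_zero (hM3 : D.MatNonvanishing) {w : Fin n → Letter J F}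
    (hw : Letter.IsRegular k w) {a b : Fin n} (hab : a ≠ b) : D.crossA (w a) (w b) ≠ 0 := by
  unfold crossA crossCoeff
  split_ifs with h1 h2
  · exact one_div_ne_zero (hw.val_sub_ne_zero hab)
  · exact one_ne_zero
  · exact fun h => hM3 _ _ h1 (hw.val_algebraicIndependent b a hab.symm _ h)

theorem poleA_ne_zero (hV2 : D.VecNonvanishing) {w : Fin n → Letter J F}
    (hw : Letter.IsRegular k w) (a : Fin n) : D.poleA (w a) ≠ 0 := by
  unfold poleA poleCoeff
  split_ifs with h1 h2
  · exact one_div_ne_zero (hw.val_ne_zero a)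
  · exact one_ne_zero
  · exact fun h => hV2 _ h1 (transcendental_iff.mp
      (Letter.IsRegular.transcendental_neg (hw.val_transcendental a)) _ h)

theorem tauA_ne_zero (hM3 : D.MatNonvanishing) (hV2 : D.VecNonvanishing) (r : Fin n)
    (p : D.Point β n F) : D.tauA r p ≠ 0 := by
  unfold tauA
  split_ifs with h
  · exact poleA_ne_zero hV2 p.regular r
  · exact crossA_ne_zero hM3 p.regular (prevIdx_ne h)

/-- Functions supported on the points with trivial Weyl group component. -/
def SupportedAtOne (φ : D.Point β n F → F) : Prop := ∀ p, p.w ≠ 1 → φ p = 0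

/-- The operator τ_r sees only `p` and s_r p, so a word applied to φ at `p` combines values of φ at
images of `p` under subwords. A word not longer than `p.w` reaches the trivial group element only if
no letter is skipped and its product is `p.w`. -/
theorem tauOp_word_eq_zero {φ : D.Point β n F → F} (hφ : SupportedAtOne φ) (ω : List (Fin n))
    (p : D.Point β n F) (hl : ω.length ≤ (weylSystem n).length p.w)
    (hp : p.w ≠ (weylSystem n).wordProd ω) : (ω.map (D.tauOp β F)).prod φ p = 0 := by
  induction ω generalizing p with
  | nil => exact hφ p (by simpa using hp)
  | cons r ω ih =>
    rw [List.map_cons, List.prod_cons, Module.End.mul_apply, tauOp_apply]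
    rw [List.length_cons] at hl
    have h1 : (ω.map (D.tauOp β F)).prod φ p = 0 := by
      refine ih p (by omega) ?_
      intro h
      have := (weylSystem n).length_wordProd_le ω
      rw [← h] at this
      omega
    have h2 : (ω.map (D.tauOp β F)).prod φ (p.refl r) = 0 := by
      refine ih _ ?_ ?_
      · change ω.length ≤ (weylSystem n).length ((weylSystem n).simple r * p.w)
        rcases (weylSystem n).length_simple_mul p.w r with h | h <;> omega
      · intro h
        apply hp
        rw [CoxeterSystem.wordProd_cons, ← h]
        exact ((weylSystem n).simple_mul_simple_cancel_left r).symm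
    rw [h1, h2, mul_zero, mul_zero, add_zero]

/-- Successive reflection of a point along a word. -/
def Point.reflWord (p : D.Point β n F) : List (Fin n) → D.Point β n F
  | [] => p
  | r :: ω => (p.refl r).reflWord ω

theorem Point.exists_reflWord_eq (q : D.Point β n F) (ω : List (Fin n)) :
    ∃ p : D.Point β n F, p.reflWord ω = q ∧ p.w = (weylSystem n).wordProd ω * q.w := by
  induction ω with
  | nil => exact ⟨q, rfl, by simp⟩
  | cons r ω ih =>
    obtain ⟨p, hp, hw⟩ := ih
    refine ⟨p.refl r, ?_, ?_⟩
    · rw [reflWord, Point.refl_refl, hp]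
    · rw [CoxeterSystem.wordProd_cons, mul_assoc, ← hw]
      rfl

/-- Skipping a letter of a reduced word leaves too few letters to reach the trivial group element.
So only the term with all reflections survives, and its coefficient is a product of nonzero `tauA`.
-/
theorem tauOp_word_apply (hM3 : D.MatNonvanishing) (hV2 : D.VecNonvanishing) (ω : List (Fin n))
    (hω : (weylSystem n).IsReduced ω) (p : D.Point β n F)
    (hp : p.w = (weylSystem n).wordProd ω) :
    ∃ c : F, c ≠ 0 ∧ ∀ φ : D.Point β n F → F, SupportedAtOne φ →
      (ω.map (D.tauOp β F)).prod φ p = c * φ (p.reflWord ω) := by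
  induction ω generalizing p with
  | nil => exact ⟨1, one_ne_zero, fun φ _ => by simp [Point.reflWord]⟩
  | cons r ω ih =>
    have hr : (weylSystem n).IsReduced ω :=
      CoxeterSystem.IsReduced.of_append_right (α := [r]) hω
    have hp' : (p.refl r).w = (weylSystem n).wordProd ω := by
      change (weylSystem n).simple r * p.w = _
      rw [hp, CoxeterSystem.wordProd_cons, CoxeterSystem.simple_mul_simple_cancel_left]
    obtain ⟨c, hc, h⟩ := ih hr (p.refl r) hp'
    refine ⟨D.tauA r p * c, mul_ne_zero (tauA_ne_zero hM3 hV2 r p) hc, fun φ hφ => ?_⟩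
    have hl : (weylSystem n).length p.w = ω.length + 1 := by rw [hp, hω.eq, List.length_cons]
    rw [List.map_cons, List.prod_cons, Module.End.mul_apply, tauOp_apply, h φ hφ,
      tauOp_word_eq_zero hφ ω p (by omega)
        (fun h' => by rw [h', hr.eq] at hl; omega), mul_zero, add_zero, mul_assoc, Point.reflWord]

variable (n) in
theorem isRegular_generic (ν : Fin n → J) :
    Letter.IsRegular k (fun l => (⟨ν l, (l : ℤ) + 1, algebraMap (MvPolynomial (Fin n) k)
      (FractionRing (MvPolynomial (Fin n) k)) (MvPolynomial.X l)⟩ :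
        Letter J (FractionRing (MvPolynomial (Fin n) k)))) := by
  have hinj := IsFractionRing.injective (MvPolynomial (Fin n) k)
    (FractionRing (MvPolynomial (Fin n) k))
  refine ⟨fun a => ?_, fun a => ?_, fun a b hab => ?_, fun a b hab => ?_, fun a b hab f hf => ?_⟩
  · dsimp only
    omega
  · exact (transcendental_algebraMap_iff hinj).mpr (MvPolynomial.transcendental_X k a)
  · rw [ne_eq, Fin.ext_iff] at hab
    dsimp only
    omega
  · dsimp only
    omega
  · have h1 : (MvPolynomial.aeval ![algebraMap (MvPolynomial (Fin n) k)
        (FractionRing (MvPolynomial (Fin n) k)) (MvPolynomial.X a),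
        algebraMap (MvPolynomial (Fin n) k)
        (FractionRing (MvPolynomial (Fin n) k)) (MvPolynomial.X b)] f) =
        algebraMap (MvPolynomial (Fin n) k) (FractionRing (MvPolynomial (Fin n) k))
          (MvPolynomial.rename ![a, b] f) := by
      rw [MvPolynomial.rename_eq_aeval, ← IsScalarTower.coe_toAlgHom' k, ← AlgHom.comp_apply,
        MvPolynomial.comp_aeval]
      congr 2
      funext i
      fin_cases i <;> rfl
    rw [h1] at hf
    have h2 := (map_eq_zero_iff _ hinj).mp hf
    refine (map_eq_zero_iff _ (MvPolynomial.rename_injective _ ?_)).mp h2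
    intro i j hij
    fin_cases i <;> fin_cases j <;> simp_all

/-- A leading term argument. In a relation, fix a term with `w` of maximal length and evaluate at a
point over `w` that is reflected to a generic point of composition ν. Terms with another group
element vanish there, and so do those with another composition; the rest become a common nonzero
factor times distinct monomials. -/
theorem linearIndependent_pbwElement (hP : D.PerfectAlong β n) (hM1 : D.MatRegular)
    (hM2 : D.MatThetaSymmetric) (hM3 : D.MatNonvanishing) (hV1 : D.VecRegular)
    (hV2 : D.VecNonvanishing) {red : WeylB n → List (Fin n)} (hred : IsReducedChoice red) :
    LinearIndependent k (D.pbwElement β red) := by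
  classical
  set F := FractionRing (MvPolynomial (Fin n) k) with hF
  obtain ⟨ρ, hρ⟩ := exists_rep F hP hM1 hM2 hV1
  rw [linearIndependent_iff]
  intro c hc
  by_contra hne
  obtain ⟨⟨w, a, ν⟩, ht, hmax⟩ := c.support.exists_max_image
    (fun t => (weylSystem n).length t.1) (Finsupp.support_nonempty_iff.mpr hne)
  -- the generic point and the test function
  let q : D.Point β n F := ⟨1, _, ν, fun _ => rfl, isRegular_generic n ν.1⟩
  obtain ⟨p, hpq, hpw⟩ := q.exists_reflWord_eq (red w)
  rw [show q.w = 1 from rfl, mul_one] at hpw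
  let φ : D.Point β n F → F := fun p => if p.w = 1 then 1 else 0
  obtain ⟨C, hC, hw⟩ := tauOp_word_apply hM3 hV2 (red w) (hred w).1 p hpw
  let ψ : WeylB n × (Fin n → ℕ) × D.IsoComp β n → (D.Point β n F → F) := fun t =>
    (ordMonomial (D.xOp (F := F)) t.2.1 * D.eOp F t.2.2 : Module.End k (D.Point β n F → F)) φ
  have hmon : ∀ b : Fin n → ℕ, ordMonomial (D.xOp (β := β) (F := F)) b =
      D.mulOp β n F (fun p => ∏ l, (p.word l).val ^ b l) := by
    intro b
    have := map_ordMonomial (D.mulOp β n F)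
      (fun l (p : D.Point β n F) => (p.word l).val) b
    refine this.symm.trans ?_
    rw [ordMonomial_eq_prod]
    change D.mulOp β n F _ = _
    congr 1
    funext p
    simp
  have hψval : ∀ t p, ψ t p = (∏ l, (p.word l).val ^ t.2.1 l) *
      ((if p.comp = t.2.2 then 1 else 0) * φ p) := by
    intro t p
    simp only [ψ]
    rw [hmon, Module.End.mul_apply, mulOp_apply, eOp_apply]
  have hψ : ∀ t, SupportedAtOne (ψ t) := by
    intro t p hp
    rw [hψval]
    simp [φ, hp]
  have hρt : ∀ t, ρ (D.pbwElement β red t) φ = ((red t.1).map (D.tauOp β F)).prod (ψ t) := by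
    intro t
    have h1 : ρ ((red t.1).map fun r => D.gen β n (OGen.tau r)).prod =
        ((red t.1).map (D.tauOp β F)).prod := by
      rw [map_list_prod, List.map_map]
      congr 1
      exact List.map_congr_left fun r _ => hρ _
    have h2 : ρ (ordMonomial (fun l => D.gen β n (OGen.x l)) t.2.1) =
        ordMonomial (D.xOp (F := F)) t.2.1 := by
      have := map_ordMonomial ρ (fun l => D.gen β n (OGen.x l)) t.2.1
      refine this.trans ?_
      congr 1
      funext l
      exact hρ _
    have h3 : ρ (D.gen β n (OGen.e t.2.2)) = D.eOp F t.2.2 := hρ _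
    rw [pbwElement, map_mul, map_mul, h1, h2, h3, mul_assoc]
    rfl
  have hsum : ∑ t ∈ c.support, c t • (ρ (D.pbwElement β red t) φ p) = 0 := by
    rw [Finsupp.linearCombination_apply, Finsupp.sum] at hc
    have := congrArg (fun z => ρ z φ p) hc
    simpa [map_sum, LinearMap.sum_apply, Finset.sum_apply] using this
  have hterm : ∀ t ∈ c.support, c t • (ρ (D.pbwElement β red t) φ p) =
      C * algebraMap (MvPolynomial (Fin n) k) F
        (if t.1 = w ∧ t.2.2 = ν then MvPolynomial.monomial
          (Finsupp.equivFunOnFinite.symm t.2.1) (c t) else 0) := by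
    intro t htc
    rw [hρt]
    by_cases h1 : t.1 = w
    · rw [h1, hw _ (hψ t), hpq, hψval]
      by_cases h2 : t.2.2 = ν
      · have h3 : q.comp = t.2.2 := h2.symm
        rw [if_pos h3, if_pos ⟨rfl, h2⟩, MvPolynomial.monomial_eq, map_mul, Finsupp.prod_fintype _ _ (fun _ => pow_zero _), map_prod]
        simp only [map_pow, Finsupp.equivFunOnFinite_symm_apply_apply]
        have h4 : algebraMap (MvPolynomial (Fin n) k) F (MvPolynomial.C (c t)) =
            algebraMap k F (c t) := by
          rw [← MvPolynomial.algebraMap_eq, ← IsScalarTower.algebraMap_apply]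
        rw [h4, Algebra.smul_def]
        simp only [φ, q, if_true]
        ring
      · have h3 : ¬ q.comp = t.2.2 := fun h => h2 h.symm
        rw [if_neg h3, if_neg (fun h => h2 h.2)]
        simp
    · rw [tauOp_word_eq_zero (hψ t), if_neg (fun h => h1 h.1)]
      · simp
      · rw [hpw, (hred w).2, ← (hred t.1).1.eq, (hred t.1).2]
        exact hmax t htc
      · rw [hpw, (hred w).2, (hred t.1).2]
        exact Ne.symm h1
  rw [Finset.sum_congr rfl hterm, ← Finset.mul_sum, ← map_sum, mul_eq_zero,
    or_iff_right hC, map_eq_zero_iff _ (IsFractionRing.injective _ _)] at hsum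
  have hcoeff := congrArg (MvPolynomial.coeff (Finsupp.equivFunOnFinite.symm a)) hsum
  rw [MvPolynomial.coeff_sum, MvPolynomial.coeff_zero,
    Finset.sum_eq_single_of_mem _ ht] at hcoeff
  · rw [if_pos ⟨rfl, rfl⟩, MvPolynomial.coeff_monomial, if_pos rfl] at hcoeff
    exact Finsupp.mem_support_iff.mp ht hcoeff
  · rintro ⟨w', a', ν'⟩ _ hne'
    split_ifs with h
    · rw [MvPolynomial.coeff_monomial, if_neg]
      intro h'
      apply hne'
      have h3 : a' = a := Finsupp.equivFunOnFinite.symm.injective h'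
      exact Prod.ext h.1 (Prod.ext h3 h.2)
    · simp

end CoeffDatum

/-! ### Symbols in the associated graded algebra -/

namespace AlgFiltration

variable {k A : Type*} [CommRing k] [Ring A] [Algebra k A] (𝓕 : AlgFiltration k A)

/-- The symbol in degree `d` as a linear map. -/
noncomputable def symbolₗ (d : ℕ) : 𝓕.F d →ₗ[k] 𝓕.Gr := DirectSum.lof k ℕ 𝓕.Piece d ∘ₗ 𝓕.proj d

theorem symbol_eq_symbolₗ {d : ℕ} {a : A} (ha : a ∈ 𝓕.F d) :
    𝓕.symbol d a ha = 𝓕.symbolₗ d ⟨a, ha⟩ := rfl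

theorem symbol_congr {d d' : ℕ} (h : d = d') {a b : A} (hab : a = b) (ha : a ∈ 𝓕.F d)
    (hb : b ∈ 𝓕.F d') : 𝓕.symbol d a ha = 𝓕.symbol d' b hb := by
  subst h
  subst hab
  rfl

theorem symbol_mul {i j : ℕ} {a b : A} (ha : a ∈ 𝓕.F i) (hb : b ∈ 𝓕.F j) :
    𝓕.symbol i a ha * 𝓕.symbol j b hb = 𝓕.symbol (i + j) (a * b) (𝓕.mul_mem ha hb) :=
  DirectSum.of_mul_of _ _

theorem symbol_one : 𝓕.symbol 0 1 𝓕.one_mem = 1 := rfl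

theorem symbol_eq_zero_iff {d : ℕ} {a : A} (ha : a ∈ 𝓕.F d) :
    𝓕.symbol d a ha = 0 ↔ a ∈ 𝓕.lt d := by
  have h1 : 𝓕.symbol d a ha = 0 ↔ 𝓕.proj d ⟨a, ha⟩ = 0 := by
    rw [symbol, ← map_zero (DirectSum.of 𝓕.Piece d)]
    exact (DirectSum.of_injective d).eq_iff
  rw [h1, ← LinearMap.mem_ker, ker_proj]
  rfl

theorem symbol_eq_iff {d : ℕ} {a b : A} (ha : a ∈ 𝓕.F d) (hb : b ∈ 𝓕.F d) :
    𝓕.symbol d a ha = 𝓕.symbol d b hb ↔ a - b ∈ 𝓕.lt d := by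
  rw [← 𝓕.symbol_eq_zero_iff ((𝓕.F d).sub_mem ha hb), ← sub_eq_zero]
  simp only [symbol_eq_symbolₗ, ← map_sub]
  rfl

theorem symbol_sum {ι : Type*} (s : Finset ι) {d : ℕ} {a : ι → A} (ha : ∀ i, a i ∈ 𝓕.F d) :
    𝓕.symbol d (∑ i ∈ s, a i) (Submodule.sum_mem _ fun i _ => ha i) =
      ∑ i ∈ s, 𝓕.symbol d (a i) (ha i) := by
  simp only [symbol_eq_symbolₗ, ← map_sum]
  congr 1
  exact Subtype.ext (by simp)

variable {𝓕} in
theorem mul_mem_of_eq {i j d : ℕ} (h : i + j = d) {a b : A} (ha : a ∈ 𝓕.F i) (hb : b ∈ 𝓕.F j) :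
    a * b ∈ 𝓕.F d := h ▸ 𝓕.mul_mem ha hb

end AlgFiltration

section DegFiltration

variable {k A G : Type*} [CommRing k] [Ring A] [Algebra k A] (g : G → A) (deg : G → ℕ)

theorem list_prod_mem_degFiltration (l : List G) :
    (l.map g).prod ∈ (degFiltration k g deg).F (l.map deg).sum :=
  Submodule.subset_span ⟨l, le_rfl, rfl⟩

/-- The symbol of a generator. -/
noncomputable def symGen (k : Type*) {A G : Type*} [CommRing k] [Ring A] [Algebra k A] (g : G → A)
    (deg : G → ℕ) (s : G) : (degFiltration k g deg).Gr :=
  (degFiltration k g deg).symbol (deg s) (g s) (mem_degFiltration k g deg s _ le_rfl)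

theorem prod_map_symGen (l : List G) :
    (l.map (symGen k g deg)).prod =
      (degFiltration k g deg).symbol (l.map deg).sum (l.map g).prod
        (list_prod_mem_degFiltration g deg l) := by
  induction l with
  | nil => exact ((degFiltration k g deg).symbol_one).symm
  | cons s l ih =>
    rw [List.map_cons, List.prod_cons, ih, symGen, AlgFiltration.symbol_mul]
    exact AlgFiltration.symbol_congr _ (by simp) (by simp) _ _

theorem prod_map_symGen_eq {l l' : List G} (h : (l.map deg).sum = (l'.map deg).sum)
    (hl : (l.map g).prod - (l'.map g).prod ∈ (degFiltration k g deg).lt (l.map deg).sum) :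
    (l.map (symGen k g deg)).prod = (l'.map (symGen k g deg)).prod := by
  rw [prod_map_symGen, prod_map_symGen, (degFiltration k g deg).symbol_congr h.symm rfl
    (list_prod_mem_degFiltration g deg l') (h ▸ list_prod_mem_degFiltration g deg l'),
    AlgFiltration.symbol_eq_iff]
  exact hl

end DegFiltration

/-! ### Divisibility of differences -/

namespace CoeffDatum

/-- Modulo `c` the arguments agree, hence so do the values. This turns fractions in the braid
relations into polynomials, so that the relations can be used with d = 1. -/
theorem dvd_subst₂_sub {k σ : Type*} [Field k] (f : MvPolynomial (Fin 2) k)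
    {a a' b b' c : MvPolynomial σ k} (ha : c ∣ a - a') (hb : c ∣ b - b') :
    c ∣ subst₂ f a b - subst₂ f a' b' := by
  have key : ∀ p, MvPolynomial.aeval ![Ideal.Quotient.mkₐ k (Ideal.span {c}) a,
      Ideal.Quotient.mkₐ k (Ideal.span {c}) b] p =
        Ideal.Quotient.mkₐ k (Ideal.span {c}) (subst₂ p a b) := fun p => by
    rw [subst₂, ← AlgHom.comp_apply, MvPolynomial.comp_aeval]
    congr 2
    funext i
    fin_cases i <;> rfl
  have key' : ∀ p, MvPolynomial.aeval ![Ideal.Quotient.mkₐ k (Ideal.span {c}) a',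
      Ideal.Quotient.mkₐ k (Ideal.span {c}) b'] p =
        Ideal.Quotient.mkₐ k (Ideal.span {c}) (subst₂ p a' b') := fun p => by
    rw [subst₂, ← AlgHom.comp_apply, MvPolynomial.comp_aeval]
    congr 2
    funext i
    fin_cases i <;> rfl
  have h : ∀ {x y : MvPolynomial σ k}, c ∣ x - y ↔
      Ideal.Quotient.mkₐ k (Ideal.span {c}) x = Ideal.Quotient.mkₐ k (Ideal.span {c}) y := by
    intro x y
    rw [← Ideal.mem_span_singleton, Ideal.Quotient.mkₐ_eq_mk, Ideal.Quotient.eq]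
  rw [h, ← key, ← key', h.mp ha, h.mp hb]

theorem dvd_aeval_sub {k A : Type*} [CommRing k] [CommRing A] [Algebra k A] (f : Polynomial k)
    {a b c : A} (h : c ∣ a - b) : c ∣ Polynomial.aeval a f - Polynomial.aeval b f := by
  rw [Polynomial.aeval_def, Polynomial.aeval_def, ← Polynomial.eval_map, ← Polynomial.eval_map]
  exact h.trans (Polynomial.sub_dvd_eval_sub a b _)

variable {k J : Type*} [Field k] (D : CoeffDatum k J) {β : J →₀ ℕ} {n : ℕ}

/-! ### Relations in the orientifold KLR algebra -/

variable (β n) in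
/-- The projection of the free algebra to the orientifold KLR algebra. -/
noncomputable def mkO : D.Free β n →ₐ[k] D.OKLR β n := RingQuot.mkAlgHom k (Rel D β n)

theorem mkO_ι (s : OGen (D.IsoComp β n) n) : D.mkO β n (FreeAlgebra.ι k s) = D.gen β n s := rfl

variable {D} in
theorem Rel.mkO_eq {a b : D.Free β n} (h : Rel D β n a b) : D.mkO β n a = D.mkO β n b :=
  RingQuot.mkAlgHom_rel k h

theorem exists_evalO : ∃ f : MvPolynomial (Fin n) k →ₐ[k] D.OKLR β n,
    (∀ p, f p = ordEval (fun l => D.gen β n (OGen.x l)) p) ∧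
      ∀ l, f (MvPolynomial.X l) = D.gen β n (OGen.x l) := by
  refine exists_algHom_of_commute _ fun l l' => ?_
  simpa only [map_mul, mkO_ι] using (Rel.x_x (D := D) (β := β) l l').mkO_eq

variable (β n) in
/-- Evaluation of polynomials at `x_1, …, x_n`. -/
noncomputable def evalO : MvPolynomial (Fin n) k →ₐ[k] D.OKLR β n := D.exists_evalO.choose

theorem evalO_X (l : Fin n) : D.evalO β n (MvPolynomial.X l) = D.gen β n (OGen.x l) :=
  D.exists_evalO.choose_spec.2 l

theorem mkO_fpoly (p : MvPolynomial (Fin n) k) : D.mkO β n (D.fpoly β p) = D.evalO β n p := by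
  rw [map_ordEval]
  exact (D.exists_evalO.choose_spec.1 p).symm

theorem evalO_mem (p : MvPolynomial (Fin n) k) : D.evalO β n p ∈ (D.filtration β n).F 0 := by
  induction p using MvPolynomial.induction_on with
  | C c =>
    rw [← MvPolynomial.algebraMap_eq, AlgHom.commutes]
    exact (D.filtration β n).algebraMap_mem c
  | add p q hp hq => rw [map_add]; exact Submodule.add_mem _ hp hq
  | mul_X p l hp =>
    rw [map_mul, evalO_X]
    exact AlgFiltration.mul_mem_of_eq (zero_add 0) hp
      (mem_degFiltration k _ _ (OGen.x l) 0 le_rfl)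

theorem sum_gen_e : ∑ ν, D.gen β n (OGen.e ν) = 1 := by
  simpa only [map_sum, map_one, mkO_ι] using (Rel.e_sum (D := D) (β := β) (n := n)).mkO_eq

theorem gen_e_mem (ν : D.IsoComp β n) (d : ℕ) :
    D.gen β n (OGen.e ν) ∈ (D.filtration β n).F d :=
  mem_degFiltration k _ _ (OGen.e ν) d (Nat.zero_le d)

theorem gen_x_mem (l : Fin n) (d : ℕ) : D.gen β n (OGen.x l) ∈ (D.filtration β n).F d :=
  mem_degFiltration k _ _ (OGen.x l) d (Nat.zero_le d)

theorem gen_tau_mem (r : Fin n) : D.gen β n (OGen.tau r) ∈ (D.filtration β n).F 1 :=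
  mem_degFiltration k _ _ (OGen.tau r) 1 le_rfl

theorem mem_filtration_of_mul_e {d : ℕ} {a : D.OKLR β n}
    (h : ∀ ν, a * D.gen β n (OGen.e ν) ∈ (D.filtration β n).F d) :
    a ∈ (D.filtration β n).F d := by
  rw [← mul_one a, ← D.sum_gen_e, Finset.mul_sum]
  exact Submodule.sum_mem _ fun ν _ => h ν

theorem evalO_mul_e_mem (p : MvPolynomial (Fin n) k) (ν : D.IsoComp β n) :
    D.evalO β n p * D.gen β n (OGen.e ν) ∈ (D.filtration β n).F 0 :=
  AlgFiltration.mul_mem_of_eq (zero_add 0) (D.evalO_mem p) (D.gen_e_mem ν 0)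

theorem evalO_mul_tau_mul_e_mem (p : MvPolynomial (Fin n) k) (r : Fin n) (ν : D.IsoComp β n) :
    D.evalO β n p * D.gen β n (OGen.tau r) * D.gen β n (OGen.e ν) ∈ (D.filtration β n).F 1 :=
  AlgFiltration.mul_mem_of_eq (add_zero 1)
    (AlgFiltration.mul_mem_of_eq (zero_add 1) (D.evalO_mem p) (D.gen_tau_mem r))
    (D.gen_e_mem ν 0)

theorem gen_tau_sq_mul_e {r : Fin n} (hr : (r : ℕ) ≠ 0) (ν : D.IsoComp β n) :
    D.gen β n (OGen.tau r) * D.gen β n (OGen.tau r) * D.gen β n (OGen.e ν) =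
      D.evalO β n (subst₂ (D.Q (ν.1 (prevIdx r)) (ν.1 r)) (MvPolynomial.X r)
        (MvPolynomial.X (prevIdx r))) * D.gen β n (OGen.e ν) := by
  simpa only [map_mul, mkO_ι, mkO_fpoly] using (Rel.quad r hr ν).mkO_eq

theorem gen_tau_zero_sq_mul_e {r : Fin n} (hr : (r : ℕ) = 0) (ν : D.IsoComp β n) :
    D.gen β n (OGen.tau r) * D.gen β n (OGen.tau r) * D.gen β n (OGen.e ν) =
      D.evalO β n (Polynomial.aeval (-MvPolynomial.X r) (D.Q' (ν.1 r))) *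
        D.gen β n (OGen.e ν) := by
  simpa only [map_mul, mkO_ι, mkO_fpoly] using (Rel.quad_zero r hr ν).mkO_eq

theorem gen_tau_mul_e (r : Fin n) (ν : D.IsoComp β n) :
    D.gen β n (OGen.tau r) * D.gen β n (OGen.e ν) =
      D.gen β n (OGen.e (D.refl r ν)) * D.gen β n (OGen.tau r) := by
  simpa only [map_mul, mkO_ι] using (Rel.tau_e r ν).mkO_eq

theorem gen_tau_sq_mem (r : Fin n) :
    D.gen β n (OGen.tau r) * D.gen β n (OGen.tau r) ∈ (D.filtration β n).F 0 := by
  refine D.mem_filtration_of_mul_e fun ν => ?_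
  by_cases hr : (r : ℕ) = 0
  · rw [D.gen_tau_zero_sq_mul_e hr]
    exact D.evalO_mul_e_mem _ ν
  · rw [D.gen_tau_sq_mul_e hr]
    exact D.evalO_mul_e_mem _ ν

theorem gen_tau_comm {r s : Fin n} (h : (r : ℕ) + 1 < s) :
    D.gen β n (OGen.tau r) * D.gen β n (OGen.tau s) =
      D.gen β n (OGen.tau s) * D.gen β n (OGen.tau r) := by
  simpa only [map_mul, mkO_ι] using (Rel.tau_comm (D := D) (β := β) r s h).mkO_eq

/-- The fraction in the braid relation is a polynomial for every Q, since its numerator vanishes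
when x_k = x_{k+2}. -/
theorem gen_braid_mem {r s : Fin n} (hr : (r : ℕ) ≠ 0) (hs : (s : ℕ) = r + 1) :
    D.gen β n (OGen.tau s) * D.gen β n (OGen.tau r) * D.gen β n (OGen.tau s) -
      D.gen β n (OGen.tau r) * D.gen β n (OGen.tau s) * D.gen β n (OGen.tau r) ∈
        (D.filtration β n).F 0 := by
  refine D.mem_filtration_of_mul_e fun ν => ?_
  by_cases hν : ν.1 (prevIdx r) = ν.1 s
  · obtain ⟨g, hg⟩ := dvd_subst₂_sub (D.Q (ν.1 (prevIdx r)) (ν.1 r))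
      (a := MvPolynomial.X r) (a' := MvPolynomial.X r)
      (b := MvPolynomial.X (prevIdx r)) (b' := MvPolynomial.X s)
      (c := MvPolynomial.X (prevIdx r) - MvPolynomial.X s) (by simp) dvd_rfl
    have h := (Rel.braid_eq r s hr hs ν hν g 1 (by rw [one_mul, hg, mul_comm])).mkO_eq
    simp only [map_mul, map_sub, mkO_ι, mkO_fpoly, map_one, one_mul] at h
    rw [h]
    exact D.evalO_mul_e_mem _ ν
  · have h := (Rel.braid_ne r s hr hs ν hν).mkO_eq
    simp only [map_mul, map_sub, mkO_ι, map_zero] at h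
    rw [h]
    exact Submodule.zero_mem _

variable {D} in
theorem PerfectAlong.hermitianAt_of_zero_one (hP : D.PerfectAlong β n) {r s : Fin n}
    (hr : (r : ℕ) = 0) (hs : (s : ℕ) = 1) (ν : D.IsoComp β n) :
    D.HermitianAt (ν.1 r) (ν.1 s) := by
  have h := hP.1 ν s (by omega)
  rwa [prevIdx_eq (show (s : ℕ) = r + 1 by omega)] at h

/-- (V3) makes the fraction of the conjugate case a polynomial, and (M2) with (M4) that of two
different fixed colours. Then d = 1 is allowed, and the right-hand sides contain at most one τ. -/
theorem gen_braid_zero_mem (hP : D.PerfectAlong β n) (hM2 : D.MatThetaSymmetric) {r s : Fin n}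
    (hr : (r : ℕ) = 0) (hs : (s : ℕ) = 1) :
    (D.gen β n (OGen.tau s) * D.gen β n (OGen.tau r)) ^ 2 -
      (D.gen β n (OGen.tau r) * D.gen β n (OGen.tau s)) ^ 2 ∈ (D.filtration β n).F 1 := by
  have hrs : r ≠ s := fun h => by rw [h] at hr; omega
  refine D.mem_filtration_of_mul_e fun ν => ?_
  by_cases h₁ : ν.1 r ≠ ν.1 s ∧ ν.1 s = D.θ (ν.1 r)
  · have hd : (MvPolynomial.X r + MvPolynomial.X s : MvPolynomial (Fin n) k) ∣
        Polynomial.aeval (MvPolynomial.X s) (D.Q' (ν.1 s)) -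
          Polynomial.aeval (MvPolynomial.X r) (D.Q' (ν.1 r)) := by
      rw [(hP.2 ν r).aeval, ← h₁.2]
      exact dvd_aeval_sub _ ⟨1, by ring⟩
    obtain ⟨g, hg⟩ := hd
    have h := (Rel.braid_zero_conj r s hr hs ν h₁.1 h₁.2 g 1
      (by rw [one_mul, hg, mul_comm])).mkO_eq
    simp only [map_mul, map_sub, map_pow, mkO_ι, mkO_fpoly, map_one, one_mul] at h
    rw [h]
    exact D.evalO_mul_tau_mul_e_mem _ _ _
  by_cases h₂ : ν.1 r ≠ D.θ (ν.1 r) ∧ ν.1 s = D.θ (ν.1 s)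
  · obtain ⟨g, hg⟩ := dvd_subst₂_sub (D.Q (ν.1 r) (ν.1 s))
      (a := MvPolynomial.X s) (a' := -MvPolynomial.X s)
      (b := -MvPolynomial.X r) (b' := -MvPolynomial.X r)
      (c := (MvPolynomial.X s : MvPolynomial (Fin n) k)) ⟨2, by ring⟩ (by simp)
    have h := (Rel.braid_zero_fix r s hr hs ν h₂.1 h₂.2 g 1
      (by rw [one_mul, hg, mul_comm])).mkO_eq
    simp only [map_mul, map_sub, map_pow, mkO_ι, mkO_fpoly, map_one, one_mul] at h
    rw [h]
    exact D.evalO_mul_tau_mul_e_mem _ _ _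
  by_cases h₃ : D.θ (ν.1 r) = ν.1 r ∧ ν.1 r ≠ ν.1 s ∧ ν.1 s = D.θ (ν.1 s)
  -- For fixed colours (M2) and (M4) together give Q(u, v) = Q(-u, -v). So the numerator is
  -- divisible by x_2 as well as by x_1, and by the product because x_2 is prime and does not divide
  -- x_1.
  · have hsym : ∀ a b : MvPolynomial (Fin n) k, subst₂ (D.Q (ν.1 r) (ν.1 s)) a b =
        subst₂ (D.Q (ν.1 r) (ν.1 s)) (-a) (-b) := fun a b => by
      have e := hM2.aeval (ν.1 r) (ν.1 s) a b
      rw [h₃.1, ← h₃.2.2] at e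
      exact e.trans ((hP.hermitianAt_of_zero_one hr hs ν).aeval _ _).symm
    have hdr : (MvPolynomial.X r : MvPolynomial (Fin n) k) ∣
        subst₂ (D.Q (ν.1 r) (ν.1 s)) (MvPolynomial.X s) (-MvPolynomial.X r) -
          subst₂ (D.Q (ν.1 r) (ν.1 s)) (MvPolynomial.X s) (MvPolynomial.X r) :=
      dvd_subst₂_sub _ (by simp) ⟨-2, by ring⟩
    have hds : (MvPolynomial.X s : MvPolynomial (Fin n) k) ∣
        subst₂ (D.Q (ν.1 r) (ν.1 s)) (MvPolynomial.X s) (-MvPolynomial.X r) -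
          subst₂ (D.Q (ν.1 r) (ν.1 s)) (MvPolynomial.X s) (MvPolynomial.X r) := by
      rw [hsym (MvPolynomial.X s) (MvPolynomial.X r)]
      exact dvd_subst₂_sub _ ⟨2, by ring⟩ (by simp)
    obtain ⟨f, hf⟩ := hdr
    rw [hf] at hds
    rcases (MvPolynomial.X_prime (R := k) (i := s)).dvd_or_dvd hds with hds | hds
    · exact absurd (MvPolynomial.X_dvd_X.mp hds).symm (by simpa using hrs)
    obtain ⟨g, rfl⟩ := hds
    have h := (Rel.braid_zero_fix_fix r s hr hs ν h₃.1 h₃.2.1 h₃.2.2 g 1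
      (by rw [one_mul, hf]; ring)).mkO_eq
    simp only [map_mul, map_sub, map_add, map_pow, mkO_ι, mkO_fpoly, map_one, one_mul] at h
    rw [h]
    refine AlgFiltration.mul_mem_of_eq (add_zero 1) (AlgFiltration.mul_mem_of_eq (zero_add 1)
      (D.evalO_mem g) (Submodule.add_mem _ ?_ ?_)) (D.gen_e_mem ν 0)
    · exact AlgFiltration.mul_mem_of_eq (zero_add 1) (D.gen_x_mem r 0) (D.gen_tau_mem r)
    · exact (D.filtration β n).mono (Nat.zero_le 1) (D.filtration β n).one_mem
  · have h := (Rel.braid_zero_else r s hr hs ν h₁ h₂ h₃).mkO_eq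
    simp only [map_mul, map_sub, map_pow, mkO_ι, map_zero] at h
    rw [h]
    exact Submodule.zero_mem _

theorem gen_tau_mul_x_sub_mem {r : Fin n} (hr : (r : ℕ) ≠ 0) (l : Fin n) :
    D.gen β n (OGen.tau r) * D.gen β n (OGen.x l) -
      D.gen β n (OGen.x (Equiv.swap (prevIdx r) r l)) * D.gen β n (OGen.tau r) ∈
        (D.filtration β n).F 0 := by
  refine D.mem_filtration_of_mul_e fun ν => ?_
  by_cases h : (l = prevIdx r ∨ l = r) ∧ ν.1 (prevIdx r) = ν.1 r
  · obtain ⟨rfl | rfl, hν⟩ := h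
    · have h := (Rel.mixed_left r hr ν hν).mkO_eq
      simp only [map_mul, map_sub, map_neg, mkO_ι] at h
      rw [Equiv.swap_apply_left, h]
      exact Submodule.neg_mem _ (D.gen_e_mem ν 0)
    · have h := (Rel.mixed_right l hr ν hν).mkO_eq
      simp only [map_mul, map_sub, mkO_ι] at h
      rw [Equiv.swap_apply_right, h]
      exact D.gen_e_mem ν 0
  · have h := (Rel.mixed_else r hr l ν h).mkO_eq
    simp only [map_mul, map_sub, mkO_ι, map_zero] at h
    rw [h]
    exact Submodule.zero_mem _

theorem gen_tau_mul_x_add_mem {r : Fin n} (hr : (r : ℕ) = 0) :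
    D.gen β n (OGen.tau r) * D.gen β n (OGen.x r) +
      D.gen β n (OGen.x r) * D.gen β n (OGen.tau r) ∈ (D.filtration β n).F 0 := by
  refine D.mem_filtration_of_mul_e fun ν => ?_
  by_cases hν : ν.1 r = D.θ (ν.1 r)
  · have h := (Rel.mixed_zero_eq r hr ν hν).mkO_eq
    simp only [map_mul, map_add, map_neg, map_ofNat, mkO_ι] at h
    rw [h, neg_mul, two_mul]
    exact Submodule.neg_mem _ (Submodule.add_mem _ (D.gen_e_mem ν 0) (D.gen_e_mem ν 0))
  · have h := (Rel.mixed_zero_ne r hr ν hν).mkO_eq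
    simp only [map_mul, map_add, map_zero, mkO_ι] at h
    rw [h]
    exact Submodule.zero_mem _

end CoeffDatum

/-! ### The homomorphism from the semidirect product to the associated graded algebra -/

namespace CoeffDatum

variable {k J : Type*} [Field k] (D : CoeffDatum k J) {β : J →₀ ℕ} {n : ℕ}

/-- The two sides of a braid relation have degree at least 2 when r ≠ s. They commute exactly in
degree 2, and in degrees 3 and 4 they differ by elements of filtration degree at most 0 and 1. -/
theorem gen_alternatingWord_sub_mem (hP : D.PerfectAlong β n) (hM2 : D.MatThetaSymmetric)
    (r s : Fin n) :
    ((CoxeterSystem.alternatingWord r s (coxB n r s)).map fun t => D.gen β n (OGen.tau t)).prod -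
      ((CoxeterSystem.alternatingWord s r (coxB n r s)).map fun t => D.gen β n (OGen.tau t)).prod ∈
        (D.filtration β n).lt (coxB n r s) := by
  rw [coxB_apply]
  split_ifs with h1 h2 h3
  · subst h1
    rw [sub_self]
    exact Submodule.zero_mem _
  · have key : ∀ {r s : Fin n}, (r : ℕ) = 0 ∧ (s : ℕ) = 1 →
        ((CoxeterSystem.alternatingWord s r 4).map fun t => D.gen β n (OGen.tau t)).prod -
        ((CoxeterSystem.alternatingWord r s 4).map fun t => D.gen β n (OGen.tau t)).prod ∈
          (D.filtration β n).lt 4 := fun {r s} h => by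
      have h0 := D.gen_braid_zero_mem hP hM2 h.1 h.2
      -- By definition `lt 4` is `F 3`, which contains the difference, an element of `F 1`.
      refine (D.filtration β n).mono (show 1 ≤ 3 by omega) ?_
      convert h0 using 1
      simp [CoxeterSystem.alternatingWord, pow_two, mul_assoc]
    rcases h2 with h2 | h2
    · rw [← neg_sub]
      exact Submodule.neg_mem _ (key h2)
    · exact key h2
  · have key : ∀ {r s : Fin n}, (r : ℕ) ≠ 0 → (s : ℕ) = r + 1 →
        ((CoxeterSystem.alternatingWord r s 3).map fun t => D.gen β n (OGen.tau t)).prod -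
        ((CoxeterSystem.alternatingWord s r 3).map fun t => D.gen β n (OGen.tau t)).prod ∈
          (D.filtration β n).lt 3 := fun {r s} hr h => by
      have h0 := D.gen_braid_mem (β := β) hr h
      refine (D.filtration β n).mono (show 0 ≤ 2 by omega) ?_
      convert h0 using 1
      simp [CoxeterSystem.alternatingWord, mul_assoc]
    rcases h3 with h3 | h3
    · rw [← neg_sub]
      exact Submodule.neg_mem _ (key (by omega) h3.symm)
    · exact key (by omega) h3.symm
  · have h : D.gen β n (OGen.tau r) * D.gen β n (OGen.tau s) =
        D.gen β n (OGen.tau s) * D.gen β n (OGen.tau r) := by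
      rcases lt_or_gt_of_ne (fun h => h1 (Fin.ext h)) with h | h
      · exact D.gen_tau_comm (by omega)
      · exact (D.gen_tau_comm (by omega)).symm
    have h' : ((CoxeterSystem.alternatingWord r s 2).map fun t => D.gen β n (OGen.tau t)).prod =
        ((CoxeterSystem.alternatingWord s r 2).map fun t => D.gen β n (OGen.tau t)).prod := by
      simpa [CoxeterSystem.alternatingWord] using h
    rw [h', sub_self]
    exact Submodule.zero_mem _

variable (β n) in
/-- The symbols of the generators. -/
noncomputable abbrev sym (s : OGen (D.IsoComp β n) n) :
    (degFiltration k (D.gen β n) OGen.deg).Gr := symGen k (D.gen β n) OGen.deg s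

theorem sym_mul_sym (s t : OGen (D.IsoComp β n) n) :
    D.sym β n s * D.sym β n t = ([s, t].map (D.sym β n)).prod := by simp

/-- Every correction term in the relations of the orientifold KLR algebra has smaller degree than
the products being compared, so it disappears from the symbols. -/
theorem sym_rel (hP : D.PerfectAlong β n) (hM2 : D.MatThetaSymmetric) {a b : D.Free β n}
    (h : NilRel D β n a b) :
    FreeAlgebra.lift k (D.sym β n) a = FreeAlgebra.lift k (D.sym β n) b := by
  cases h <;>
    try simp only [map_mul, map_neg, map_sum, map_one, map_zero, FreeAlgebra.lift_ι_apply]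
  case e_mul_self ν =>
    rw [sym, symGen, AlgFiltration.symbol_mul]
    refine AlgFiltration.symbol_congr _ rfl ?_ _ _
    simpa only [map_mul, mkO_ι] using (Rel.e_mul_self ν).mkO_eq
  case e_mul_ne ν μ h =>
    rw [sym, sym, symGen, symGen, AlgFiltration.symbol_mul, AlgFiltration.symbol_eq_zero_iff]
    have h0 : D.gen β n (OGen.e ν) * D.gen β n (OGen.e μ) = 0 := by
      simpa only [map_mul, mkO_ι, map_zero] using (Rel.e_mul_ne ν μ h).mkO_eq
    rw [h0]
    exact Submodule.zero_mem _
  case e_sum =>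
    refine Eq.trans (AlgFiltration.symbol_sum _ Finset.univ (d := 0)
      (fun ν => D.gen_e_mem ν 0)).symm ?_
    rw [← AlgFiltration.symbol_one]
    exact AlgFiltration.symbol_congr _ rfl D.sum_gen_e _ _
  case x_e l ν =>
    rw [sym_mul_sym, sym_mul_sym]
    refine prod_map_symGen_eq _ _ rfl ?_
    have h0 : D.gen β n (OGen.x l) * D.gen β n (OGen.e ν) =
        D.gen β n (OGen.e ν) * D.gen β n (OGen.x l) := by
      simpa only [map_mul, mkO_ι] using (Rel.x_e l ν).mkO_eq
    simp [h0]
  case x_x l l' =>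
    rw [sym_mul_sym, sym_mul_sym]
    refine prod_map_symGen_eq _ _ rfl ?_
    have h0 : D.gen β n (OGen.x l) * D.gen β n (OGen.x l') =
        D.gen β n (OGen.x l') * D.gen β n (OGen.x l) := by
      simpa only [map_mul, mkO_ι] using (Rel.x_x (D := D) (β := β) l l').mkO_eq
    simp [h0]
  case sq r =>
    rw [sym, symGen, AlgFiltration.symbol_mul, AlgFiltration.symbol_eq_zero_iff]
    exact (D.filtration β n).mono (Nat.zero_le 1) (D.gen_tau_sq_mem r)
  case braid r s =>
    have key : ∀ ω : List (Fin n), FreeAlgebra.lift k (D.sym β n) (ω.map (D.ft β)).prod =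
        ((ω.map OGen.tau).map (D.sym β n)).prod := fun ω => by
      rw [map_list_prod, List.map_map, List.map_map]
      congr 2
      funext t
      simp only [Function.comp_apply, FreeAlgebra.lift_ι_apply]
    have hdeg : ∀ ω : List (Fin n),
        ((ω.map (OGen.tau (C := D.IsoComp β n))).map OGen.deg).sum = ω.length := fun ω => by
      induction ω with
      | nil => rfl
      | cons t ω ih =>
        rw [List.map_cons, List.map_cons, List.sum_cons, ih, List.length_cons, add_comm]
        rfl
    rw [key, key]
    refine prod_map_symGen_eq _ _ (by simp only [hdeg, CoxeterSystem.length_alternatingWord]) ?_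
    rw [hdeg, CoxeterSystem.length_alternatingWord, List.map_map, List.map_map]
    exact D.gen_alternatingWord_sub_mem hP hM2 r s
  case tau_e r ν =>
    rw [sym_mul_sym, sym_mul_sym]
    refine prod_map_symGen_eq _ _ rfl ?_
    simp [D.gen_tau_mul_e]
  case tau_x r hr l =>
    rw [sym_mul_sym, sym_mul_sym]
    refine prod_map_symGen_eq _ _ rfl ?_
    have := D.gen_tau_mul_x_sub_mem (β := β) hr l
    simp only [List.map_cons, List.map_nil, List.prod_cons, List.prod_nil, mul_one]
    exact this
  case tau_zero_x r hr =>
    rw [neg_mul, eq_neg_iff_add_eq_zero]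
    have h1 : D.sym β n (OGen.tau r) * D.sym β n (OGen.x r) +
        D.sym β n (OGen.x r) * D.sym β n (OGen.tau r) =
        (degFiltration k (D.gen β n) OGen.deg).symbol 1
          (D.gen β n (OGen.tau r) * D.gen β n (OGen.x r) +
            D.gen β n (OGen.x r) * D.gen β n (OGen.tau r))
          ((D.filtration β n).mono (Nat.zero_le 1) (D.gen_tau_mul_x_add_mem hr)) := by
      rw [sym, sym, symGen, symGen, AlgFiltration.symbol_mul, AlgFiltration.symbol_mul]
      exact (map_add (AlgFiltration.symbolₗ _ 1) _ _).symm
    rw [h1]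
    exact (AlgFiltration.symbol_eq_zero_iff _ _).mpr (D.gen_tau_mul_x_add_mem hr)
  case tau_zero_x_ne r hr l hl =>
    rw [sym_mul_sym, sym_mul_sym]
    refine prod_map_symGen_eq _ _ rfl ?_
    have h0 : D.gen β n (OGen.tau r) * D.gen β n (OGen.x l) =
        D.gen β n (OGen.x l) * D.gen β n (OGen.tau r) := by
      simpa only [map_mul, mkO_ι] using (Rel.mixed_zero_comm (D := D) (β := β) r hr l hl).mkO_eq
    simp [h0]

/-- The homomorphism from the semidirect product to the associated graded algebra. -/
theorem exists_nilSmash_algHom_gr (hP : D.PerfectAlong β n) (hM2 : D.MatThetaSymmetric) :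
    ∃ Ψ : D.NilSmash β n →ₐ[k] (degFiltration k (D.gen β n) OGen.deg).Gr,
      ∀ s, Ψ (D.nilGen β n s) = D.sym β n s := by
  refine ⟨RingQuot.liftAlgHom k ⟨FreeAlgebra.lift k (D.sym β n),
    fun _ _ h => D.sym_rel hP hM2 h⟩, fun s => ?_⟩
  rw [nilGen]
  erw [RingQuot.liftAlgHom_mkAlgHom_apply]
  rw [FreeAlgebra.lift_ι_apply]

end CoeffDatum

/-! ### Spanning of the semidirect product -/

namespace CoeffDatum

variable {k J : Type*} [Field k] (D : CoeffDatum k J) {β : J →₀ ℕ} {n : ℕ}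

variable (β n) in
/-- The projection of the free algebra to the semidirect product. -/
noncomputable def mkN : D.Free β n →ₐ[k] D.NilSmash β n := RingQuot.mkAlgHom k (NilRel D β n)

theorem mkN_ι (s : OGen (D.IsoComp β n) n) : D.mkN β n (FreeAlgebra.ι k s) = D.nilGen β n s := rfl

variable {D} in
theorem NilRel.mkN_eq {a b : D.Free β n} (h : NilRel D β n a b) : D.mkN β n a = D.mkN β n b :=
  RingQuot.mkAlgHom_rel k h

theorem exists_evalN : ∃ f : MvPolynomial (Fin n) k →ₐ[k] D.NilSmash β n,
    (∀ p, f p = ordEval (fun l => D.nilGen β n (OGen.x l)) p) ∧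
      ∀ l, f (MvPolynomial.X l) = D.nilGen β n (OGen.x l) := by
  refine exists_algHom_of_commute _ fun l l' => ?_
  simpa only [map_mul, mkN_ι] using (NilRel.x_x (D := D) (β := β) l l').mkN_eq

variable (β n) in
/-- Evaluation of polynomials at `x_1, …, x_n` in the semidirect product. -/
noncomputable def evalN : MvPolynomial (Fin n) k →ₐ[k] D.NilSmash β n := D.exists_evalN.choose

theorem evalN_X (l : Fin n) : D.evalN β n (MvPolynomial.X l) = D.nilGen β n (OGen.x l) :=
  D.exists_evalN.choose_spec.2 l

theorem evalN_eq_ordEval (p : MvPolynomial (Fin n) k) :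
    D.evalN β n p = ordEval (fun l => D.nilGen β n (OGen.x l)) p :=
  D.exists_evalN.choose_spec.1 p

theorem nilGen_e_mul_evalN (ν : D.IsoComp β n) (p : MvPolynomial (Fin n) k) :
    D.nilGen β n (OGen.e ν) * D.evalN β n p = D.evalN β n p * D.nilGen β n (OGen.e ν) := by
  induction p using MvPolynomial.induction_on with
  | C c =>
    rw [← MvPolynomial.algebraMap_eq, AlgHom.commutes]
    exact (Algebra.commutes c _).symm
  | add p q hp hq => rw [map_add, mul_add, add_mul, hp, hq]
  | mul_X p l hp =>
    have h : D.nilGen β n (OGen.x l) * D.nilGen β n (OGen.e ν) =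
        D.nilGen β n (OGen.e ν) * D.nilGen β n (OGen.x l) := by
      simpa only [map_mul, mkN_ι] using (NilRel.x_e l ν).mkN_eq
    rw [map_mul, evalN_X, ← mul_assoc, hp, mul_assoc, mul_assoc, h]

variable (β) in
/-- The product of the generators `T_r` along a word. -/
noncomputable def nilWord (ω : List (Fin n)) : D.NilSmash β n :=
  (ω.map fun r => D.nilGen β n (OGen.tau r)).prod

theorem nilWord_cons (r : Fin n) (ω : List (Fin n)) :
    D.nilWord β (r :: ω) = D.nilGen β n (OGen.tau r) * D.nilWord β ω := by
  simp [nilWord]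

theorem nilGen_e_mul_tau (r : Fin n) (ν : D.IsoComp β n) :
    D.nilGen β n (OGen.e ν) * D.nilGen β n (OGen.tau r) =
      D.nilGen β n (OGen.tau r) * D.nilGen β n (OGen.e (D.refl r ν)) := by
  have h := (NilRel.tau_e r (D.refl r ν)).mkN_eq
  simp only [map_mul, mkN_ι, refl_refl] at h
  exact h.symm

theorem exists_nilGen_e_mul_nilWord (ω : List (Fin n)) (ν : D.IsoComp β n) :
    ∃ μ, D.nilGen β n (OGen.e ν) * D.nilWord β ω =
      D.nilWord β ω * D.nilGen β n (OGen.e μ) := by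
  induction ω generalizing ν with
  | nil => exact ⟨ν, by simp [nilWord]⟩
  | cons r ω ih =>
    obtain ⟨μ, hμ⟩ := ih (D.refl r ν)
    exact ⟨μ, by rw [nilWord_cons, ← mul_assoc, nilGen_e_mul_tau, mul_assoc, hμ, mul_assoc]⟩

/-- That `p` is a variable up to sign is recorded because the induction along a word moves single
variables. -/
theorem exists_nilGen_x_mul_tau (r l : Fin n) :
    ∃ p, D.nilGen β n (OGen.x l) * D.nilGen β n (OGen.tau r) =
      D.nilGen β n (OGen.tau r) * D.evalN β n p ∧ (p = MvPolynomial.X l ∨ p = -MvPolynomial.X l ∨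
        p = MvPolynomial.X (Equiv.swap (prevIdx r) r l)) := by
  by_cases hr : (r : ℕ) = 0
  · by_cases hl : l = r
    · subst hl
      refine ⟨-MvPolynomial.X l, ?_, by simp⟩
      have h := (NilRel.tau_zero_x (D := D) (β := β) l hr).mkN_eq
      simp only [map_mul, map_neg, mkN_ι, neg_mul] at h
      rw [map_neg, evalN_X, mul_neg, h, neg_neg]
    · refine ⟨MvPolynomial.X l, ?_, by simp⟩
      have h := (NilRel.tau_zero_x_ne (D := D) (β := β) r hr l hl).mkN_eq
      simp only [map_mul, mkN_ι] at h
      rw [evalN_X, h]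
  · refine ⟨MvPolynomial.X (Equiv.swap (prevIdx r) r l), ?_, by simp⟩
    have h := (NilRel.tau_x (D := D) (β := β) r hr (Equiv.swap (prevIdx r) r l)).mkN_eq
    simp only [map_mul, mkN_ι, Equiv.swap_apply_self] at h
    rw [evalN_X, h]

theorem exists_nilGen_x_mul_nilWord (ω : List (Fin n)) (l : Fin n) :
    ∃ p, D.nilGen β n (OGen.x l) * D.nilWord β ω = D.nilWord β ω * D.evalN β n p := by
  induction ω generalizing l with
  | nil => exact ⟨MvPolynomial.X l, by simp [nilWord, evalN_X]⟩
  | cons r ω ih =>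
    obtain ⟨p, hp, h⟩ := D.exists_nilGen_x_mul_tau (β := β) r l
    have hq : ∃ q, D.evalN β n p * D.nilWord β ω = D.nilWord β ω * D.evalN β n q := by
      rcases h with rfl | rfl | rfl
      · obtain ⟨q, hq⟩ := ih l
        exact ⟨q, by rw [evalN_X, hq]⟩
      · obtain ⟨q, hq⟩ := ih l
        exact ⟨-q, by rw [map_neg, evalN_X, neg_mul, hq, map_neg, mul_neg]⟩
      · obtain ⟨q, hq⟩ := ih (Equiv.swap (prevIdx r) r l)
        exact ⟨q, by rw [evalN_X, hq]⟩
    obtain ⟨q, hq⟩ := hq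
    exact ⟨q, by rw [nilWord_cons, ← mul_assoc, hp, mul_assoc, hq, mul_assoc]⟩

theorem nilWord_braid (r s : Fin n) :
    ((CoxeterSystem.alternatingWord r s (coxB n r s)).map
        fun r => D.nilGen β n (OGen.tau r)).prod =
      ((CoxeterSystem.alternatingWord s r (coxB n r s)).map
        fun r => D.nilGen β n (OGen.tau r)).prod := by
  have h := (NilRel.braid (D := D) (β := β) r s).mkN_eq
  rw [map_list_prod, map_list_prod, List.map_map, List.map_map] at h
  exact h

theorem nilGen_tau_sq (r : Fin n) : D.nilGen β n (OGen.tau r) * D.nilGen β n (OGen.tau r) = 0 := by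
  simpa only [map_mul, mkN_ι, map_zero] using (NilRel.sq (D := D) (β := β) r).mkN_eq

theorem nilWord_eq_of_isReduced {ω ω' : List (Fin n)} (hω : (weylSystem n).IsReduced ω)
    (hω' : (weylSystem n).IsReduced ω')
    (h : (weylSystem n).wordProd ω = (weylSystem n).wordProd ω') :
    D.nilWord β ω = D.nilWord β ω' :=
  (weylSystem n).prod_map_eq_of_isReduced _ (weylSystem_hasExactOrders n) D.nilWord_braid hω hω' h

theorem nilWord_eq_zero {ω : List (Fin n)} (hω : ¬ (weylSystem n).IsReduced ω) :
    D.nilWord β ω = 0 :=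
  (weylSystem n).prod_map_eq_zero_of_not_isReduced _ (weylSystem_hasExactOrders n)
    D.nilWord_braid D.nilGen_tau_sq hω

variable (β) in
/-- The analogue `T_w x_1^{a_1} ⋯ x_n^{a_n} e(ν)` of `pbwElement` in the semidirect product. -/
noncomputable def nilPBW (red : WeylB n → List (Fin n))
    (t : WeylB n × (Fin n → ℕ) × D.IsoComp β n) : D.NilSmash β n :=
  D.nilWord β (red t.1) * ordMonomial (fun l => D.nilGen β n (OGen.x l)) t.2.1 *
    D.nilGen β n (OGen.e t.2.2)

variable (β) in
/-- The span of the elements `T_w x^a e(ν)` with `w` of length `d`. -/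
noncomputable def nilSpan (red : WeylB n → List (Fin n)) (d : ℕ) : Submodule k (D.NilSmash β n) :=
  Submodule.span k (D.nilPBW β red '' {t | (red t.1).length = d})

variable {red : WeylB n → List (Fin n)}

/-- A reduced word may be replaced by the chosen one, by Matsumoto's theorem; a word that is not
reduced gives 0 because of T_r² = 0. -/
theorem nilWord_mul_mem (hred : IsReducedChoice red) (ω : List (Fin n))
    (p : MvPolynomial (Fin n) k) (ν : D.IsoComp β n) :
    D.nilWord β ω * D.evalN β n p * D.nilGen β n (OGen.e ν) ∈ D.nilSpan β red ω.length := by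
  by_cases hω : (weylSystem n).IsReduced ω
  · have hw := hred ((weylSystem n).wordProd ω)
    rw [D.nilWord_eq_of_isReduced hω hw.1 hw.2.symm, evalN_eq_ordEval, ordEval, Finset.mul_sum,
      Finset.sum_mul]
    refine Submodule.sum_mem _ fun a _ => ?_
    rw [mul_smul_comm, smul_mul_assoc]
    refine Submodule.smul_mem _ _ (Submodule.subset_span ⟨(_, a, ν), ?_, rfl⟩)
    have := hw.1.eq
    rw [hw.2, hω.eq] at this
    exact this.symm
  · rw [D.nilWord_eq_zero hω, zero_mul, zero_mul]
    exact Submodule.zero_mem _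

theorem ordMonomial_eq_evalN (a : Fin n → ℕ) :
    ordMonomial (fun l => D.nilGen β n (OGen.x l)) a =
      D.evalN β n (ordMonomial MvPolynomial.X a) := by
  rw [map_ordMonomial]
  simp only [evalN_X]

/-- Generators e(ν) and x_l pass to the right of T_w and are absorbed there, while T_r lengthens the
word by one letter. The span of all T_w x^a e(ν) is therefore a left ideal, and it contains 1. -/
theorem nilGen_mul_mem (hred : IsReducedChoice red) (s : OGen (D.IsoComp β n) n) {d : ℕ}
    {y : D.NilSmash β n} (hy : y ∈ D.nilSpan β red d) :
    D.nilGen β n s * y ∈ D.nilSpan β red (s.deg + d) := by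
  induction hy using Submodule.span_induction with
  | zero => rw [mul_zero]; exact Submodule.zero_mem _
  | add x y _ _ hx hy => rw [mul_add]; exact Submodule.add_mem _ hx hy
  | smul c x _ hx => rw [mul_smul_comm]; exact Submodule.smul_mem _ c hx
  | mem y hy =>
    obtain ⟨⟨w, a, ν⟩, rfl, rfl⟩ := hy
    rw [nilPBW, ordMonomial_eq_evalN]
    dsimp only
    cases s with
    | e μ =>
      obtain ⟨μ', h⟩ := D.exists_nilGen_e_mul_nilWord (red w) μ
      rw [← mul_assoc, ← mul_assoc, h, mul_assoc (D.nilWord β (red w)), nilGen_e_mul_evalN,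
        ← mul_assoc, mul_assoc _ (D.nilGen β n _)]
      rw [show (OGen.e μ : OGen (D.IsoComp β n) n).deg = 0 from rfl, zero_add]
      by_cases hμ : μ' = ν
      · subst hμ
        have h : D.nilGen β n (OGen.e μ') * D.nilGen β n (OGen.e μ') =
            D.nilGen β n (OGen.e μ') := by
          simpa only [map_mul, mkN_ι] using (NilRel.e_mul_self μ').mkN_eq
        rw [h]
        exact D.nilWord_mul_mem hred _ _ _
      · have h : D.nilGen β n (OGen.e μ') * D.nilGen β n (OGen.e ν) = 0 := by
          simpa only [map_mul, mkN_ι, map_zero] using (NilRel.e_mul_ne μ' ν hμ).mkN_eq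
        rw [h, mul_zero]
        exact Submodule.zero_mem _
    | x l =>
      obtain ⟨p, h⟩ := D.exists_nilGen_x_mul_nilWord (β := β) (red w) l
      rw [← mul_assoc, ← mul_assoc, h, mul_assoc (D.nilWord β (red w)), ← map_mul,
        show (OGen.x l : OGen (D.IsoComp β n) n).deg = 0 from rfl, zero_add]
      exact D.nilWord_mul_mem hred _ _ _
    | tau r =>
      rw [← mul_assoc, ← mul_assoc, ← nilWord_cons, add_comm]
      exact D.nilWord_mul_mem hred (r :: red w) _ _

theorem red_one (hred : IsReducedChoice red) : red 1 = [] := by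
  have h := (hred 1).1.eq
  rw [(hred 1).2, CoxeterSystem.length_one] at h
  exact List.length_eq_zero_iff.mp h.symm

theorem sum_nilGen_e : ∑ ν, D.nilGen β n (OGen.e ν) = 1 := by
  simpa only [map_sum, map_one, mkN_ι] using (NilRel.e_sum (D := D) (β := β) (n := n)).mkN_eq

theorem prod_nilGen_mem (hred : IsReducedChoice red) (L : List (OGen (D.IsoComp β n) n)) :
    (L.map (D.nilGen β n)).prod ∈ D.nilSpan β red (L.map OGen.deg).sum := by
  induction L with
  | nil =>
    rw [List.map_nil, List.map_nil, List.prod_nil, ← D.sum_nilGen_e]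
    refine Submodule.sum_mem _ fun ν _ => ?_
    have h := D.nilWord_mul_mem hred [] 1 ν
    rwa [map_one, mul_one, nilWord, List.map_nil, List.prod_nil, one_mul] at h
  | cons s L ih =>
    rw [List.map_cons, List.map_cons, List.prod_cons, List.sum_cons]
    exact D.nilGen_mul_mem hred s ih

/-- In a quotient of the free algebra, products of generators span. -/
theorem span_prod_eq_top {A G : Type*} [Ring A] [Algebra k A] (π : FreeAlgebra k G →ₐ[k] A)
    (hπ : Function.Surjective π) :
    Submodule.span k (Set.range fun L : List G => (L.map fun s => π (FreeAlgebra.ι k s)).prod) =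
      ⊤ := by
  rw [eq_top_iff]
  rintro x -
  obtain ⟨a, rfl⟩ := hπ x
  induction a using FreeAlgebra.induction with
  | grade0 c =>
    rw [AlgHom.commutes, Algebra.algebraMap_eq_smul_one]
    exact Submodule.smul_mem _ c (Submodule.subset_span ⟨[], by simp⟩)
  | grade1 s => exact Submodule.subset_span ⟨[s], by simp⟩
  | mul a b ha hb =>
    rw [map_mul]
    have h := Submodule.mul_mem_mul ha hb
    rw [Submodule.span_mul_span] at h
    refine Submodule.span_mono ?_ h
    rintro _ ⟨_, ⟨l, rfl⟩, _, ⟨l', rfl⟩, rfl⟩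
    exact ⟨l ++ l', by simp⟩
  | add a b ha hb => rw [map_add]; exact Submodule.add_mem _ ha hb

theorem span_nilPBW (hred : IsReducedChoice red) :
    Submodule.span k (Set.range (D.nilPBW β red)) = ⊤ := by
  rw [eq_top_iff, ← span_prod_eq_top (D.mkN β n) (RingQuot.mkAlgHom_surjective k _)]
  refine Submodule.span_le.mpr ?_
  rintro _ ⟨L, rfl⟩
  exact Submodule.span_mono (Set.image_subset_range _ _) (D.prod_nilGen_mem hred L)

end CoeffDatum

/-! ### The PBW basis and the PBW property from perfectness -/

namespace AlgFiltration

variable {k A : Type*} [CommRing k] [Ring A] [Algebra k A] (𝓕 : AlgFiltration k A)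

/-- The symbols of a basis adapted to the filtration are linearly independent. -/
theorem linearIndependent_symbol {ι : Type*} {v : ι → A} (hv : LinearIndependent k v)
    (deg : ι → ℕ) (hdeg : ∀ i, v i ∈ 𝓕.F (deg i))
    (hspan : ∀ d, 𝓕.F d ≤ Submodule.span k (v '' {i | deg i ≤ d})) :
    LinearIndependent k fun i => 𝓕.symbol (deg i) (v i) (hdeg i) := by
  classical
  rw [linearIndependent_iff']
  intro s g hg i₀ hi₀
  set d := deg i₀ with hd
  have hmem : ∀ i ∈ s.filter (deg · = d), g i • v i ∈ 𝓕.F d := fun i hi =>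
    Submodule.smul_mem _ _ ((Finset.mem_filter.mp hi).2 ▸ hdeg i)
  have hmem' : ∑ i ∈ s.filter (deg · = d), g i • v i ∈ 𝓕.F d := Submodule.sum_mem _ hmem
  have h1 : ∑ i ∈ s.filter (deg · = d), g i • 𝓕.symbol (deg i) (v i) (hdeg i) =
      𝓕.symbol d (∑ i ∈ s.filter (deg · = d), g i • v i) hmem' := by
    have h2 : (⟨_, hmem'⟩ : 𝓕.F d) =
        ∑ i ∈ (s.filter (deg · = d)).attach, ⟨g i • v i, hmem i i.2⟩ := by
      refine Subtype.ext ?_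
      simp only [AddSubmonoidClass.coe_finsetSum]
      rw [Finset.sum_attach _ (fun i => g i • v i)]
    rw [symbol_eq_symbolₗ, h2, map_sum, ← Finset.sum_attach]
    refine Finset.sum_congr rfl fun i _ => ?_
    have hi : deg i = d := (Finset.mem_filter.mp i.2).2
    have hi' : v i ∈ 𝓕.F d := 𝓕.mono hi.le (hdeg i)
    rw [𝓕.symbol_congr hi rfl (hdeg i) hi', symbol_eq_symbolₗ, ← map_smul]
    rfl
  -- The component of degree `d` of the given relation says that this partial sum of the `v i` has
  -- symbol zero.
  have h3 : 𝓕.symbol d (∑ i ∈ s.filter (deg · = d), g i • v i) hmem' = 0 := by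
    have h4 := congrArg (DirectSum.component k ℕ 𝓕.Piece d) hg
    rw [← Finset.sum_filter_add_sum_filter_not s (deg · = d), h1, map_add, map_zero] at h4
    have h5 : DirectSum.component k ℕ 𝓕.Piece d
        (∑ i ∈ s.filter (¬ deg · = d), g i • 𝓕.symbol (deg i) (v i) (hdeg i)) = 0 := by
      rw [map_sum]
      refine Finset.sum_eq_zero fun i hi => ?_
      rw [map_smul]
      have h6 : DirectSum.component k ℕ 𝓕.Piece d (𝓕.symbol (deg i) (v i) (hdeg i)) = 0 :=
        DirectSum.of_eq_of_ne _ _ _ (fun h => (Finset.mem_filter.mp hi).2 h.symm)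
      rw [h6, smul_zero]
    rw [h5, add_zero] at h4
    have h7 : 𝓕.cls (∑ i ∈ s.filter (deg · = d), g i • v i) hmem' = 0 := by
      rw [← h4]
      exact (DirectSum.component.lof_self k (M := 𝓕.Piece) d _).symm
    rw [symbol, h7, map_zero]
  rw [symbol_eq_zero_iff] at h3
  -- A vanishing symbol places the sum in smaller filtration degree, hence by `hspan` in the span of
  -- the `v i` of smaller degree. This span meets that of the `v i` of degree `d` only in 0.
  have h4 : ∑ i ∈ s.filter (deg · = d), g i • v i ∈
      Submodule.span k (v '' {i | deg i < d}) := by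
    cases hd' : d with
    | zero =>
      rw [hd'] at h3
      have h5 : ∑ i ∈ s.filter (deg · = 0), g i • v i = 0 := h3
      rw [h5]
      exact Submodule.zero_mem _
    | succ e =>
      rw [hd'] at h3
      refine Submodule.span_mono (Set.image_mono ?_) (hspan e h3)
      intro i hi
      exact Nat.lt_succ_of_le hi
  have h5 : ∑ i ∈ s.filter (deg · = d), g i • v i ∈
      Submodule.span k (v '' {i | deg i = d}) :=
    Submodule.sum_mem _ fun i hi => Submodule.smul_mem _ _
      (Submodule.subset_span ⟨i, (Finset.mem_filter.mp hi).2, rfl⟩)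
  have h6 : Disjoint {i | deg i < d} {i | deg i = d} :=
    Set.disjoint_left.mpr fun i hi hi' => hi.ne hi'
  have h7 := Submodule.disjoint_def.mp (hv.disjoint_span_image h6) _ h4 h5
  exact linearIndependent_iff'.mp hv _ _ h7 i₀ (Finset.mem_filter.mpr ⟨hi₀, rfl⟩)

end AlgFiltration

namespace CoeffDatum

variable {k J : Type*} [Field k] (D : CoeffDatum k J) {β : J →₀ ℕ} {n : ℕ}
  {red : WeylB n → List (Fin n)}

/-- The list of generators whose product is `τ_w x^a e(ν)`. -/
def pbwList {C : Type*} (red : WeylB n → List (Fin n)) (t : WeylB n × (Fin n → ℕ) × C) :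
    List (OGen C n) :=
  (red t.1).map OGen.tau ++
    ((List.ofFn fun l => List.replicate (t.2.1 l) (OGen.x l)).flatten ++ [OGen.e t.2.2])

theorem prod_map_pbwList {C A : Type*} [Monoid A] (g : OGen C n → A)
    (t : WeylB n × (Fin n → ℕ) × C) :
    ((pbwList red t).map g).prod = ((red t.1).map fun r => g (OGen.tau r)).prod *
      ordMonomial (fun l => g (OGen.x l)) t.2.1 * g (OGen.e t.2.2) := by
  rw [pbwList, List.map_append, List.map_append, List.prod_append, List.prod_append, List.map_map,
    List.map_flatten, List.prod_flatten, List.map_ofFn, List.map_ofFn, ← mul_assoc]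
  simp only [Function.comp_def, List.map_replicate, List.prod_replicate, List.map_cons,
    List.map_nil, List.prod_cons, List.prod_nil, mul_one]
  rfl

theorem sum_deg_pbwList {C : Type*} (t : WeylB n × (Fin n → ℕ) × C) :
    ((pbwList red t).map OGen.deg).sum = (red t.1).length := by
  rw [pbwList, List.map_append, List.map_append, List.sum_append, List.sum_append, List.map_map,
    List.map_flatten, List.sum_flatten, List.map_ofFn, List.map_ofFn]
  simp [Function.comp_def, OGen.deg]

theorem pbwElement_eq_prod (t : WeylB n × (Fin n → ℕ) × D.IsoComp β n) :
    D.pbwElement β red t = ((pbwList red t).map (D.gen β n)).prod :=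
  (prod_map_pbwList _ t).symm

theorem nilPBW_eq_prod (t : WeylB n × (Fin n → ℕ) × D.IsoComp β n) :
    D.nilPBW β red t = ((pbwList red t).map (D.nilGen β n)).prod :=
  (prod_map_pbwList _ t).symm

theorem pbwElement_mem (t : WeylB n × (Fin n → ℕ) × D.IsoComp β n) :
    D.pbwElement β red t ∈ (degFiltration k (D.gen β n) OGen.deg).F (red t.1).length :=
  Submodule.subset_span ⟨pbwList red t, (sum_deg_pbwList t).le, (D.pbwElement_eq_prod t).symm⟩

section

variable {Ψ : D.NilSmash β n →ₐ[k] (degFiltration k (D.gen β n) OGen.deg).Gr}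

theorem map_prod_nilGen (hΨ : ∀ s, Ψ (D.nilGen β n s) = D.sym β n s)
    (L : List (OGen (D.IsoComp β n) n)) :
    Ψ (L.map (D.nilGen β n)).prod =
      (degFiltration k (D.gen β n) OGen.deg).symbol (L.map OGen.deg).sum (L.map (D.gen β n)).prod
        (list_prod_mem_degFiltration _ _ L) := by
  rw [← prod_map_symGen, map_list_prod, List.map_map]
  congr 2
  funext s
  exact hΨ s

theorem map_nilPBW (hΨ : ∀ s, Ψ (D.nilGen β n s) = D.sym β n s)
    (t : WeylB n × (Fin n → ℕ) × D.IsoComp β n) :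
    Ψ (D.nilPBW β red t) = (degFiltration k (D.gen β n) OGen.deg).symbol (red t.1).length
      (D.pbwElement β red t) (D.pbwElement_mem t) := by
  rw [nilPBW_eq_prod, D.map_prod_nilGen hΨ]
  exact AlgFiltration.symbol_congr _ (sum_deg_pbwList t) (D.pbwElement_eq_prod t).symm _ _

theorem exists_symbol_of_mem_nilSpan (hΨ : ∀ s, Ψ (D.nilGen β n s) = D.sym β n s) {d : ℕ}
    {y : D.NilSmash β n} (hy : y ∈ D.nilSpan β red d) :
    ∃ b ∈ Submodule.span k (D.pbwElement β red '' {t | (red t.1).length = d}),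
      ∃ hb : b ∈ (degFiltration k (D.gen β n) OGen.deg).F d,
        Ψ y = (degFiltration k (D.gen β n) OGen.deg).symbol d b hb := by
  induction hy using Submodule.span_induction with
  | zero =>
    refine ⟨0, Submodule.zero_mem _, Submodule.zero_mem _, ?_⟩
    rw [map_zero]
    exact (map_zero (AlgFiltration.symbolₗ _ d)).symm
  | add x y _ _ hx hy =>
    obtain ⟨b, h, hb, e⟩ := hx
    obtain ⟨b', h', hb', e'⟩ := hy
    refine ⟨b + b', Submodule.add_mem _ h h', Submodule.add_mem _ hb hb', ?_⟩
    rw [map_add, e, e']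
    exact (map_add (AlgFiltration.symbolₗ _ d) ⟨b, hb⟩ ⟨b', hb'⟩).symm
  | smul c x _ hx =>
    obtain ⟨b, h, hb, e⟩ := hx
    refine ⟨c • b, Submodule.smul_mem _ c h, Submodule.smul_mem _ c hb, ?_⟩
    rw [map_smul, e]
    exact (map_smul (AlgFiltration.symbolₗ _ d) c ⟨b, hb⟩).symm
  | mem y hy =>
    obtain ⟨t, rfl, rfl⟩ := hy
    exact ⟨_, Submodule.subset_span ⟨t, rfl, rfl⟩, D.pbwElement_mem t, D.map_nilPBW hΨ t⟩

/-- No rewriting in the algebra itself is needed. The symbol of a product of degree `d` is the image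
under Ψ of a combination of T_w x^a e(ν); subtracting the same combination of PBW elements leaves
something of smaller degree, to which induction applies. -/
theorem filtration_le_span (hred : IsReducedChoice red)
    (hΨ : ∀ s, Ψ (D.nilGen β n s) = D.sym β n s) (d : ℕ) :
    (degFiltration k (D.gen β n) OGen.deg).F d ≤
      Submodule.span k (D.pbwElement β red '' {t | (red t.1).length ≤ d}) := by
  induction d using Nat.strong_induction_on with
  | _ d ih =>
    refine Submodule.span_le.mpr ?_
    rintro _ ⟨L, hL, rfl⟩
    have hmono : ∀ {e : ℕ}, e ≤ d →
        Submodule.span k (D.pbwElement β red '' {t | (red t.1).length ≤ e}) ≤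
        Submodule.span k (D.pbwElement β red '' {t | (red t.1).length ≤ d}) := fun h =>
      Submodule.span_mono (Set.image_mono fun t (ht : _ ≤ _) => ht.trans h)
    have hL' := list_prod_mem_degFiltration (k := k) (D.gen β n) OGen.deg L
    rcases hL.lt_or_eq with hL | rfl
    · exact hmono hL.le (ih _ hL hL')
    · obtain ⟨b, hb, hb', e⟩ := D.exists_symbol_of_mem_nilSpan hΨ (D.prod_nilGen_mem hred L)
      rw [D.map_prod_nilGen hΨ, AlgFiltration.symbol_eq_iff] at e
      have hb₁ : b ∈ Submodule.span k
          (D.pbwElement β red '' {t | (red t.1).length ≤ (L.map OGen.deg).sum}) := by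
        refine Submodule.span_mono (Set.image_mono ?_) hb
        intro t ht
        exact le_of_eq ht
      rw [SetLike.mem_coe, ← sub_add_cancel (L.map (D.gen β n)).prod b]
      refine Submodule.add_mem _ ?_ hb₁
      clear hb₁ hb hb'
      generalize (L.map (D.gen β n)).prod - b = c at e
      generalize (L.map OGen.deg).sum = d at e ih hmono
      cases d with
      | zero =>
        have : c = 0 := e
        rw [this]
        exact Submodule.zero_mem _
      | succ d => exact hmono (Nat.le_succ d) (ih d (Nat.lt_succ_self d) e)

theorem span_pbwElement (hred : IsReducedChoice red)
    (hΨ : ∀ s, Ψ (D.nilGen β n s) = D.sym β n s) :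
    Submodule.span k (Set.range (D.pbwElement β red)) = ⊤ := by
  rw [eq_top_iff, ← span_prod_eq_top (D.mkO β n) (RingQuot.mkAlgHom_surjective k _)]
  refine Submodule.span_le.mpr ?_
  rintro _ ⟨L, rfl⟩
  exact Submodule.span_mono (Set.image_subset_range _ _)
    (D.filtration_le_span hred hΨ _ (list_prod_mem_degFiltration (D.gen β n) OGen.deg L))

theorem map_nilPiece (hΨ : ∀ s, Ψ (D.nilGen β n s) = D.sym β n s) (d : ℕ) :
    (D.nilPiece β n d).map Ψ.toLinearMap =
      (degFiltration k (D.gen β n) OGen.deg).grPiece d := by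
  apply le_antisymm
  · rw [nilPiece, spanDegEq, Submodule.map_span, Submodule.span_le]
    rintro _ ⟨_, ⟨L, rfl, rfl⟩, rfl⟩
    exact ⟨_, (D.map_prod_nilGen hΨ L).symm⟩
  · rintro _ ⟨y, rfl⟩
    obtain ⟨⟨a, ha⟩, rfl⟩ := AlgFiltration.proj_surjective _ d y
    change (degFiltration k (D.gen β n) OGen.deg).symbolₗ d ⟨a, ha⟩ ∈ _
    induction ha using Submodule.span_induction with
    | zero =>
      have h0 := map_zero ((degFiltration k (D.gen β n) OGen.deg).symbolₗ d)
      exact Set.mem_of_eq_of_mem h0 (Submodule.zero_mem _)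
    | add x y hx hy h h' =>
      have := Submodule.add_mem _ h h'
      rwa [← map_add] at this
    | smul c x hx h =>
      have := Submodule.smul_mem _ c h
      rwa [← map_smul] at this
    | mem a ha =>
      obtain ⟨L, hL, rfl⟩ := ha
      rcases hL.lt_or_eq with hL | rfl
      · have : (degFiltration k (D.gen β n) OGen.deg).symbolₗ d ⟨_, Submodule.subset_span
            ⟨L, hL.le, rfl⟩⟩ = 0 := by
          refine ((degFiltration k (D.gen β n) OGen.deg).symbol_eq_zero_iff
            (Submodule.subset_span ⟨L, hL.le, rfl⟩)).mpr ?_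
          obtain ⟨e, rfl⟩ := Nat.exists_eq_succ_of_ne_zero (Nat.ne_zero_of_lt hL)
          exact Submodule.subset_span ⟨L, Nat.le_of_lt_succ hL, rfl⟩
        exact this ▸ Submodule.zero_mem _
      · exact ⟨(L.map (D.nilGen β n)).prod, Submodule.subset_span ⟨L, rfl, rfl⟩,
          D.map_prod_nilGen hΨ L⟩

theorem surjective_of_map_nilGen (hΨ : ∀ s, Ψ (D.nilGen β n s) = D.sym β n s) :
    Function.Surjective Ψ := by
  intro y
  induction y using DirectSum.induction_on with
  | zero => exact ⟨0, map_zero _⟩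
  | of d y =>
    have h : DirectSum.lof k ℕ _ d y ∈ (degFiltration k (D.gen β n) OGen.deg).grPiece d :=
      ⟨y, rfl⟩
    rw [← D.map_nilPiece hΨ] at h
    obtain ⟨x, -, hx⟩ := h
    exact ⟨x, hx⟩
  | add y y' h h' =>
    obtain ⟨x, rfl⟩ := h
    obtain ⟨x', rfl⟩ := h'
    exact ⟨x + x', map_add _ _ _⟩

/-- Ψ carries a spanning family to the symbols of the PBW elements, and these are linearly
independent because the PBW elements are and are adapted to the filtration. -/
theorem injective_of_map_nilGen (hred : IsReducedChoice red)
    (hΨ : ∀ s, Ψ (D.nilGen β n s) = D.sym β n s)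
    (hli : LinearIndependent k (D.pbwElement β red)) : Function.Injective Ψ := by
  have h1 := AlgFiltration.linearIndependent_symbol (degFiltration k (D.gen β n) OGen.deg) hli
    (fun t => (red t.1).length) D.pbwElement_mem (D.filtration_le_span hred hΨ)
  rw [injective_iff_map_eq_zero]
  intro y hy
  have hy' : y ∈ Submodule.span k (Set.range (D.nilPBW β red)) := by
    rw [D.span_nilPBW hred]
    trivial
  obtain ⟨c, rfl⟩ := (Finsupp.mem_span_range_iff_exists_finsupp).mp hy'
  rw [Finsupp.sum, map_sum] at hy
  simp only [map_smul, D.map_nilPBW hΨ] at hy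
  have h2 := linearIndependent_iff'.mp h1 _ _ hy
  exact Finset.sum_eq_zero fun t ht => by simp only [h2 t ht, zero_smul]

end

theorem PerfectAlong.hasPBWBasis {D : CoeffDatum k J} (hP : D.PerfectAlong β n)
    (hM1 : D.MatRegular) (hM2 : D.MatThetaSymmetric)
    (hM3 : D.MatNonvanishing) (hV1 : D.VecRegular) (hV2 : D.VecNonvanishing)
    (hred : IsReducedChoice red) : D.HasPBWBasis β red := by
  obtain ⟨Ψ, hΨ⟩ := D.exists_nilSmash_algHom_gr hP hM2
  exact ⟨linearIndependent_pbwElement hP hM1 hM2 hM3 hV1 hV2 hred, D.span_pbwElement hred hΨ⟩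

theorem PerfectAlong.canonicalPBWProperty {D : CoeffDatum k J} (hP : D.PerfectAlong β n)
    (hM1 : D.MatRegular) (hM2 : D.MatThetaSymmetric)
    (hM3 : D.MatNonvanishing) (hV1 : D.VecRegular) (hV2 : D.VecNonvanishing)
    (hred : IsReducedChoice red) : D.CanonicalPBWProperty β n := by
  obtain ⟨Ψ, hΨ⟩ := D.exists_nilSmash_algHom_gr hP hM2
  let e := AlgEquiv.ofBijective Ψ ⟨D.injective_of_map_nilGen hred hΨ
    (linearIndependent_pbwElement hP hM1 hM2 hM3 hV1 hV2 hred), D.surjective_of_map_nilGen hΨ⟩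
  have he : ∀ y, e.symm (Ψ y) = y := fun y => e.symm_apply_apply y
  refine ⟨e.symm, fun d => ?_, fun s => ?_⟩
  · change Submodule.map _ ((degFiltration k (D.gen β n) OGen.deg).grPiece d) = _
    rw [← D.map_nilPiece hΨ]
    ext y
    constructor
    · rintro ⟨_, ⟨x, hx, rfl⟩, rfl⟩
      have : e.symm.toLinearMap (Ψ.toLinearMap x) = x := he x
      exact Set.mem_of_eq_of_mem this hx
    · intro hy
      exact ⟨_, ⟨y, hy, rfl⟩, he y⟩
  · rw [← he (D.nilGen β n s), hΨ s]
    rfl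

end CoeffDatum

/-- A surjective endomorphism of a Noetherian ring is injective. -/
theorem IsNoetherianRing.injective_of_surjective_ringHom {R : Type*} [CommRing R]
    [IsNoetherianRing R] (f : R →+* R) (hf : Function.Surjective f) : Function.Injective f := by
  have hpow : ∀ (m : ℕ) (x : R), (f ^ (m + 1)) x = f ((f ^ m) x) := fun m x => by
    rw [pow_succ']
    rfl
  obtain ⟨m, hm⟩ := monotone_stabilizes_iff_noetherian.mpr ‹IsNoetherianRing R›
    ⟨fun m => RingHom.ker (f ^ m), monotone_nat_of_le_succ fun m x hx => by
      rw [RingHom.mem_ker] at hx ⊢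
      rw [hpow, hx, map_zero]⟩
  rw [injective_iff_map_eq_zero]
  intro x hx
  have hsurj : ∀ m : ℕ, Function.Surjective ⇑(f ^ m) := fun m => by
    induction m with
    | zero => exact Function.surjective_id
    | succ m ih =>
      have : ⇑(f ^ (m + 1)) = f ∘ (f ^ m) := funext (hpow m)
      rw [this]
      exact hf.comp ih
  -- An element of the kernel is written as f^m(y). Then y lies in the kernel of f^(m+1), which is
  -- that of f^m, so the element is 0.
  obtain ⟨y, rfl⟩ := hsurj m x
  rw [← hpow, ← RingHom.mem_ker] at hx
  have h := hm (m + 1) (Nat.le_succ m)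
  have h' : RingHom.ker (f ^ m) = RingHom.ker (f ^ (m + 1)) := h
  rw [← h'] at hx
  exact hx

/-! ### Perfectness from faithfulness of the polynomial subalgebra -/

namespace CoeffDatum

variable {k J : Type*} [Field k] (D : CoeffDatum k J) {β : J →₀ ℕ} {n : ℕ}

theorem subst₂_X_injective {σ : Type*} {a b : σ} (hab : a ≠ b) :
    Function.Injective fun f : MvPolynomial (Fin 2) k =>
      subst₂ f (MvPolynomial.X a) (MvPolynomial.X b) := by
  have h : (fun f : MvPolynomial (Fin 2) k => subst₂ f (MvPolynomial.X a) (MvPolynomial.X b)) =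
      MvPolynomial.rename ![a, b] := by
    funext f
    rw [subst₂, MvPolynomial.rename_eq_aeval]
    congr 2
    funext i
    fin_cases i <;> rfl
  rw [h]
  refine MvPolynomial.rename_injective _ fun i j hij => ?_
  fin_cases i <;> fin_cases j <;> simp_all [eq_comm]

theorem aeval_X_injective {σ : Type*} (a : σ) :
    Function.Injective (Polynomial.aeval (R := k) (MvPolynomial.X a : MvPolynomial σ k)) :=
  transcendental_iff_injective.mp (MvPolynomial.transcendental_X k a)

variable (β n) in
/-- The polynomial subalgebra acts faithfully: `p e(ν) = 0` only for `p = 0`. -/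
def PolyFaithful : Prop :=
  ∀ (ν : D.IsoComp β n) (p : MvPolynomial (Fin n) k),
    D.evalO β n p * D.gen β n (OGen.e ν) = 0 → p = 0

theorem gen_e_mul_evalO (ν : D.IsoComp β n) (p : MvPolynomial (Fin n) k) :
    D.gen β n (OGen.e ν) * D.evalO β n p = D.evalO β n p * D.gen β n (OGen.e ν) := by
  induction p using MvPolynomial.induction_on with
  | C c =>
    rw [← MvPolynomial.algebraMap_eq, AlgHom.commutes]
    exact (Algebra.commutes c _).symm
  | add p q hp hq => rw [map_add, mul_add, add_mul, hp, hq]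
  | mul_X p l hp =>
    have h : D.gen β n (OGen.x l) * D.gen β n (OGen.e ν) =
        D.gen β n (OGen.e ν) * D.gen β n (OGen.x l) := by
      simpa only [map_mul, mkO_ι] using (Rel.x_e l ν).mkO_eq
    rw [map_mul, evalO_X, ← mul_assoc, hp, mul_assoc, mul_assoc, h]

theorem gen_tau_mul_evalO_mul_e {r : Fin n} {ν : D.IsoComp β n}
    (S : MvPolynomial (Fin n) k →ₐ[k] MvPolynomial (Fin n) k)
    (hS : ∀ l, D.gen β n (OGen.tau r) * D.gen β n (OGen.x l) * D.gen β n (OGen.e ν) =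
      D.evalO β n (S (MvPolynomial.X l)) * D.gen β n (OGen.tau r) * D.gen β n (OGen.e ν))
    (p : MvPolynomial (Fin n) k) :
    D.gen β n (OGen.tau r) * D.evalO β n p * D.gen β n (OGen.e ν) =
      D.evalO β n (S p) * D.gen β n (OGen.tau r) * D.gen β n (OGen.e ν) := by
  induction p using MvPolynomial.induction_on with
  | C c =>
    rw [← MvPolynomial.algebraMap_eq, AlgHom.commutes, AlgHom.commutes, AlgHom.commutes,
      Algebra.commutes c (D.gen β n (OGen.tau r))]
  | add p q hp hq => rw [map_add, map_add, map_add, mul_add, add_mul, hp, hq, add_mul, add_mul]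
  | mul_X p l hp =>
    have hx := D.gen_e_mul_evalO ν (MvPolynomial.X l)
    rw [evalO_X] at hx
    calc _ = D.gen β n (OGen.tau r) * D.evalO β n p * D.gen β n (OGen.e ν) *
          D.gen β n (OGen.x l) := by
            rw [map_mul, evalO_X, mul_assoc _ (D.gen β n (OGen.e ν)), hx]
            simp only [mul_assoc]
      _ = D.evalO β n (S p) * (D.gen β n (OGen.tau r) * D.gen β n (OGen.x l) *
          D.gen β n (OGen.e ν)) := by
            rw [hp, mul_assoc _ (D.gen β n (OGen.e ν)), hx]
            simp only [mul_assoc]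
      _ = _ := by
            rw [hS, map_mul, map_mul]
            simp only [mul_assoc]

/-- The two ways of computing `τ_r ^ 3` give an identity between the coefficients. -/
theorem PolyFaithful.eq_of_sq {D : CoeffDatum k J} (h : D.PolyFaithful β n) {r : Fin n}
    {ν : D.IsoComp β n} (S : MvPolynomial (Fin n) k →ₐ[k] MvPolynomial (Fin n) k)
    (hS : ∀ l, D.gen β n (OGen.tau r) * D.gen β n (OGen.x l) * D.gen β n (OGen.e ν) =
      D.evalO β n (S (MvPolynomial.X l)) * D.gen β n (OGen.tau r) * D.gen β n (OGen.e ν))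
    {p q : MvPolynomial (Fin n) k}
    (hp : D.gen β n (OGen.tau r) * D.gen β n (OGen.tau r) * D.gen β n (OGen.e ν) =
      D.evalO β n p * D.gen β n (OGen.e ν))
    (hq : D.gen β n (OGen.tau r) * D.gen β n (OGen.tau r) * D.gen β n (OGen.e (D.refl r ν)) =
      D.evalO β n q * D.gen β n (OGen.e (D.refl r ν)))
    (hq0 : q ≠ 0) : S p = q := by
  have h1 : D.evalO β n (S p) * D.gen β n (OGen.tau r) * D.gen β n (OGen.e ν) =
      D.evalO β n q * D.gen β n (OGen.tau r) * D.gen β n (OGen.e ν) := by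
    rw [← D.gen_tau_mul_evalO_mul_e S hS, mul_assoc, ← hp, mul_assoc _ _ (D.gen β n (OGen.e ν)),
      gen_tau_mul_e, mul_assoc (D.evalO β n q), gen_tau_mul_e, ← mul_assoc, ← mul_assoc,
      ← mul_assoc, hq, mul_assoc]
  -- A further factor τ_r on the right turns τ_r e(ν) into q e(s_r ν). Faithfulness then gives (S p
  -- - q) q = 0 in a domain.
  have h2 := congrArg (· * D.gen β n (OGen.tau r)) h1
  have h3 : D.gen β n (OGen.e ν) * D.gen β n (OGen.tau r) =
      D.gen β n (OGen.tau r) * D.gen β n (OGen.e (D.refl r ν)) := by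
    rw [gen_tau_mul_e, refl_refl]
  simp only [mul_assoc, h3] at h2
  simp only [← mul_assoc (D.gen β n (OGen.tau r)), hq] at h2
  rw [← mul_assoc, ← mul_assoc, ← map_mul, ← map_mul, ← sub_eq_zero, ← sub_mul, ← map_sub,
    ← sub_mul] at h2
  exact sub_eq_zero.mp ((mul_eq_zero.mp (h _ _ h2)).resolve_right hq0)

/-- For different colours τ_r moves past polynomials without a correction, by the swap of two
variables. `eq_of_sq` says that this swap takes Q_{ij}(x_{k+1}, x_k) to Q_{ji}(x_{k+1}, x_k). For
equal colours both sides are 0. -/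
theorem PolyFaithful.hermitianAt {D : CoeffDatum k J} (h : D.PolyFaithful β n)
    (hM1 : D.MatRegular) (hM3 : D.MatNonvanishing) (ν : D.IsoComp β n) {r : Fin n}
    (hr : (r : ℕ) ≠ 0) : D.HermitianAt (ν.1 (prevIdx r)) (ν.1 r) := by
  by_cases hij : ν.1 (prevIdx r) = ν.1 r
  · rw [HermitianAt, hij, hM1, subst₂, map_zero]
  have hne := prevIdx_ne hr
  have hv1 : (D.refl r ν).1 (prevIdx r) = ν.1 r := by
    rw [refl_val, wordRefl_pos _ hr]
    simp
  have hv2 : (D.refl r ν).1 r = ν.1 (prevIdx r) := by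
    rw [refl_val, wordRefl_pos _ hr]
    simp
  have hq := D.gen_tau_sq_mul_e hr (D.refl r ν)
  rw [hv1, hv2] at hq
  have hq0 : subst₂ (D.Q (ν.1 r) (ν.1 (prevIdx r))) (MvPolynomial.X r)
      (MvPolynomial.X (prevIdx r)) ≠ 0 := by
    intro h0
    refine hM3 _ _ (Ne.symm hij) (subst₂_X_injective hne.symm ?_)
    simpa [subst₂] using h0
  have key := h.eq_of_sq (r := r) (ν := ν)
    (MvPolynomial.aeval fun l => MvPolynomial.X (Equiv.swap (prevIdx r) r l)) (fun l => by
      have h0 := (Rel.mixed_else r hr l ν (fun h => hij h.2)).mkO_eq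
      simp only [map_mul, map_sub, mkO_ι, map_zero, sub_mul, sub_eq_zero] at h0
      rw [h0, MvPolynomial.aeval_X, evalO_X]) (D.gen_tau_sq_mul_e hr ν) hq hq0
  rw [aeval_subst₂] at key
  simp only [MvPolynomial.aeval_X, Equiv.swap_apply_left, Equiv.swap_apply_right] at key
  refine subst₂_X_injective hne (key.trans ?_)
  change _ = MvPolynomial.aeval _ (subst₂ _ _ _)
  rw [aeval_subst₂]
  simp [subst₂]

/-- As in `PolyFaithful.hermitianAt`, with the sign change of x_1 for the swap: it takes Q_i(-x_1)
to Q_{θ(i)}(-x_1). -/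
theorem PolyFaithful.selfConjugateAt_zero {D : CoeffDatum k J} (h : D.PolyFaithful β n)
    (hV1 : D.VecRegular) (hV2 : D.VecNonvanishing) (ν : D.IsoComp β n) {r : Fin n}
    (hr : (r : ℕ) = 0) : D.SelfConjugateAt (ν.1 r) := by
  by_cases hi : D.θ (ν.1 r) = ν.1 r
  · rw [SelfConjugateAt, hi, hV1 _ hi, Polynomial.zero_comp]
  have hv : (D.refl r ν).1 r = D.θ (ν.1 r) := by
    rw [refl_val, wordRefl_zero _ hr, Function.update_self]
  have hcomp : ∀ f : Polynomial k, Polynomial.aeval (-MvPolynomial.X r : MvPolynomial (Fin n) k) f =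
      Polynomial.aeval (MvPolynomial.X r) (f.comp (-Polynomial.X)) := fun f => by
    rw [Polynomial.aeval_comp]
    simp
  have hq := D.gen_tau_zero_sq_mul_e hr (D.refl r ν)
  rw [hv] at hq
  have hq0 : Polynomial.aeval (-MvPolynomial.X r : MvPolynomial (Fin n) k)
      (D.Q' (D.θ (ν.1 r))) ≠ 0 := by
    intro h0
    rw [hcomp] at h0
    have h1 := aeval_X_injective r (h0.trans (map_zero _).symm)
    refine hV2 (D.θ (ν.1 r)) (fun h => hi (D.θ_invol.injective h)) ?_
    have h2 := congrArg (fun f => f.comp (-Polynomial.X)) h1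
    simpa [Polynomial.comp_assoc] using h2
  have key := h.eq_of_sq (r := r) (ν := ν)
    (MvPolynomial.aeval (Function.update MvPolynomial.X r (-MvPolynomial.X r))) (fun l => by
      rw [MvPolynomial.aeval_X]
      by_cases hl : l = r
      · subst hl
        have h0 := (Rel.mixed_zero_ne l hr ν (Ne.symm hi)).mkO_eq
        simp only [map_mul, map_add, mkO_ι, map_zero, add_mul] at h0
        rw [Function.update_self, map_neg, evalO_X, neg_mul, neg_mul]
        exact eq_neg_of_add_eq_zero_left h0
      · have h0 := (Rel.mixed_zero_comm (D := D) (β := β) r hr l hl).mkO_eq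
        simp only [map_mul, mkO_ι] at h0
        rw [Function.update_of_ne hl, h0, evalO_X]) (D.gen_tau_zero_sq_mul_e hr ν) hq hq0
  rw [← Polynomial.aeval_algHom_apply] at key
  simp only [map_neg, MvPolynomial.aeval_X, Function.update_self, neg_neg] at key
  exact aeval_X_injective r (key.trans (hcomp _))

/-- Permutation of the entries of an isotropic composition. -/
def IsoComp.permute {D : CoeffDatum k J} (ν : D.IsoComp β n) (π : Equiv.Perm (Fin n)) :
    D.IsoComp β n :=
  ⟨ν.1 ∘ π, (Equiv.sum_comp π
    (fun l => Finsupp.single (ν.1 l) 1 + Finsupp.single (D.θ (ν.1 l)) 1)).trans ν.2⟩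

theorem PolyFaithful.perfectAlong {D : CoeffDatum k J} (h : D.PolyFaithful β n)
    (hM1 : D.MatRegular) (hM3 : D.MatNonvanishing) (hV1 : D.VecRegular)
    (hV2 : D.VecNonvanishing) : D.PerfectAlong β n := by
  refine ⟨fun ν r hr => h.hermitianAt hM1 hM3 ν hr, fun ν r => ?_⟩
  -- τ_0 involves only the first entry of a composition, but any entry can be moved there by a
  -- permutation, which preserves β.
  have := h.selfConjugateAt_zero hV1 hV2 (ν.permute (Equiv.swap ⟨0, r.pos⟩ r)) (r := ⟨0, r.pos⟩) rfl
  simpa [IsoComp.permute] using this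

/-- The trivial element has the empty word as its reduced expression, so the x^a e(ν) are among the
basis elements. -/
theorem HasPBWBasis.polyFaithful {D : CoeffDatum k J} {red : WeylB n → List (Fin n)}
    (hred : IsReducedChoice red) (h : D.HasPBWBasis β red) : D.PolyFaithful β n := by
  intro ν p hp
  have hinj : Function.Injective fun a : Fin n →₀ ℕ =>
      (((1 : WeylB n), ⇑a, ν) : WeylB n × (Fin n → ℕ) × D.IsoComp β n) := fun a b hab => by
    simpa using hab
  have hli := linearIndependent_iff'.mp (h.1.comp _ hinj) p.support (fun a => p.coeff a) (by
    rw [← mkO_fpoly, map_ordEval, ordEval, Finset.sum_mul] at hp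
    rw [← hp]
    refine Finset.sum_congr rfl fun a _ => ?_
    rw [smul_mul_assoc]
    simp only [Function.comp_apply, pbwElement, red_one hred, List.map_nil, List.prod_nil, one_mul]
    rfl)
  ext a
  by_cases ha : a ∈ p.support
  · simpa using hli a ha
  · simpa using ha

/-! ### Faithfulness from the PBW property -/

variable (β n) in
/-- The algebra `⨁_ν k[x_1, …, x_n]`. -/
abbrev PolyAlg : Type _ := D.IsoComp β n → MvPolynomial (Fin n) k

theorem gen_e_mul_e [DecidableEq (D.IsoComp β n)] (ν μ : D.IsoComp β n) :
    D.gen β n (OGen.e ν) * D.gen β n (OGen.e μ) = if ν = μ then D.gen β n (OGen.e ν) else 0 := by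
  split_ifs with h
  · subst h
    simpa only [map_mul, mkO_ι] using (Rel.e_mul_self ν).mkO_eq
  · simpa only [map_mul, mkO_ι, map_zero] using (Rel.e_mul_ne ν μ h).mkO_eq

variable (β n) in
/-- The homomorphism `∑_ν p_ν ↦ ∑_ν p_ν(x) e(ν)`. -/
noncomputable def polyHom : D.PolyAlg β n →ₐ[k] D.OKLR β n :=
  AlgHom.ofLinearMap
    { toFun := fun p => ∑ ν, D.evalO β n (p ν) * D.gen β n (OGen.e ν)
      map_add' := fun p q => by
        simp only [Pi.add_apply, map_add, add_mul, Finset.sum_add_distrib]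
      map_smul' := fun c p => by
        simp only [Pi.smul_apply, map_smul, smul_mul_assoc, Finset.smul_sum, RingHom.id_apply] }
    (by simp [sum_gen_e])
    (fun p q => by
      classical
      simp only [LinearMap.coe_mk, AddHom.coe_mk, Finset.sum_mul_sum]
      refine Finset.sum_congr rfl fun ν _ => ?_
      rw [Finset.sum_eq_single ν]
      · rw [Pi.mul_apply, map_mul, mul_assoc (D.evalO β n (p ν)) (D.gen β n _),
          ← mul_assoc (D.gen β n _), gen_e_mul_evalO, mul_assoc (D.evalO β n (q ν)), gen_e_mul_e,
          if_pos rfl, mul_assoc]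
      · intro μ _ hμ
        rw [mul_assoc (D.evalO β n (p ν)), ← mul_assoc (D.gen β n _),
          gen_e_mul_evalO, mul_assoc (D.evalO β n (q μ)), gen_e_mul_e, if_neg hμ.symm, mul_zero,
          mul_zero]
      · intro h
        exact absurd (Finset.mem_univ ν) h)

theorem polyHom_apply (p : D.PolyAlg β n) :
    D.polyHom β n p = ∑ ν, D.evalO β n (p ν) * D.gen β n (OGen.e ν) := rfl

theorem polyHom_single [DecidableEq (D.IsoComp β n)] (ν : D.IsoComp β n)
    (p : MvPolynomial (Fin n) k) :
    D.polyHom β n (Pi.single ν p) = D.evalO β n p * D.gen β n (OGen.e ν) := by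
  rw [polyHom_apply, Finset.sum_eq_single ν]
  · rw [Pi.single_eq_same]
  · intro μ _ hμ
    rw [Pi.single_eq_of_ne hμ, map_zero, zero_mul]
  · intro h
    exact absurd (Finset.mem_univ ν) h

theorem polyHom_mem (p : D.PolyAlg β n) : D.polyHom β n p ∈ (D.filtration β n).F 0 :=
  Submodule.sum_mem _ fun ν _ => D.evalO_mul_e_mem _ ν

/-- A product of generators of total degree 0 contains no τ_r. -/
theorem mem_range_polyHom {a : D.OKLR β n} (ha : a ∈ (D.filtration β n).F 0) :
    a ∈ (D.polyHom β n).range := by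
  classical
  change a ∈ Subalgebra.toSubmodule (D.polyHom β n).range
  refine Submodule.span_le.mpr ?_ ha
  rintro _ ⟨L, hL, rfl⟩
  refine Subalgebra.list_prod_mem _ fun y hy => ?_
  obtain ⟨s, hs, rfl⟩ := List.mem_map.mp hy
  have h0 : s.deg = 0 := by
    have := List.single_le_sum (fun _ _ => Nat.zero_le _) s.deg (List.mem_map_of_mem hs)
    omega
  cases s with
  | e ν => exact ⟨Pi.single ν 1, 
      (D.polyHom_single ν 1).trans (by rw [map_one, one_mul])⟩
  | x l =>
    refine ⟨fun _ => MvPolynomial.X l, (D.polyHom_apply _).trans ?_⟩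
    rw [ ← Finset.mul_sum, sum_gen_e, mul_one, evalO_X]
  | tau r => exact absurd h0 one_ne_zero

variable (β n) in
/-- The images of the generators under the projection of the semidirect product that sends `T_r`
to `0`. -/
noncomputable def polyGen [DecidableEq (D.IsoComp β n)] : OGen (D.IsoComp β n) n → D.PolyAlg β n
  | OGen.e ν => Pi.single ν 1
  | OGen.x l => fun _ => MvPolynomial.X l
  | OGen.tau _ => 0

theorem polyGen_rel [DecidableEq (D.IsoComp β n)] {a b : D.Free β n} (h : NilRel D β n a b) :
    FreeAlgebra.lift k (D.polyGen β n) a = FreeAlgebra.lift k (D.polyGen β n) b := by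
  cases h <;>
    try simp only [map_mul, map_neg, map_sum, map_one, map_zero, FreeAlgebra.lift_ι_apply,
      polyGen, zero_mul, mul_zero]
  case e_mul_self ν => rw [← Pi.single_mul, mul_one]
  case e_mul_ne ν μ h =>
    funext κ
    by_cases hκ : κ = ν
    · subst hκ
      simp [Pi.single_eq_of_ne h]
    · simp [Pi.single_eq_of_ne hκ]
  case e_sum => exact Finset.univ_sum_single (1 : D.PolyAlg β n)
  case x_e l ν => exact mul_comm _ _
  case x_x l l' => exact mul_comm _ _
  case braid r s =>
    -- No entry of the Coxeter matrix is 0, so both braid words contain some T_r and are mapped to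
    -- 0.
    have hm : 0 < coxB n r s := ((weylSystem_hasExactOrders n) r s).1
    have key : ∀ r' s' : Fin n, FreeAlgebra.lift k (D.polyGen β n)
        ((CoxeterSystem.alternatingWord r' s' (coxB n r s)).map (D.ft β)).prod = 0 := by
      intro r' s'
      obtain ⟨m, hm⟩ := Nat.exists_eq_succ_of_ne_zero hm.ne'
      rw [hm, CoxeterSystem.alternatingWord, List.concat_eq_append, List.map_append,
        List.prod_append, map_mul]
      simp [polyGen]
    rw [key, key]

theorem exists_nilSmash_algHom_polyAlg [DecidableEq (D.IsoComp β n)] :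
    ∃ χ : D.NilSmash β n →ₐ[k] D.PolyAlg β n, ∀ s, χ (D.nilGen β n s) = D.polyGen β n s := by
  refine ⟨RingQuot.liftAlgHom k ⟨FreeAlgebra.lift k (D.polyGen β n),
    fun _ _ h => D.polyGen_rel h⟩, fun s => ?_⟩
  rw [nilGen]
  erw [RingQuot.liftAlgHom_mkAlgHom_apply]
  rw [FreeAlgebra.lift_ι_apply]

variable (β n) in
/-- The homomorphism from `⨁_ν k[x_1, …, x_n]` to the component of degree zero of the associated
graded algebra. -/
noncomputable def polyHomGr : D.PolyAlg β n →ₐ[k] (D.filtration β n).Gr :=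
  AlgHom.ofLinearMap
    ((D.filtration β n).symbolₗ 0 ∘ₗ
      (D.polyHom β n).toLinearMap.codRestrict _ D.polyHom_mem)
    (by
      rw [← AlgFiltration.symbol_one]
      exact AlgFiltration.symbol_congr _ rfl (map_one (D.polyHom β n)) (D.polyHom_mem 1) _)
    (fun p q => by
      refine Eq.trans ?_ ((D.filtration β n).symbol_mul (D.polyHom_mem p) (D.polyHom_mem q)).symm
      exact AlgFiltration.symbol_congr _ rfl (map_mul (D.polyHom β n) p q) (D.polyHom_mem _) _)

theorem polyHomGr_apply (p : D.PolyAlg β n) :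
    D.polyHomGr β n p = (D.filtration β n).symbol 0 (D.polyHom β n p) (D.polyHom_mem p) := rfl

/-- The isomorphism Φ may send symbols to anything of the right degree, so it cannot be evaluated on
generators. But the polynomials map onto degree 0 of gr, Φ maps this onto degree 0 of the semidirect
product, and χ leads from there onto the polynomials. The composite σ is a surjective endomorphism
of a Noetherian ring, thus injective, and σ kills whatever is 0 in the algebra. -/
theorem PBWProperty.polyFaithful {D : CoeffDatum k J} (h : D.PBWProperty β n) :
    D.PolyFaithful β n := by
  classical
  obtain ⟨Φ, hΦ⟩ := h
  obtain ⟨χ, hχ⟩ := D.exists_nilSmash_algHom_polyAlg (β := β) (n := n)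
  let σ : D.PolyAlg β n →ₐ[k] D.PolyAlg β n :=
    (χ.comp (Φ : (D.filtration β n).Gr →ₐ[k] D.NilSmash β n)).comp (D.polyHomGr β n)
  have hgen : ∀ s : OGen (D.IsoComp β n) n, s.deg = 0 → D.polyGen β n s ∈ σ.range := by
    intro s hs
    have h1 : D.nilGen β n s ∈ D.nilPiece β n 0 :=
      Submodule.subset_span ⟨[s], by simpa using hs, by simp⟩
    rw [← hΦ] at h1
    obtain ⟨_, ⟨y, rfl⟩, hy⟩ := h1
    obtain ⟨a, ha, rfl⟩ := AlgFiltration.exists_cls _ y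
    obtain ⟨p, rfl⟩ := D.mem_range_polyHom ha
    refine ⟨p, ?_⟩
    rw [← hχ, ← hy]
    rfl
  have hconst : ∀ f : MvPolynomial (Fin n) k, (fun _ => f : D.PolyAlg β n) ∈ σ.range := by
    intro f
    induction f using MvPolynomial.induction_on with
    | C c => exact σ.range.algebraMap_mem c
    | add p q hp hq => exact σ.range.add_mem hp hq
    | mul_X p l hp => exact σ.range.mul_mem hp (hgen (OGen.x l) rfl)
  have hsurj : Function.Surjective σ := by
    intro q
    have h1 : q = ∑ ν, (fun _ => q ν : D.PolyAlg β n) * D.polyGen β n (OGen.e ν) := by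
      funext μ
      rw [Finset.sum_apply, Finset.sum_eq_single μ]
      · simp [polyGen]
      · intro ν _ hν
        simp [polyGen, Pi.single_eq_of_ne hν.symm]
      · intro h
        exact absurd (Finset.mem_univ μ) h
    rw [h1]
    exact σ.range.sum_mem fun ν _ => σ.range.mul_mem (hconst _) (hgen (OGen.e ν) rfl)
  have hinj := IsNoetherianRing.injective_of_surjective_ringHom (σ : D.PolyAlg β n →+* _) hsurj
  intro ν p hp
  have h0 : σ (Pi.single ν p) = 0 := by
    have h1 : D.polyHomGr β n (Pi.single ν p) = 0 := by
      rw [polyHomGr_apply, AlgFiltration.symbol_eq_zero_iff, polyHom_single, hp]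
      exact Submodule.zero_mem _
    rw [AlgHom.comp_apply, h1, map_zero]
  have h1 := congrFun (hinj (h0.trans (map_zero σ).symm)) ν
  simpa using h1

end CoeffDatum

/-! ### The main theorem -/

namespace CoeffDatum

variable {k J : Type*} [Field k] (D : CoeffDatum k J) {n : ℕ}

/-- The dimension vector of a word. -/
noncomputable def wordDim (ν : Fin n → J) : J →₀ ℕ :=
  ∑ l, (Finsupp.single (ν l) 1 + Finsupp.single (D.θ (ν l)) 1)

theorem isSelfDual_wordDim (ν : Fin n → J) : D.IsSelfDual (D.wordDim ν) n := by
  classical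
  refine ⟨fun i => ?_, fun i hi => ?_, ?_⟩
  · simp only [wordDim, Finsupp.finsetSum_apply, Finsupp.add_apply]
    refine Finset.sum_congr rfl fun l _ => ?_
    have h1 : D.θ (ν l) = i ↔ ν l = D.θ i :=
      ⟨fun h => by rw [← h, D.θ_invol], fun h => by rw [h, D.θ_invol]⟩
    have h2 : D.θ (ν l) = D.θ i ↔ ν l = i := D.θ_invol.injective.eq_iff
    simp only [Finsupp.single_apply, h1, h2]
    exact add_comm _ _
  · simp only [wordDim, Finsupp.finsetSum_apply, Finsupp.add_apply]
    refine Finset.even_sum _ fun l _ => ?_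
    have h1 : D.θ (ν l) = i ↔ ν l = i :=
      ⟨fun h => by rw [← D.θ_invol (ν l), h, hi], fun h => by rw [h, hi]⟩
    simp only [Finsupp.single_apply, h1]
    exact Even.add_self _
  · rw [wordDim, map_sum]
    simp [mul_comm]

theorem perfect_of_perfectAlong (hM1 : D.MatRegular) (hM2 : D.MatThetaSymmetric)
    (hM3 : D.MatNonvanishing) (hV1 : D.VecRegular) (hV2 : D.VecNonvanishing) (hn : 2 ≤ n)
    (h : ∀ β : J →₀ ℕ, D.IsSelfDual β n → D.PerfectAlong β n) : D.MatPerfect ∧ D.VecPerfect := by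
  have key : ∀ i j, D.HermitianAt i j ∧ D.SelfConjugateAt i := by
    intro i j
    -- The word i j j ⋯ j has `i` and `j` as consecutive entries because n ≥ 2, and its dimension
    -- vector is one of the admissible β.
    let ν : D.IsoComp (D.wordDim fun l : Fin n => if (l : ℕ) = 0 then i else j) n := ⟨_, rfl⟩
    have hP := h _ (D.isSelfDual_wordDim fun l : Fin n => if (l : ℕ) = 0 then i else j)
    have h1 := hP.1 ν ⟨1, by omega⟩ one_ne_zero
    have h2 := hP.2 ν ⟨0, by omega⟩
    exact ⟨h1, h2⟩
  exact ⟨⟨hM1, hM2, hM3, fun i j => (key i j).1⟩, hV1, hV2, fun i => (key i i).2⟩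

theorem perfectAlong_of_perfect (hM : D.MatPerfect) (hV : D.VecPerfect) (β : J →₀ ℕ) :
    D.PerfectAlong β n :=
  ⟨fun _ _ _ => hM.2.2.2 _ _, fun _ _ => hV.2.2 _⟩

end CoeffDatum

theorem mainTheorem7 {k J : Type*} [Field k] (D : CoeffDatum k J)
    (hM1 : D.MatRegular) (hM2 : D.MatThetaSymmetric) (hM3 : D.MatNonvanishing)
    (hV1 : D.VecRegular) (hV2 : D.VecNonvanishing)
    (n : ℕ) (hn : 1 ≤ n) (red : WeylB n → List (Fin n)) (hred : IsReducedChoice red) :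
    (∀ β : J →₀ ℕ, D.IsSelfDual β n →
      List.TFAE [D.PBWProperty β n, D.CanonicalPBWProperty β n, D.HasPBWBasis β red,
        D.PerfectAlong β n]) ∧
    (2 ≤ n →
      List.TFAE [∀ β : J →₀ ℕ, D.IsSelfDual β n → D.PBWProperty β n,
        ∀ β : J →₀ ℕ, D.IsSelfDual β n → D.CanonicalPBWProperty β n,
        ∀ β : J →₀ ℕ, D.IsSelfDual β n → D.HasPBWBasis β red,
        D.MatPerfect ∧ D.VecPerfect]) := by
  have h41 : ∀ β : J →₀ ℕ, D.PerfectAlong β n → D.CanonicalPBWProperty β n := fun β hP =>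
    hP.canonicalPBWProperty hM1 hM2 hM3 hV1 hV2 hred
  have h43 : ∀ β : J →₀ ℕ, D.PerfectAlong β n → D.HasPBWBasis β red := fun β hP =>
    hP.hasPBWBasis hM1 hM2 hM3 hV1 hV2 hred
  have h21 : ∀ β : J →₀ ℕ, D.CanonicalPBWProperty β n → D.PBWProperty β n :=
    fun β ⟨Φ, hΦ, _⟩ => ⟨Φ, hΦ⟩
  have h14 : ∀ β : J →₀ ℕ, D.PBWProperty β n → D.PerfectAlong β n := fun β h =>
    h.polyFaithful.perfectAlong hM1 hM3 hV1 hV2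
  have h34 : ∀ β : J →₀ ℕ, D.HasPBWBasis β red → D.PerfectAlong β n := fun β h =>
    (h.polyFaithful hred).perfectAlong hM1 hM3 hV1 hV2
  refine ⟨fun β _ => ?_, fun h2 => ?_⟩
  · tfae_have 1 → 4 := h14 β
    tfae_have 4 → 2 := h41 β
    tfae_have 2 → 1 := h21 β
    tfae_have 4 → 3 := h43 β
    tfae_have 3 → 4 := h34 β
    tfae_finish
  · have hperf := D.perfect_of_perfectAlong (n := n) hM1 hM2 hM3 hV1 hV2 h2
    tfae_have 1 → 4 := fun h => hperf fun β hβ => h14 β (h β hβ)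
    tfae_have 4 → 2 := fun h β _ => h41 β (D.perfectAlong_of_perfect h.1 h.2 β)
    tfae_have 2 → 1 := fun h β hβ => h21 β (h β hβ)
    tfae_have 4 → 3 := fun h β _ => h43 β (D.perfectAlong_of_perfect h.1 h.2 β)
    tfae_have 3 → 4 := fun h => hperf fun β hβ => h34 β (h β hβ)
    tfae_finish
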